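/- **Proposition 3.2 (Co-periodic stability).** For $\varepsilon\ge 0$ and $\omega\in[-\tfrac12,\tfrac12]$ put $k=\sqrt{1+2\omega\varepsilon}$. Let $s\in(-\sqrt{27/2},\sqrt{27/2})$. There are $\varepsilon_0>0$ and $r>0$ (depending on $s$) such that the following two statements hold. (a) For all $\varepsilon\in[0,\varepsilon_0)$ and $\omega\in[-\tfrac12,\tfrac12]$ there is exactly one function $u=\tilde u_{\varepsilon,\omega,s}\in H^6_{per}([0,2\pi],\mathbb R)$ with $\|u\|_{H^6_{per}}<r$ which is even, has mean value zero, solves, for some constant $q\in\mathbb R$, $$-k^2\left[-(1+k^2\partial_\xi^2)^2u+\varepsilon^2u-su^2-u^3\right]=q ,$$ satisfies $u(0)>0$ if $\varepsilon>0$ and $|\omega|<\tfrac12$, and is $u\equiv0$ if $\varepsilon=0$ or $|\omega|=\tfrac12$. (b) Let $B(\varepsilon,\omega,s,0)$ be the operator on $L^2_{per}([0,2\pi],\mathbb C)$ with domain $H^6_{per}([0,2\pi],\mathbb C)$ given by $$B(\varepsilon,\omega,s,0)V=-k^2\partial_\xi^2\left[-(1+k^2\partial_\xi^2)^2+\varepsilon^2-2s\tilde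 u_{\varepsilon,\omega,s}-3\tilde u_{\varepsilon,\omega,s}^2\right]V .$$ There are $\tilde\varepsilon_0\in(0,\varepsilon_0)$, $\delta>0$ and $C$ (depending only on $s$) such that for all $\varepsilon\in[0,\tilde\varepsilon_0]$ and all $\omega\in[-\tfrac12,\tfrac12]$ the spectrum has the decomposition $$\mathrm{Sp}(B(\varepsilon,\omega,s,0))=S\cup\{\lambda_1,\lambda_2,\lambda_3\},$$ where $\Re\lambda<-\delta$ for every $\lambda\in S$, and $\lambda_1,\lambda_2,\lambda_3$ are real with $\lambda_1>-\delta$, $$\left|\lambda_1+2(1-4\omega^2)\varepsilon^2\right|\le C\varepsilon^3,\qquad \lambda_2=0,\qquad \lambda_3=0 .$$ The list $\lambda_1,\lambda_2,\lambda_3$ counts these eigenvalues with algebraic multiplicity: the algebraic multiplicity of each $\mu\in\{\lambda_1,\lambda_2,\lambda_3\}$ (the dimension of $\bigcup_n\ker(B-\mu)^n$) is the number of $j\in\{1,2,3\}$ with $\lambda_j=\mu$. -/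

import Mathlib

open MeasureTheory Complex
open scoped ENNReal

noncomputable section

namespace MatthewsCox

instance instFactTwoPiPos : Fact (0 < 2 * Real.pi) := ⟨Real.two_pi_pos⟩

/-- The circle `ℝ / 2πℤ`. -/
abbrev Circ : Type := AddCircle (2 * Real.pi)

/-- `L²_per([0, 2π]; ℂ)`, with the normalised measure `dξ / 2π`. -/
abbrev L2per : Type := Lp ℂ 2 (AddCircle.haarAddCircle (T := 2 * Real.pi))

/-- The Fourier coefficients `f̂(n) = (1 / 2π) ∫ f(ξ) exp(-i n ξ) dξ`. -/
def coeff (f : L2per) (n : ℤ) : ℂ := fourierCoeff (T := 2 * Real.pi) f n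

theorem coeff_eq_repr (f : L2per) (n : ℤ) :
    coeff f n = fourierBasis (T := 2 * Real.pi).repr f n :=
  (fourierBasis_repr f n).symm

theorem coeff_add (f g : L2per) (n : ℤ) : coeff (f + g) n = coeff f n + coeff g n := by
  simp only [coeff_eq_repr, map_add]; rfl

theorem coeff_smul (c : ℂ) (f : L2per) (n : ℤ) : coeff (c • f) n = c * coeff f n := by
  simp only [coeff_eq_repr, map_smul]; rfl

theorem coeff_zero (n : ℤ) : coeff 0 n = 0 := by
  simp only [coeff_eq_repr, map_zero]; rfl

theorem coeff_ext {f g : L2per} (h : ∀ n, coeff f n = coeff g n) : f = g := by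
  apply (fourierBasis (T := 2 * Real.pi)).repr.injective
  ext n
  rw [← coeff_eq_repr, ← coeff_eq_repr, h n]

theorem summable_coeff_sq (f : L2per) : Summable fun n => ‖coeff f n‖ ^ 2 :=
  (hasSum_sq_fourierCoeff f).summable

/-- The function in `L²_per` with prescribed square summable Fourier coefficients. -/
def ofCoeff (a : ℤ → ℂ) (ha : Summable fun n => ‖a n‖ ^ 2) : L2per :=
  (fourierBasis (T := 2 * Real.pi)).repr.symm
    ⟨a, memℓp_gen (by simpa using ha)⟩

theorem coeff_ofCoeff (a : ℤ → ℂ) (ha : Summable fun n => ‖a n‖ ^ 2) (n : ℤ) :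
    coeff (ofCoeff a ha) n = a n := by
  rw [coeff_eq_repr, ofCoeff, LinearIsometryEquiv.apply_symm_apply]

theorem summable_weight_add {m : ℕ} {a b : ℤ → ℂ}
    (ha : Summable fun n : ℤ => (1 + (n : ℝ) ^ 2) ^ m * ‖a n‖ ^ 2)
    (hb : Summable fun n : ℤ => (1 + (n : ℝ) ^ 2) ^ m * ‖b n‖ ^ 2) :
    Summable fun n : ℤ => (1 + (n : ℝ) ^ 2) ^ m * ‖a n + b n‖ ^ 2 := by
  refine Summable.of_nonneg_of_le (fun n => by positivity) (fun n => ?_)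
    ((ha.add hb).mul_left 2)
  have h1 : ‖a n + b n‖ ^ 2 ≤ 2 * (‖a n‖ ^ 2 + ‖b n‖ ^ 2) := by
    have := norm_add_le (a n) (b n)
    have h0 := norm_nonneg (a n + b n)
    nlinarith [sq_nonneg (‖a n‖ - ‖b n‖)]
  have h2 : 0 ≤ (1 + (n : ℝ) ^ 2) ^ m := by positivity
  nlinarith [mul_le_mul_of_nonneg_left h1 h2]

/-- The periodic Sobolev space `H^m_per([0, 2π]; ℂ)`. -/
def sobolev (m : ℕ) : Submodule ℂ L2per where
  carrier := {f | Summable fun n : ℤ => (1 + (n : ℝ) ^ 2) ^ m * ‖coeff f n‖ ^ 2}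
  zero_mem' := by simp [coeff_zero, summable_zero]
  add_mem' := by
    intro f g hf hg
    simpa only [Set.mem_ofPred_eq, coeff_add] using summable_weight_add hf hg
  smul_mem' := by
    intro c f hf
    simp only [Set.mem_ofPred_eq, coeff_smul] at hf ⊢
    refine (hf.mul_left (‖c‖ ^ 2)).congr fun n => ?_
    rw [norm_mul]; ring

/-- The norm of `H^m_per`. -/
def sobolevNorm (m : ℕ) (f : L2per) : ℝ :=
  Real.sqrt (∑' n : ℤ, (1 + (n : ℝ) ^ 2) ^ m * ‖coeff f n‖ ^ 2)

theorem mem_sobolev {m : ℕ} {f : L2per} :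
    f ∈ sobolev m ↔ Summable fun n : ℤ => (1 + (n : ℝ) ^ 2) ^ m * ‖coeff f n‖ ^ 2 := Iff.rfl

theorem sobolev_anti {m l : ℕ} (h : m ≤ l) : sobolev l ≤ sobolev m := by
  intro f hf
  refine Summable.of_nonneg_of_le (fun n => by positivity) (fun n => ?_) (mem_sobolev.1 hf)
  gcongr
  nlinarith [sq_nonneg (n : ℝ)]

/-- The embedding `H^l_per ⊆ H^m_per` for `m ≤ l`. -/
def incl {m l : ℕ} (h : m ≤ l) : sobolev l →ₗ[ℂ] sobolev m :=
  Submodule.inclusion (sobolev_anti h)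

theorem summable_deriv {m : ℕ} {f : L2per} (hf : f ∈ sobolev (m + 1)) :
    Summable fun n : ℤ => (1 + (n : ℝ) ^ 2) ^ m * ‖I * n * coeff f n‖ ^ 2 := by
  refine Summable.of_nonneg_of_le (fun n => by positivity) (fun n => ?_) (mem_sobolev.1 hf)
  have h1 : ‖I * n * coeff f n‖ ^ 2 = (n : ℝ) ^ 2 * ‖coeff f n‖ ^ 2 := by
    rw [norm_mul, norm_mul, norm_I, one_mul, mul_pow, Complex.norm_intCast, sq_abs]
  rw [h1, pow_succ (1 + (n : ℝ) ^ 2) m, mul_assoc]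
  have h2 : (n : ℝ) ^ 2 * ‖coeff f n‖ ^ 2 ≤ (1 + (n : ℝ) ^ 2) * ‖coeff f n‖ ^ 2 :=
    mul_le_mul_of_nonneg_right (by linarith) (by positivity)
  have h3 : (0 : ℝ) ≤ (1 + (n : ℝ) ^ 2) ^ m := by positivity
  exact mul_le_mul_of_nonneg_left h2 h3

theorem summable_deriv' {m : ℕ} {f : L2per} (hf : f ∈ sobolev (m + 1)) :
    Summable fun n : ℤ => ‖I * n * coeff f n‖ ^ 2 := by
  have := summable_deriv (m := 0) (sobolev_anti (by omega) hf)
  simpa using this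

/-- The (weak) derivative `∂_ξ : H^{m+1}_per → H^m_per`; on Fourier coefficients it is
multiplication by `i n`. -/
def perDeriv (m : ℕ) : sobolev (m + 1) →ₗ[ℂ] sobolev m where
  toFun f := ⟨ofCoeff (fun n => I * n * coeff f n) (summable_deriv' f.2), by
    rw [mem_sobolev]
    simpa only [coeff_ofCoeff] using summable_deriv f.2⟩
  map_add' f g := by
    apply Subtype.ext
    apply coeff_ext
    intro n
    simp only [Submodule.coe_add, coeff_add, coeff_ofCoeff]
    ring
  map_smul' c f := by
    apply Subtype.ext
    apply coeff_ext
    intro n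
    simp only [Submodule.coe_smul, coeff_smul, coeff_ofCoeff, RingHom.id_apply]
    ring

theorem coeff_perDeriv (m : ℕ) (f : sobolev (m + 1)) (n : ℤ) :
    coeff (perDeriv m f : L2per) n = I * n * coeff (f : L2per) n :=
  coeff_ofCoeff _ (summable_deriv' f.2) n

/-- `∂_ξ + iσ : H^{m+1}_per → H^m_per`. -/
def blochDeriv (σ : ℝ) (m : ℕ) : sobolev (m + 1) →ₗ[ℂ] sobolev m :=
  perDeriv m + (I * σ) • incl (Nat.le_succ m)

/-- `(∂_ξ + iσ)² : H^{m+2}_per → H^m_per`. -/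
def blochLap (σ : ℝ) (m : ℕ) : sobolev (m + 2) →ₗ[ℂ] sobolev m :=
  blochDeriv σ m ∘ₗ blochDeriv σ (m + 1)

/-- `1 + k²(∂_ξ + iσ)² : H^{m+2}_per → H^m_per`. -/
def helmholtz (k σ : ℝ) (m : ℕ) : sobolev (m + 2) →ₗ[ℂ] sobolev m :=
  incl (by omega) + ((k : ℂ) ^ 2) • blochLap σ m

/-- `(1 + k²(∂_ξ + iσ)²)² : H^6_per → H^2_per`. -/
def helmholtzSq (k σ : ℝ) : sobolev 6 →ₗ[ℂ] sobolev 2 :=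
  helmholtz k σ 2 ∘ₗ helmholtz k σ 4

/-- A real continuous `2π`-periodic function as a complex one. -/
def toComplex (w : C(Circ, ℝ)) : C(Circ, ℂ) := ⟨fun x => (w x : ℂ), by fun_prop⟩

/-- A real continuous `2π`-periodic function as an element of `L²_per`. -/
def toL2 (w : C(Circ, ℝ)) : L2per :=
  ContinuousMap.toLp 2 AddCircle.haarAddCircle ℂ (toComplex w)

/-- Multiplication by a continuous function, as a bounded operator on `L²_per`, as a function of
the multiplier. -/
def mulC : C(Circ, ℂ) →L[ℂ] L2per →L[ℂ] L2per :=
  ((ContinuousLinearMap.mul ℂ ℂ).holderL AddCircle.haarAddCircle ∞ 2 2).comp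
    (ContinuousMap.toLp ∞ AddCircle.haarAddCircle ℂ)

theorem coeFn_mulC (w : C(Circ, ℂ)) (f : L2per) :
    mulC w f =ᵐ[AddCircle.haarAddCircle] fun x => w x * f x := by
  have h1 := (ContinuousLinearMap.mul ℂ ℂ).coeFn_holder (r := 2)
    (ContinuousMap.toLp ∞ AddCircle.haarAddCircle ℂ w) f
  have h2 := ContinuousMap.coeFn_toLp (p := ∞) (𝕜 := ℂ) (AddCircle.haarAddCircle) w
  filter_upwards [h1, h2] with x hx1 hx2
  rw [← hx2]
  exact hx1

theorem coeff_mulC_fourier (m : ℤ) (f : L2per) (n : ℤ) :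
    coeff (mulC (fourier m) f) n = coeff f (n - m) := by
  unfold coeff
  rw [fourierCoeff_congr_ae (coeFn_mulC _ _)]
  unfold fourierCoeff
  congr 1
  ext x
  rw [show -(n - m) = -n + m by ring, fourier_add, smul_eq_mul, smul_eq_mul, mul_assoc]

/-- The Fourier coefficients of a product are given by convolution. -/
theorem hasSum_coeff_mulC {w : C(Circ, ℂ)} (hw : Summable (fourierCoeff w)) (f : L2per) (n : ℤ) :
    HasSum (fun m : ℤ => fourierCoeff w m * coeff f (n - m)) (coeff (mulC w f) n) := by
  have h1 := hasSum_fourier_series_of_summable hw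
  let Λ : C(Circ, ℂ) →L[ℂ] ℂ :=
    (innerSL ℂ (fourierBasis (T := 2 * Real.pi) n)).comp (mulC.flip f)
  have hΛ : ∀ v, Λ v = coeff (mulC v f) n := by
    intro v
    rw [coeff_eq_repr, HilbertBasis.repr_apply_apply]
    rfl
  have h2 := h1.mapL Λ
  rw [hΛ] at h2
  refine h2.congr_fun ?_
  intro m
  rw [map_smul, hΛ, coeff_mulC_fourier, smul_eq_mul]

theorem norm_ofCoeff_sq (a : ℤ → ℂ) (ha : Summable fun n => ‖a n‖ ^ 2) :
    ‖ofCoeff a ha‖ ^ 2 = ∑' n, ‖a n‖ ^ 2 := by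
  rw [ofCoeff, LinearIsometryEquiv.norm_map]
  have := lp.norm_rpow_eq_tsum (p := 2) (E := fun _ : ℤ => ℂ) (by simp)
    ⟨a, memℓp_gen (by simpa using ha)⟩
  simpa using this

theorem weight_le (n m : ℤ) :
    (1 + (n : ℝ) ^ 2) ≤ 2 * (1 + (m : ℝ) ^ 2) * (1 + ((n - m : ℤ) : ℝ) ^ 2) := by
  push_cast
  nlinarith [sq_nonneg ((n : ℝ) - 2 * m), sq_nonneg ((m : ℝ) * (n - m))]

theorem mulC_mem {w : C(Circ, ℂ)}
    (hw : Summable fun n : ℤ => (1 + (n : ℝ) ^ 2) * ‖fourierCoeff w n‖)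
    {f : L2per} (hf : f ∈ sobolev 2) : mulC w f ∈ sobolev 2 := by
  have hw0 : Summable (fourierCoeff w) := by
    refine Summable.of_norm_bounded hw fun n => ?_
    nlinarith [norm_nonneg (fourierCoeff w n), sq_nonneg (n : ℝ),
      mul_nonneg (sq_nonneg (n : ℝ)) (norm_nonneg (fourierCoeff w n))]
  rw [mem_sobolev] at hf
  set g : ℤ → ℝ := fun n => (1 + (n : ℝ) ^ 2) ^ 2 * ‖coeff f n‖ ^ 2 with hg
  have hshift : ∀ m : ℤ, Summable fun n : ℤ => g (n - m) := fun m =>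
    (Equiv.subRight m).summable_iff.2 hf
  have htsum : ∀ m : ℤ, ∑' n : ℤ, g (n - m) = ∑' n, g n := fun m =>
    (Equiv.subRight m).tsum_eq g
  let b : ℤ → ℤ → ℂ := fun m n => ((1 + (n : ℝ) ^ 2 : ℝ) : ℂ) * coeff f (n - m)
  have hble : ∀ m n, ‖b m n‖ ^ 2 ≤ (2 * (1 + (m : ℝ) ^ 2)) ^ 2 * g (n - m) := by
    intro m n
    have h1 : ‖b m n‖ ^ 2 = (1 + (n : ℝ) ^ 2) ^ 2 * ‖coeff f (n - m)‖ ^ 2 := by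
      rw [norm_mul, mul_pow, Complex.norm_real, Real.norm_of_nonneg (by positivity)]
    rw [h1, hg]
    have h2 := pow_le_pow_left₀ (by positivity) (weight_le n m) 2
    calc _ ≤ (2 * (1 + (m : ℝ) ^ 2) * (1 + ((n - m : ℤ) : ℝ) ^ 2)) ^ 2 * ‖coeff f (n - m)‖ ^ 2 :=
          mul_le_mul_of_nonneg_right h2 (by positivity)
      _ = _ := by ring
  have hb : ∀ m, Summable fun n => ‖b m n‖ ^ 2 := fun m =>
    Summable.of_nonneg_of_le (fun n => by positivity) (hble m) ((hshift m).mul_left _)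
  have hnorm : ∀ m, ‖ofCoeff (b m) (hb m)‖ ≤ 2 * (1 + (m : ℝ) ^ 2) * Real.sqrt (∑' n, g n) := by
    intro m
    have hN : 0 ≤ ∑' n, g n := tsum_nonneg fun n => by positivity
    refine le_of_sq_le_sq ?_ (by positivity)
    rw [norm_ofCoeff_sq, mul_pow, Real.sq_sqrt hN, ← htsum m, ← tsum_mul_left]
    exact (hb m).tsum_le_tsum (hble m) ((hshift m).mul_left _)
  let y : ℤ → L2per := fun m => fourierCoeff w m • ofCoeff (b m) (hb m)
  have hy : Summable y := by
    refine Summable.of_norm_bounded (hw.mul_left (2 * Real.sqrt (∑' n, g n))) fun m => ?_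
    rw [norm_smul]
    calc _ ≤ ‖fourierCoeff w m‖ * (2 * (1 + (m : ℝ) ^ 2) * Real.sqrt (∑' n, g n)) :=
          mul_le_mul_of_nonneg_left (hnorm m) (norm_nonneg _)
      _ = _ := by ring
  have hcoeff : ∀ n, coeff (∑' m, y m) n = ((1 + (n : ℝ) ^ 2 : ℝ) : ℂ) * coeff (mulC w f) n := by
    intro n
    have h1 := hy.hasSum.mapL (innerSL ℂ (fourierBasis (T := 2 * Real.pi) n))
    have hin : ∀ v : L2per, innerSL ℂ (fourierBasis (T := 2 * Real.pi) n) v = coeff v n := by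
      intro v
      rw [coeff_eq_repr, HilbertBasis.repr_apply_apply]
      rfl
    simp only [hin] at h1
    have h2 := (hasSum_coeff_mulC hw0 f n).mul_left ((1 + (n : ℝ) ^ 2 : ℝ) : ℂ)
    refine h1.unique (h2.congr_fun fun m => ?_)
    simp only [y, coeff_smul, coeff_ofCoeff, b]
    ring
  rw [mem_sobolev]
  refine (summable_coeff_sq (∑' m, y m)).congr fun n => ?_
  rw [hcoeff, norm_mul, mul_pow, Complex.norm_real, Real.norm_of_nonneg (by positivity)]

/-- `H^6_per([0, 2π]; ℝ)`, each class being represented by its continuous representative. -/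
def RealH6 : Type := {u : C(Circ, ℝ) // toL2 u ∈ sobolev 6}

theorem coeff_toL2 (w : C(Circ, ℝ)) (n : ℤ) : coeff (toL2 w) n = fourierCoeff (toComplex w) n :=
  fourierCoeff_toLp _ n

theorem summable_coeff_of_mem {w : C(Circ, ℝ)} (hw : toL2 w ∈ sobolev 6) :
    Summable fun n : ℤ => (1 + (n : ℝ) ^ 2) * ‖fourierCoeff (toComplex w) n‖ := by
  have h1 := mem_sobolev.1 (sobolev_anti (show 3 ≤ 6 by norm_num) hw)
  have h2 : Summable fun n : ℤ => 1 / (1 + (n : ℝ) ^ 2) := by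
    have h3 : Summable fun n : ℤ => 1 / |(n : ℝ)| ^ 2 := by
      simpa using Real.summable_one_div_int_pow.2 (show 1 < 2 by norm_num)
    rw [← (Set.finite_singleton (0 : ℤ)).summable_compl_iff] at h3 ⊢
    refine Summable.of_nonneg_of_le
      (fun n => by simp only [Function.comp_apply]; positivity) (fun n => ?_) h3
    have : (n : ℤ) ≠ 0 := n.2
    have h4 : (0 : ℝ) < (((n : ℤ) : ℝ)) ^ 2 := by positivity
    simp only [Function.comp_apply, sq_abs]
    exact one_div_le_one_div_of_le h4 (by linarith)
  refine Summable.of_nonneg_of_le (fun n => by positivity) (fun n => ?_) (h1.add h2)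
  rw [coeff_toL2]
  set p : ℝ := 1 + (n : ℝ) ^ 2 with hp
  have hp0 : 0 < p := by positivity
  set c := ‖fourierCoeff (toComplex w) n‖
  have hc : 0 ≤ c := norm_nonneg _
  have key : p ^ 3 * c ^ 2 + 1 / p - p * c = ((p ^ 2 * c - 1 / 2) ^ 2 + 3 / 4) / p := by
    field_simp
    ring
  have : 0 ≤ ((p ^ 2 * c - 1 / 2) ^ 2 + 3 / 4) / p := by positivity
  linarith

/-- The function `ε² - 2 s u - 3 u²`, the derivative at `u` of `f(u) = ε² u - s u² - u³`. -/
def dfCoeff (s ε : ℝ) (u : C(Circ, ℝ)) : C(Circ, ℝ) :=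
  ContinuousMap.const _ (ε ^ 2) - (2 * s) • u - (3 : ℝ) • u ^ 2

theorem mulC_dfCoeff (s ε : ℝ) (u : C(Circ, ℝ)) (f : L2per) :
    mulC (toComplex (dfCoeff s ε u)) f =
      ((ε : ℂ) ^ 2) • f - (2 * s : ℂ) • mulC (toComplex u) f
        - (3 : ℂ) • mulC (toComplex u) (mulC (toComplex u) f) := by
  apply Lp.ext
  filter_upwards [coeFn_mulC (toComplex (dfCoeff s ε u)) f, coeFn_mulC (toComplex u) f,
    coeFn_mulC (toComplex u) (mulC (toComplex u) f),
    Lp.coeFn_sub (((ε : ℂ) ^ 2) • f - (2 * s : ℂ) • mulC (toComplex u) f)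
      ((3 : ℂ) • mulC (toComplex u) (mulC (toComplex u) f)),
    Lp.coeFn_sub (((ε : ℂ) ^ 2) • f) ((2 * s : ℂ) • mulC (toComplex u) f),
    Lp.coeFn_smul ((ε : ℂ) ^ 2) f, Lp.coeFn_smul (2 * s : ℂ) (mulC (toComplex u) f),
    Lp.coeFn_smul (3 : ℂ) (mulC (toComplex u) (mulC (toComplex u) f))]
    with x h1 h2 h3 h4 h5 h6 h7 h8
  rw [h1, h4, Pi.sub_apply, h5, Pi.sub_apply, h6, h7, h8, Pi.smul_apply, Pi.smul_apply,
    Pi.smul_apply, h3, h2]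
  simp [toComplex, dfCoeff]
  ring

theorem mulC_dfCoeff_mem (s ε : ℝ) (u : RealH6) {f : L2per} (hf : f ∈ sobolev 2) :
    mulC (toComplex (dfCoeff s ε u.1)) f ∈ sobolev 2 := by
  have h := summable_coeff_of_mem u.2
  rw [mulC_dfCoeff]
  exact sub_mem (sub_mem (Submodule.smul_mem _ _ hf) (Submodule.smul_mem _ _ (mulC_mem h hf)))
    (Submodule.smul_mem _ _ (mulC_mem h (mulC_mem h hf)))

/-- Multiplication by `df(u) = ε² - 2 s u - 3 u²` on `H^2_per`. -/
def mulDf (s ε : ℝ) (u : RealH6) : sobolev 2 →ₗ[ℂ] sobolev 2 :=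
  (mulC (toComplex (dfCoeff s ε u.1))).toLinearMap.restrict
    fun _ hf => mulC_dfCoeff_mem s ε u hf

/-- The wave number `k = √(1 + 2ωε)`. -/
def waveNumber (ε ω : ℝ) : ℝ := Real.sqrt (1 + 2 * ω * ε)

/-- The Bloch operator
`B V = -k² (∂_ξ + iσ)² [-(1 + k² (∂_ξ + iσ)²)² + df(u)] V`
as an unbounded operator on `L²_per` with domain `H^6_per`. -/
def blochOp (s ε ω σ : ℝ) (u : RealH6) : L2per →ₗ.[ℂ] L2per where
  domain := sobolev 6
  toFun := (sobolev 0).subtype ∘ₗ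
    ((-(waveNumber ε ω : ℂ) ^ 2) • blochLap σ 0) ∘ₗ
      (-helmholtzSq (waveNumber ε ω) σ + mulDf s ε u ∘ₗ incl (by norm_num))

/-- The equation `-k² [-(1 + k² ∂_ξ²)² u + ε² u - s u² - u³] = q`. -/
def SolvesProfile (s ε ω q : ℝ) (u : RealH6) : Prop :=
  (-(waveNumber ε ω : ℂ) ^ 2) •
      (-(helmholtzSq (waveNumber ε ω) 0 ⟨toL2 u.1, u.2⟩ : L2per)
        + toL2 (ε ^ 2 • u.1 - s • u.1 ^ 2 - u.1 ^ 3)) =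
    toL2 (ContinuousMap.const _ q)

/-- The periodic pattern: an even solution of the profile equation, for some constant `q`, with
mean value zero, which is positive at `ξ = 0` in the interior `ε > 0`, `|ω| < 1/2` of the
parameter range and is the trivial state at its boundary. -/
structure IsPattern (s ε ω : ℝ) (u : RealH6) : Prop where
  profile : ∃ q : ℝ, SolvesProfile s ε ω q u
  mean_zero : ∫ x, u.1 x ∂AddCircle.haarAddCircle = 0
  even : ∀ x, u.1 (-x) = u.1 x
  pos : 0 < ε → |ω| < 1 / 2 → 0 < u.1 0
  trivial_state : ε = 0 ∨ |ω| = 1 / 2 → u.1 = 0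

section Spectrum

variable {E : Type*} [NormedAddCommGroup E] [NormedSpace ℂ E]

/-- `λ` is in the resolvent set of the unbounded operator `T` if `T - λ : dom T → E` has a bounded
everywhere defined two-sided inverse. -/
def resolventSetOf (T : E →ₗ.[ℂ] E) : Set ℂ :=
  {μ | ∃ R : E →L[ℂ] E,
    (∀ f : E, ∃ h : R f ∈ T.domain, T ⟨R f, h⟩ - μ • R f = f) ∧
    ∀ V : T.domain, R (T V - μ • (V : E)) = V}

/-- The spectrum of an unbounded operator. -/
def spectrumOf (T : E →ₗ.[ℂ] E) : Set ℂ := (resolventSetOf T)ᶜ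

/-- `ker (T - μ)^n`, with the natural domain of the power. -/
def genEigenspace (T : E →ₗ.[ℂ] E) (μ : ℂ) : ℕ → Submodule ℂ E
  | 0 => ⊥
  | n + 1 => ((genEigenspace T μ n).comap (T.toFun - μ • T.domain.subtype)).map T.domain.subtype

/-- The algebraic multiplicity of an (isolated) eigenvalue: the dimension of the space
`⋃ n, ker (T - μ)^n` of generalised eigenvectors. -/
def algMultiplicity (T : E →ₗ.[ℂ] E) (μ : ℂ) : ℕ :=
  Module.finrank ℂ ↥(⨆ n, genEigenspace T μ n)

end Spectrum

end MatthewsCox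

end

noncomputable section

namespace MatthewsCox

/-! ### Fourier coefficients and Fourier multipliers -/

/-! The patterns come from a Lyapunov–Schmidt reduction. On mode `n` the linear part of the profile
equation is `ε² - (1 - k² n²)²`. The free constant `q` takes care of mode `0`. The modes `|n| ≥ 2`
are inverted by `greenOp`, uniformly in `ε` and `ω`. The modes `±1` carry the small factor `ε² (1 -
4ω²)` (`linSymbol_one`). With `u = A (cos ξ + A g)` the correction `g` solves a contraction equation
for each small `A` (`exists_fixed`), and there remains the scalar equation `ε² (1 - 4ω²) = A² Γ(A)`
with `Γ = bifCoeff`. At `A = 0` the correction is an explicit multiple of `cos 2ξ`, so `Γ(0)` is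
`3/4 - s²/18` up to `O(ε)`, which is where the condition `s² < 27/2` enters (`bifCoeff_zero_ge`).
The intermediate value theorem solves the scalar equation, the Lipschitz bound on `Γ` makes the
positive solution unique, and every small pattern has this scaled form (`existsUnique_pattern`).

For the spectrum, write `V = R v` with `R = smooth` of order `-6`. The unbounded operator `B - z`
becomes a bounded pencil `L - z R` (`precond_blochOp`). It maps into mean zero functions and
preserves even and odd mean zero functions. In each of these two sectors there is one critical mode,
while the modes `|n| ≥ 2` are uniformly invertible for `Re z ≥ -1`. A Schur complement reduces the
eigenvalue problem to `schur z = z`. The function `schur` is a contraction of that half plane into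
itself, so each sector contains exactly one eigenvalue, and it is simple
(`SchurPencil.exists_eigenvalue`, `SchurPencil.mem_span`, `exists_sector`). The third eigenvalue
comes from the mean; it is `0` because `L` annihilates the mean (`Precond.spectrum`).

The odd eigenvalue on the branch is `0`, because translation invariance puts `u'` in the kernel
(`exists_translation_mode`). The even eigenvalue is real because the potential has real Fourier
coefficients (`Sector.conj_eq`). Its expansion comes from testing with an approximation of `∂u/∂A`
(`ScaledProfile.exists_quasimode`). The residual is `O(A²)` and has no critical component, so it
affects the eigenvalue only through the perturbation of size `O(A)`, and the error is cubic
(`SchurPencil.norm_sub_le`). The Rayleigh quotient is `-2 k² A² Γ + O(A³)`, which the amplitude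
equation turns into `-2 (1 - 4ω²) ε² + O(ε³)`. -/

/-- The `n`-th Fourier coefficient as a bounded functional. -/
def coeffL (n : ℤ) : L2per →L[ℂ] ℂ := innerSL ℂ (fourierBasis (T := 2 * Real.pi) n)

theorem coeffL_apply (n : ℤ) (f : L2per) : coeffL n f = coeff f n := by
  rw [coeff_eq_repr, HilbertBasis.repr_apply_apply]
  rfl

theorem coeff_sub (f g : L2per) (n : ℤ) : coeff (f - g) n = coeff f n - coeff g n := by
  simp only [← coeffL_apply, map_sub]

theorem coeff_neg (f : L2per) (n : ℤ) : coeff (-f) n = -coeff f n := by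
  simp only [← coeffL_apply, map_neg]

theorem norm_sq_eq_tsum (f : L2per) : ‖f‖ ^ 2 = ∑' n, ‖coeff f n‖ ^ 2 := by
  have h : ofCoeff (coeff f) (summable_coeff_sq f) = f := coeff_ext fun n => coeff_ofCoeff _ _ n
  rw [← norm_ofCoeff_sq _ (summable_coeff_sq f), h]

theorem norm_le_of_coeff_le {f g : L2per} {C : ℝ} (hC : 0 ≤ C)
    (h : ∀ n, ‖coeff f n‖ ≤ C * ‖coeff g n‖) : ‖f‖ ≤ C * ‖g‖ := by
  refine le_of_sq_le_sq ?_ (by positivity)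
  rw [mul_pow, norm_sq_eq_tsum, norm_sq_eq_tsum, ← tsum_mul_left]
  refine (summable_coeff_sq f).tsum_le_tsum (fun n => ?_) ((summable_coeff_sq g).mul_left _)
  rw [← mul_pow]
  exact pow_le_pow_left₀ (norm_nonneg _) (h n) 2

theorem norm_coeff_le (f : L2per) (n : ℤ) : ‖coeff f n‖ ≤ ‖f‖ := by
  refine le_of_sq_le_sq ?_ (norm_nonneg _)
  rw [norm_sq_eq_tsum]
  exact (summable_coeff_sq f).le_tsum n fun m _ => by positivity

theorem norm_le_tsum_coeff {f : L2per} (h : Summable fun n => ‖coeff f n‖) :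
    ‖f‖ ≤ ∑' n, ‖coeff f n‖ := by
  have h1 := hasSum_fourier_series_L2 f
  have h2 : ∀ n, ‖fourierCoeff (T := 2 * Real.pi) f n • fourierLp (T := 2 * Real.pi) 2 n‖ =
      ‖coeff f n‖ := by
    intro n
    rw [norm_smul, orthonormal_fourier.1 n, mul_one]
    rfl
  rw [← tsum_congr h2]
  conv_lhs => rw [← h1.tsum_eq]
  exact norm_tsum_le_tsum_norm (h.congr fun n => (h2 n).symm)

theorem summable_of_coeff_le {a : ℤ → ℂ} {C : ℝ} (ha : ∀ n, ‖a n‖ ≤ C) (f : L2per) :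
    Summable fun n => ‖a n * coeff f n‖ ^ 2 := by
  refine Summable.of_nonneg_of_le (fun n => by positivity) (fun n => ?_)
    ((summable_coeff_sq f).mul_left (C ^ 2))
  rw [norm_mul, mul_pow]
  exact mul_le_mul_of_nonneg_right (pow_le_pow_left₀ (norm_nonneg _) (ha n) 2) (by positivity)

/-- The Fourier multiplier with a bounded symbol. -/
def multOp (a : ℤ → ℂ) (ha : ∃ C, ∀ n, ‖a n‖ ≤ C) : L2per →L[ℂ] L2per :=
  LinearMap.mkContinuous
    { toFun := fun f => ofCoeff (fun n => a n * coeff f n)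
        (summable_of_coeff_le ha.choose_spec f)
      map_add' := fun f g => coeff_ext fun n => by
        simp only [coeff_add, coeff_ofCoeff]; ring
      map_smul' := fun c f => coeff_ext fun n => by
        simp only [coeff_smul, coeff_ofCoeff, RingHom.id_apply]; ring }
    ha.choose fun f => norm_le_of_coeff_le ((norm_nonneg _).trans (ha.choose_spec 0)) fun n => by
      rw [LinearMap.coe_mk, AddHom.coe_mk, coeff_ofCoeff, norm_mul]
      exact mul_le_mul_of_nonneg_right (ha.choose_spec n) (norm_nonneg _)

theorem coeff_multOp (a : ℤ → ℂ) (ha : ∃ C, ∀ n, ‖a n‖ ≤ C) (f : L2per) (n : ℤ) :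
    coeff (multOp a ha f) n = a n * coeff f n :=
  coeff_ofCoeff _ (summable_of_coeff_le ha.choose_spec f) n

theorem norm_multOp_le {a : ℤ → ℂ} (ha : ∃ C, ∀ n, ‖a n‖ ≤ C) {C : ℝ} (hC : ∀ n, ‖a n‖ ≤ C) :
    ‖multOp a ha‖ ≤ C := by
  have hC0 : 0 ≤ C := (norm_nonneg _).trans (hC 0)
  refine ContinuousLinearMap.opNorm_le_bound _ hC0 fun f => norm_le_of_coeff_le hC0 fun n => ?_
  rw [coeff_multOp, norm_mul]
  exact mul_le_mul_of_nonneg_right (hC n) (norm_nonneg _)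

/-! ### The Bloch operator with Floquet exponent zero in Fourier variables -/

theorem coeff_incl {m l : ℕ} (h : m ≤ l) (f : sobolev l) (n : ℤ) :
    coeff (incl h f : L2per) n = coeff (f : L2per) n := rfl

theorem coeff_blochDeriv_zero (m : ℕ) (f : sobolev (m + 1)) (n : ℤ) :
    coeff (blochDeriv 0 m f : L2per) n = I * n * coeff (f : L2per) n := by
  simp [blochDeriv, coeff_perDeriv]

theorem coeff_blochLap_zero (m : ℕ) (f : sobolev (m + 2)) (n : ℤ) :
    coeff (blochLap 0 m f : L2per) n = -(n : ℂ) ^ 2 * coeff (f : L2per) n := by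
  rw [blochLap, LinearMap.comp_apply, coeff_blochDeriv_zero, coeff_blochDeriv_zero]
  linear_combination (n : ℂ) ^ 2 * coeff (f : L2per) n * I_sq

theorem coeff_helmholtz_zero (k : ℝ) (m : ℕ) (f : sobolev (m + 2)) (n : ℤ) :
    coeff (helmholtz k 0 m f : L2per) n = (1 - (k : ℂ) ^ 2 * n ^ 2) * coeff (f : L2per) n := by
  rw [helmholtz, LinearMap.add_apply, LinearMap.smul_apply, Submodule.coe_add, Submodule.coe_smul,
    coeff_add, coeff_smul, coeff_blochLap_zero, coeff_incl]
  ring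

theorem coeff_helmholtzSq_zero (k : ℝ) (f : sobolev 6) (n : ℤ) :
    coeff (helmholtzSq k 0 f : L2per) n =
      (1 - (k : ℂ) ^ 2 * n ^ 2) ^ 2 * coeff (f : L2per) n := by
  rw [helmholtzSq, LinearMap.comp_apply, coeff_helmholtz_zero, coeff_helmholtz_zero]
  ring

/-- For `σ = 0` all differential factors are Fourier multipliers. The outer `-∂_ξ²` contributes
`n²`, so the output has mean zero; this is the source of the eigenvalue coming from the mean. -/
theorem coeff_blochOp_zero (s ε ω : ℝ) (u : RealH6) (V : sobolev 6) (n : ℤ) :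
    coeff ((blochOp s ε ω 0 u).toFun V) n = (waveNumber ε ω : ℂ) ^ 2 * n ^ 2 *
      (-(1 - (waveNumber ε ω : ℂ) ^ 2 * n ^ 2) ^ 2 * coeff (V : L2per) n +
        coeff (mulC (toComplex (dfCoeff s ε u.1)) (V : L2per)) n) := by
  set k := waveNumber ε ω
  have h : (blochOp s ε ω 0 u).toFun V = ((-(k : ℂ) ^ 2) • blochLap 0 0 (-helmholtzSq k 0 V +
      mulDf s ε u (incl (by norm_num) V)) : L2per) := rfl
  have h2 : (mulDf s ε u (incl (by norm_num) V) : L2per) =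
    mulC (toComplex (dfCoeff s ε u.1)) (V : L2per) := rfl
  rw [h, coeff_smul, coeff_blochLap_zero, Submodule.coe_add, Submodule.coe_neg, coeff_add,
    coeff_neg, coeff_helmholtzSq_zero, h2]
  ring

/-! ### A Schur complement argument for a simple eigenvalue -/

section SchurComplement

variable {E : Type*} [NormedAddCommGroup E] [NormedSpace ℂ E]

/-- The pencil `T - z R` is, for `Re z ≥ -1`, a small perturbation `P` of a pencil which is
`-z` on the line spanned by `e` and has the inverse `Y z` on the complement `ker φ`. -/
structure SchurPencil (T R P : E →L[ℂ] E) (φ : E →L[ℂ] ℂ) (e : E) (Y : ℂ → E →L[ℂ] E)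
    (M : ℝ) : Prop where
  eq_iff : ∀ z : ℂ, -1 ≤ z.re → ∀ v f : E, T v - z • R v = f ↔
    -z * φ v + φ (P v) = φ f ∧ v = φ v • e + Y z (f - P v)
  norm_inv_le : ∀ z : ℂ, -1 ≤ z.re → ‖Y z‖ ≤ M
  norm_inv_sub_le : ∀ z w : ℂ, -1 ≤ z.re → -1 ≤ w.re → ‖Y z - Y w‖ ≤ M * ‖z - w‖
  apply_inv : ∀ z f, φ (Y z f) = 0
  inv_apply : ∀ z, Y z e = 0
  apply_vec : φ e = 1
  norm_functional_le : ‖φ‖ ≤ 1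
  norm_weight_le : ‖R‖ ≤ 1
  apply_weight : ∀ v, φ (R v) = φ v
  norm_vec_le : ‖e‖ ≤ 2
  one_le : 1 ≤ M
  small : 16 * M * ‖P‖ ≤ 1

namespace SchurPencil

variable {T R P : E →L[ℂ] E} {φ : E →L[ℂ] ℂ} {e : E} {Y : ℂ → E →L[ℂ] E} {M : ℝ}

theorem norm_pert_le (h : SchurPencil T R P φ e Y M) : ‖P‖ ≤ 1 / 16 := by
  have := h.small
  nlinarith [h.one_le, norm_nonneg P]

/-- The inverse of `1 + Y z P`. -/
def corr (P : E →L[ℂ] E) (Y : ℂ → E →L[ℂ] E) (z : ℂ) : E →L[ℂ] E := Ring.inverse (1 + Y z * P)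

theorem norm_inv_mul_le (h : SchurPencil T R P φ e Y M) {z : ℂ} (hz : -1 ≤ z.re) :
    ‖Y z * P‖ ≤ 1 / 2 := by
  have h1 := norm_mul_le (Y z) P
  have h2 := mul_le_mul_of_nonneg_right (h.norm_inv_le z hz) (norm_nonneg P)
  linarith [h.small]

variable [CompleteSpace E]

theorem isUnit (h : SchurPencil T R P φ e Y M) {z : ℂ} (hz : -1 ≤ z.re) :
    IsUnit (1 + Y z * P) := by
  have h1 : ‖-(Y z * P)‖ < 1 := by
    rw [norm_neg]; linarith [h.norm_inv_mul_le hz]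
  have := isUnit_one_sub_of_norm_lt_one h1
  rwa [sub_neg_eq_add] at this

theorem corr_add (h : SchurPencil T R P φ e Y M) {z : ℂ} (hz : -1 ≤ z.re) (x : E) :
    corr P Y z x + Y z (P (corr P Y z x)) = x := by
  have := congrArg (fun A : E →L[ℂ] E => A x) (Ring.mul_inverse_cancel _ (h.isUnit hz))
  simpa [corr] using this

theorem corr_unique (h : SchurPencil T R P φ e Y M) {z : ℂ} (hz : -1 ≤ z.re) {v x : E}
    (hv : v + Y z (P v) = x) : v = corr P Y z x := by
  have := congrArg (fun A : E →L[ℂ] E => A v) (Ring.inverse_mul_cancel _ (h.isUnit hz))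
  rw [← hv]
  simpa [corr] using this.symm

theorem norm_corr_le (h : SchurPencil T R P φ e Y M) {z : ℂ} (hz : -1 ≤ z.re) (x : E) :
    ‖corr P Y z x‖ ≤ 2 * ‖x‖ := by
  set v := corr P Y z x with hv
  have h1 : v = x - (Y z * P) v := by
    rw [eq_sub_iff_add_eq]; exact h.corr_add hz x
  have h2 : ‖v‖ ≤ ‖x‖ + ‖(Y z * P) v‖ := by
    conv_lhs => rw [h1]
    exact norm_sub_le _ _
  have h3 := (Y z * P).le_of_opNorm_le (h.norm_inv_mul_le hz) v
  linarith

/-- `Y z` takes values in `ker φ`, so the correction never changes the critical component. -/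
theorem apply_corr (h : SchurPencil T R P φ e Y M) {z : ℂ} (hz : -1 ≤ z.re) (x : E) :
    φ (corr P Y z x) = φ x := by
  have := congrArg φ (h.corr_add hz x)
  rwa [map_add, h.apply_inv, add_zero] at this

theorem norm_apply_pert_corr_le (h : SchurPencil T R P φ e Y M) {z : ℂ} (hz : -1 ≤ z.re)
    (x : E) : ‖φ (P (corr P Y z x))‖ ≤ 2 * ‖P‖ * ‖x‖ := by
  have h1 := φ.le_of_opNorm_le h.norm_functional_le (P (corr P Y z x))
  have h2 := P.le_opNorm (corr P Y z x)
  have h3 := mul_le_mul_of_nonneg_left (h.norm_corr_le hz x) (norm_nonneg P)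
  linarith

/-- The scalar Schur complement of `T - z R` is `schur z - z`. -/
def schur (P : E →L[ℂ] E) (φ : E →L[ℂ] ℂ) (e : E) (Y : ℂ → E →L[ℂ] E) (z : ℂ) : ℂ :=
  φ (P (corr P Y z e))

theorem norm_schur_le (h : SchurPencil T R P φ e Y M) {z : ℂ} (hz : -1 ≤ z.re) :
    ‖schur P φ e Y z‖ ≤ 4 * ‖P‖ := by
  have h1 := h.norm_apply_pert_corr_le hz e
  have h2 := mul_le_mul_of_nonneg_left h.norm_vec_le (norm_nonneg P)
  rw [schur]; linarith

/-- `Y` depends Lipschitz continuously on `z`, and it enters the difference with a factor `P` on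
either side. The resulting `8 M ‖P‖²` is far below `1/2`, which makes `schur` a contraction. -/
theorem norm_schur_sub_le (h : SchurPencil T R P φ e Y M) {z w : ℂ} (hz : -1 ≤ z.re)
    (hw : -1 ≤ w.re) : ‖schur P φ e Y z - schur P φ e Y w‖ ≤ 1 / 2 * ‖z - w‖ := by
  set v := corr P Y z e with hv
  -- Resolvent identity for the inverses of `1 + Y z P` and `1 + Y w P`, applied to `e`.
  have h1 : corr P Y w e = v + corr P Y w ((Y z - Y w) (P v)) := by
    symm
    apply h.corr_unique hw
    have e1 := h.corr_add hz e
    have e2 := h.corr_add hw ((Y z - Y w) (P v))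
    rw [← hv] at e1
    have e3 : (Y z - Y w) (P v) = Y z (P v) - Y w (P v) := rfl
    rw [map_add, map_add, ← e1]
    have e4 : corr P Y w ((Y z - Y w) (P v)) + Y w (P (corr P Y w ((Y z - Y w) (P v)))) =
      Y z (P v) - Y w (P v) := e2.trans e3
    rw [← sub_eq_zero] at e4 ⊢
    rw [← e4]; abel
  have h2 : schur P φ e Y z - schur P φ e Y w = -φ (P (corr P Y w ((Y z - Y w) (P v)))) := by
    rw [schur, schur, h1, map_add, map_add, ← hv]; ring
  rw [h2, norm_neg]
  have h3 := h.norm_apply_pert_corr_le hw ((Y z - Y w) (P v))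
  have h4 := (Y z - Y w).le_of_opNorm_le (h.norm_inv_sub_le z w hz hw) (P v)
  have h5 := P.le_opNorm v
  have h6 := h.norm_corr_le hz e
  rw [← hv] at h6
  have h7 : ‖P v‖ ≤ ‖P‖ * 4 := h5.trans
    (mul_le_mul_of_nonneg_left (by linarith [h.norm_vec_le]) (norm_nonneg P))
  have hM := h.one_le
  have hp := h.norm_pert_le
  have hs := h.small
  have h8 : ‖(Y z - Y w) (P v)‖ ≤ M * ‖z - w‖ * (‖P‖ * 4) :=
    h4.trans (mul_le_mul_of_nonneg_left h7 (by positivity))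
  calc _ ≤ 2 * ‖P‖ * (M * ‖z - w‖ * (‖P‖ * 4)) :=
        h3.trans (mul_le_mul_of_nonneg_left h8 (by positivity))
    _ = (16 * M * ‖P‖) * (‖P‖ / 2) * ‖z - w‖ := by ring
    _ ≤ 1 * (1 / 2) * ‖z - w‖ := by gcongr; linarith
    _ = _ := by ring

theorem eq_corr (h : SchurPencil T R P φ e Y M) {z : ℂ} (hz : -1 ≤ z.re) {v f : E}
    (hv : T v - z • R v = f) : v = corr P Y z (φ v • e + Y z f) := by
  have h1 := ((h.eq_iff z hz v f).1 hv).2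
  apply h.corr_unique hz
  rw [map_sub] at h1
  nth_rewrite 1 [h1]
  abel

/-- Eliminating the complement through `eq_corr` leaves one scalar equation for `φ v`. Its
coefficient is the Schur complement and its right side is the solvability functional; `solve` is the
converse. -/
theorem schur_mul (h : SchurPencil T R P φ e Y M) {z : ℂ} (hz : -1 ≤ z.re) {v f : E}
    (hv : T v - z • R v = f) :
    (schur P φ e Y z - z) * φ v = φ f - φ (P (corr P Y z (Y z f))) := by
  have h1 := ((h.eq_iff z hz v f).1 hv).1
  have h2 := congrArg (fun x => φ (P x)) (h.eq_corr hz hv)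
  simp only [map_add, map_smul, smul_eq_mul] at h2
  rw [schur]
  linear_combination h1 - h2

theorem solve (h : SchurPencil T R P φ e Y M) {z : ℂ} (hz : -1 ≤ z.re) {c : ℂ} {f : E}
    (hc : (schur P φ e Y z - z) * c = φ f - φ (P (corr P Y z (Y z f)))) :
    T (corr P Y z (c • e + Y z f)) - z • R (corr P Y z (c • e + Y z f)) = f := by
  rw [h.eq_iff z hz]
  have h1 := h.apply_corr hz (c • e + Y z f)
  rw [map_add φ, map_smul φ, h.apply_vec, h.apply_inv, smul_eq_mul, mul_one, add_zero] at h1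
  rw [h1]
  constructor
  · rw [schur] at hc
    simp only [map_add, map_smul, smul_eq_mul]
    linear_combination hc
  · have h2 := h.corr_add hz (c • e + Y z f)
    rw [map_sub, ← add_sub_assoc]
    exact eq_sub_of_add_eq h2

theorem bijective (h : SchurPencil T R P φ e Y M) {z : ℂ} (hz : -1 ≤ z.re)
    (hne : schur P φ e Y z ≠ z) : Function.Bijective fun v => T v - z • R v := by
  have h0 : schur P φ e Y z - z ≠ 0 := sub_ne_zero.2 hne
  constructor
  · intro v w hvw
    have h1 : T (v - w) - z • R (v - w) = 0 := by
      have : T v - z • R v = T w - z • R w := hvw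
      rw [map_sub, map_sub, smul_sub, ← sub_eq_zero.2 this]; abel
    have h2 := h.schur_mul hz h1
    simp only [map_zero, sub_zero, mul_eq_zero, h0, false_or] at h2
    have h3 := h.eq_corr hz h1
    rw [h2] at h3
    simp only [zero_smul, map_zero, add_zero] at h3
    exact sub_eq_zero.1 h3
  · intro f
    refine ⟨_, h.solve hz (c := (φ f - φ (P (corr P Y z (Y z f)))) / (schur P φ e Y z - z)) ?_⟩
    field_simp

/-- Banach's fixed point theorem in the closed half plane `Re z ≥ -1`. The values of `schur` have
modulus at most `4 ‖P‖ ≤ 1/4`, so the half plane is mapped into its interior. -/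
theorem exists_eigenvalue (h : SchurPencil T R P φ e Y M) :
    ∃ μ : ℂ, -1 < μ.re ∧ schur P φ e Y μ = μ ∧ ‖μ‖ ≤ 4 * ‖P‖ := by
  have hcl : IsClosed {z : ℂ | -1 ≤ z.re} := isClosed_le continuous_const continuous_re
  have hre : ∀ z : ℂ, -1 ≤ z.re → -1 < (schur P φ e Y z).re := by
    intro z hz
    have h1 := h.norm_schur_le hz
    have h2 := h.norm_pert_le
    have h3 := (abs_le.1 (abs_re_le_norm (schur P φ e Y z))).1
    linarith
  have hmaps : Set.MapsTo (schur P φ e Y) {z : ℂ | -1 ≤ z.re} {z : ℂ | -1 ≤ z.re} :=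
    fun z hz => (hre z hz).le
  have hK : ContractingWith (1 / 2) (hmaps.restrict (schur P φ e Y) _ _) := by
    refine ⟨by norm_num, LipschitzWith.of_dist_le_mul fun z w => ?_⟩
    have := h.norm_schur_sub_le z.2 w.2
    rw [Subtype.dist_eq, Subtype.dist_eq, dist_eq_norm, dist_eq_norm]
    simpa using this
  obtain ⟨μ, hμ, hfix, -⟩ := hK.exists_fixedPoint' hcl.isComplete hmaps (x := 0)
    (by simp) (edist_ne_top _ _)
  have hfix' : schur P φ e Y μ = μ := hfix
  refine ⟨μ, ?_, hfix', ?_⟩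
  · rw [← hfix']; exact hre μ hμ
  · conv_lhs => rw [← hfix']
    exact h.norm_schur_le hμ

theorem schur_unique (h : SchurPencil T R P φ e Y M) {z w : ℂ} (hz : -1 ≤ z.re) (hw : -1 ≤ w.re)
    (h1 : schur P φ e Y z = z) (h2 : schur P φ e Y w = w) : z = w := by
  have := h.norm_schur_sub_le hz hw
  rw [h1, h2] at this
  have h3 : ‖z - w‖ ≤ 0 := by linarith
  exact sub_eq_zero.1 (norm_le_zero_iff.1 h3)

theorem eigenvector (h : SchurPencil T R P φ e Y M) {μ : ℂ} (hμ : -1 ≤ μ.re)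
    (hfix : schur P φ e Y μ = μ) :
    T (corr P Y μ e) - μ • R (corr P Y μ e) = 0 ∧ φ (corr P Y μ e) = 1 := by
  have h1 := h.solve hμ (c := 1) (f := 0) (by simp [hfix])
  simp only [one_smul, map_zero, add_zero] at h1
  exact ⟨h1, by rw [h.apply_corr hμ, h.apply_vec]⟩

/-- The eigenvalue is simple. -/
theorem mem_span (h : SchurPencil T R P φ e Y M) {μ : ℂ} (hμ : -1 ≤ μ.re)
    (hfix : schur P φ e Y μ = μ) {v : E} {a : ℂ}
    (hv : T v - μ • R v = a • R (corr P Y μ e)) : a = 0 ∧ v = φ v • corr P Y μ e := by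
  set V := corr P Y μ e with hV
  have h1 := h.schur_mul hμ hv
  -- At the eigenvalue the left side of `schur_mul` vanishes. What remains is `a (1 - φ(P(corr(Y(R
  -- V))))) = 0`, and smallness of `P` keeps the bracket away from zero, so no Jordan chain can
  -- start.
  rw [hfix, sub_self, zero_mul] at h1
  have hφV : φ V = 1 := (h.eigenvector hμ hfix).2
  simp only [map_smul, smul_eq_mul, h.apply_weight, hφV] at h1
  have h2 := h.norm_apply_pert_corr_le hμ (Y μ (R V))
  have h3 := (Y μ).le_of_opNorm_le (h.norm_inv_le μ hμ) (R V)
  have h4 := R.le_of_opNorm_le h.norm_weight_le V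
  have h5 := h.norm_corr_le hμ e
  rw [← hV] at h5
  have hM := h.one_le
  have h6 : ‖φ (P (corr P Y μ (Y μ (R V))))‖ ≤ 1 / 2 := by
    calc _ ≤ 2 * ‖P‖ * (M * (1 * 4)) := by
          refine h2.trans (mul_le_mul_of_nonneg_left (h3.trans ?_) (by positivity))
          refine mul_le_mul_of_nonneg_left (h4.trans ?_) (by positivity)
          linarith [h.norm_vec_le]
      _ = (16 * M * ‖P‖) / 2 := by ring
      _ ≤ 1 / 2 := by linarith [h.small]
  have h7 : φ (P (corr P Y μ (Y μ (R V)))) ≠ 1 := by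
    intro h8
    rw [h8, norm_one] at h6
    norm_num at h6
  have ha : a = 0 := by
    have h9 : a * (1 - φ (P (corr P Y μ (Y μ (R V))))) = 0 := by linear_combination -h1
    exact (mul_eq_zero.1 h9).resolve_right (sub_ne_zero.2 h7.symm)
  refine ⟨ha, ?_⟩
  rw [ha, zero_smul] at hv
  have h8 := h.eq_corr hμ hv
  rwa [map_zero, add_zero, map_smul, ← hV] at h8

/-- The eigenvalue is close to the Rayleigh quotient of an approximate eigenvector. -/
theorem norm_sub_le (h : SchurPencil T R P φ e Y M) {μ : ℂ} (hμ : -1 ≤ μ.re)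
    (hfix : schur P φ e Y μ = μ) {v ρ : E} {b : ℂ} (hv : T v = b • e + ρ) (hφv : φ v = 1)
    (hρ : φ ρ = 0) : ‖b - μ‖ ≤ 2 * M * ‖P‖ * (‖ρ‖ + 4 * ‖P‖ * ‖R v - e‖) := by
  -- The part not proportional to `e` lies in `ker φ`. It therefore enters the solvability condition
  -- only after an application of `P`, which gains a factor `‖P‖`.
  have h1 : T v - μ • R v = (b - μ) • e + (ρ - μ • (R v - e)) := by
    rw [hv, sub_smul, smul_sub]; abel
  have h2 := h.schur_mul hμ h1
  rw [hfix, sub_self, zero_mul] at h2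
  simp only [map_add, map_smul, h.inv_apply, smul_zero, map_zero, zero_add, map_sub, h.apply_weight,
    hφv, h.apply_vec, hρ, smul_eq_mul] at h2
  have h3 : b - μ = φ (P (corr P Y μ (Y μ (ρ - μ • (R v - e))))) := by
    simp only [map_sub, map_smul, h.inv_apply, smul_sub, smul_zero, map_zero] at h2 ⊢
    linear_combination -h2
  have hμn : ‖μ‖ ≤ 4 * ‖P‖ := by
    conv_lhs => rw [← hfix]
    exact h.norm_schur_le hμ
  have hM := h.one_le
  have h4 : ‖ρ - μ • (R v - e)‖ ≤ ‖ρ‖ + 4 * ‖P‖ * ‖R v - e‖ := by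
    refine (_root_.norm_sub_le _ _).trans (add_le_add le_rfl ?_)
    rw [norm_smul]
    exact mul_le_mul_of_nonneg_right hμn (norm_nonneg _)
  rw [h3]
  calc _ ≤ 2 * ‖P‖ * ‖Y μ (ρ - μ • (R v - e))‖ := h.norm_apply_pert_corr_le hμ _
    _ ≤ 2 * ‖P‖ * (M * (‖ρ‖ + 4 * ‖P‖ * ‖R v - e‖)) := by
        refine mul_le_mul_of_nonneg_left ?_ (by positivity)
        exact ((Y μ).le_of_opNorm_le (h.norm_inv_le μ hμ) _).trans
          (mul_le_mul_of_nonneg_left h4 (by positivity))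
    _ = _ := by ring

end SchurPencil

end SchurComplement

/-! ### Absolutely convergent Fourier series with polynomial weights -/

/-- A continuous function as an element of `L²_per`. -/
def contToL2 (f : C(Circ, ℂ)) : L2per := ContinuousMap.toLp 2 AddCircle.haarAddCircle ℂ f

/-- The `n`-th Fourier coefficient of a continuous function, as a bounded functional. -/
def fourierCoeffL (n : ℤ) : C(Circ, ℂ) →L[ℂ] ℂ :=
  (coeffL n).comp (ContinuousMap.toLp 2 AddCircle.haarAddCircle ℂ)

theorem coeff_contToL2 (f : C(Circ, ℂ)) (n : ℤ) : coeff (contToL2 f) n = fourierCoeff f n :=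
  fourierCoeff_toLp _ n

theorem fourierCoeffL_apply (n : ℤ) (f : C(Circ, ℂ)) : fourierCoeffL n f = fourierCoeff f n := by
  rw [← coeff_contToL2, ← coeffL_apply]; rfl

theorem contToL2_add (f g : C(Circ, ℂ)) : contToL2 (f + g) = contToL2 f + contToL2 g :=
  map_add (ContinuousMap.toLp 2 AddCircle.haarAddCircle ℂ) f g

theorem mulC_contToL2 (f g : C(Circ, ℂ)) : mulC f (contToL2 g) = contToL2 (f * g) := by
  apply Lp.ext
  filter_upwards [coeFn_mulC f (contToL2 g),
    ContinuousMap.coeFn_toLp (p := 2) (𝕜 := ℂ) AddCircle.haarAddCircle g,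
    ContinuousMap.coeFn_toLp (p := 2) (𝕜 := ℂ) AddCircle.haarAddCircle (f * g)] with x h1 h2 h3
  rw [h1]
  change f x * (ContinuousMap.toLp 2 AddCircle.haarAddCircle ℂ g : L2per) x =
    (ContinuousMap.toLp 2 AddCircle.haarAddCircle ℂ (f * g) : L2per) x
  rw [h2, h3]
  rfl

theorem mulC_mul (f g : C(Circ, ℂ)) (v : L2per) : mulC (f * g) v = mulC f (mulC g v) := by
  apply Lp.ext
  filter_upwards [coeFn_mulC f (mulC g v), coeFn_mulC g v, coeFn_mulC (f * g) v] with x h1 h2 h3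
  rw [h1, h2, h3, ContinuousMap.mul_apply, mul_assoc]

theorem norm_fourierCoeff_le (f : C(Circ, ℂ)) (n : ℤ) : ‖fourierCoeff f n‖ ≤ ‖f‖ := by
  rw [fourierCoeff]
  refine (norm_integral_le_of_norm_le_const (C := ‖f‖) ?_).trans (by simp)
  filter_upwards with x
  rw [norm_smul]
  have h1 : ‖(fourier (-n) x : ℂ)‖ = 1 := by
    rw [fourier_apply]; exact Circle.norm_coe _
  rw [h1, one_mul]
  exact f.norm_coe_le_norm x

theorem contToL2_injective : Function.Injective contToL2 :=
  ContinuousMap.toLp_injective (p := 2) (𝕜 := ℂ) (E := ℂ) AddCircle.haarAddCircle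

theorem fourierCoeff_ext {f g : C(Circ, ℂ)} (h : ∀ n, fourierCoeff f n = fourierCoeff g n) :
    f = g := by
  apply contToL2_injective
  apply coeff_ext
  intro n
  rw [coeff_contToL2, coeff_contToL2, h n]

/-- The weighted sum `∑ (1 + n²)^j |f̂(n)|` converges and is at most `C`. -/
structure WienerBound (j : ℕ) (C : ℝ) (f : C(Circ, ℂ)) : Prop where
  summable : Summable fun n : ℤ => (1 + (n : ℝ) ^ 2) ^ j * ‖fourierCoeff f n‖
  tsum_le : ∑' n : ℤ, (1 + (n : ℝ) ^ 2) ^ j * ‖fourierCoeff f n‖ ≤ C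

namespace WienerBound

variable {j : ℕ} {a b : ℝ} {f g : C(Circ, ℂ)}

theorem of_le {c : ℤ → ℝ} (hc : Summable c)
    (h : ∀ n : ℤ, (1 + (n : ℝ) ^ 2) ^ j * ‖fourierCoeff f n‖ ≤ c n) (ha : ∑' n, c n ≤ a) :
    WienerBound j a f := by
  have hs : Summable fun n : ℤ => (1 + (n : ℝ) ^ 2) ^ j * ‖fourierCoeff f n‖ :=
    Summable.of_nonneg_of_le (fun n => by positivity) h hc
  exact ⟨hs, (hs.tsum_le_tsum h hc).trans ha⟩

theorem nonneg (h : WienerBound j a f) : 0 ≤ a :=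
  (tsum_nonneg fun n => by positivity).trans h.tsum_le

theorem mono (h : WienerBound j a f) (hab : a ≤ b) : WienerBound j b f :=
  ⟨h.summable, h.tsum_le.trans hab⟩

theorem anti {l : ℕ} (h : WienerBound j a f) (hl : l ≤ j) : WienerBound l a f := by
  refine of_le h.summable (fun n => ?_) h.tsum_le
  have h1 : (1 : ℝ) ≤ 1 + (n : ℝ) ^ 2 := by nlinarith [sq_nonneg (n : ℝ)]
  gcongr

theorem add (hf : WienerBound j a f) (hg : WienerBound j b g) : WienerBound j (a + b) (f + g) := by
  refine of_le (hf.summable.add hg.summable) (fun n => ?_) ?_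
  · rw [← mul_add, ← fourierCoeffL_apply, ← fourierCoeffL_apply, ← fourierCoeffL_apply, map_add]
    gcongr
    exact norm_add_le _ _
  · rw [hf.summable.tsum_add hg.summable]
    exact add_le_add hf.tsum_le hg.tsum_le

theorem smul (c : ℂ) (hf : WienerBound j a f) : WienerBound j (‖c‖ * a) (c • f) := by
  refine of_le (hf.summable.mul_left ‖c‖) (fun n => ?_) ?_
  · rw [← fourierCoeffL_apply, ← fourierCoeffL_apply, map_smul, norm_smul]
    exact le_of_eq (by ring)
  · rw [tsum_mul_left]
    exact mul_le_mul_of_nonneg_left hf.tsum_le (norm_nonneg _)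

theorem summable_coeff (h : WienerBound j a f) : Summable (fourierCoeff f) := by
  have := (h.anti (Nat.zero_le j)).summable
  simp only [pow_zero, one_mul] at this
  exact this.of_norm

theorem norm_le (h : WienerBound j a f) : ‖f‖ ≤ a := by
  have h0 := h.anti (Nat.zero_le j)
  have h1 := hasSum_fourier_series_of_summable h.summable_coeff
  have h2 : ∀ n, ‖fourierCoeff f n • (fourier n : C(Circ, ℂ))‖ =
      (1 + (n : ℝ) ^ 2) ^ 0 * ‖fourierCoeff f n‖ := by
    intro n
    rw [norm_smul, fourier_norm, mul_one, pow_zero, one_mul]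
  calc ‖f‖ = ‖∑' n, fourierCoeff f n • (fourier n : C(Circ, ℂ))‖ := by rw [h1.tsum_eq]
    _ ≤ ∑' n, ‖fourierCoeff f n • (fourier n : C(Circ, ℂ))‖ :=
        norm_tsum_le_tsum_norm (h0.summable.congr fun n => (h2 n).symm)
    _ ≤ a := by rw [tsum_congr h2]; exact h0.tsum_le

/-- The weight is submultiplicative up to a factor: `weight_le` distributes `(1 + n²)^j` over `m`
and `n - m` at the cost of `2^j`. The rest is Young's inequality in `ℓ¹`. -/
theorem mul (hf : WienerBound j a f) (hg : WienerBound j b g) :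
    WienerBound j (2 ^ j * (a * b)) (f * g) := by
  set F : ℤ → ℝ := fun n => (1 + (n : ℝ) ^ 2) ^ j * ‖fourierCoeff f n‖ with hF
  set G : ℤ → ℝ := fun n => (1 + (n : ℝ) ^ 2) ^ j * ‖fourierCoeff g n‖ with hG
  have hF0 : ∀ n, 0 ≤ F n := fun n => by positivity
  have hG0 : ∀ n, 0 ≤ G n := fun n => by positivity
  have h1 : Summable fun p : ℤ × ℤ => F p.1 * G p.2 := hf.summable.mul_of_nonneg hg.summable hF0 hG0
  -- The shear `(n, m) ↦ (m, n - m)` turns the double series of the product into the series of the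
  -- convolution.
  let σ : ℤ × ℤ ≃ ℤ × ℤ :=
    { toFun := fun p => (p.2, p.1 - p.2)
      invFun := fun p => (p.2 + p.1, p.1)
      left_inv := fun p => by simp
      right_inv := fun p => by simp }
  have h2 : Summable fun p : ℤ × ℤ => F p.2 * G (p.1 - p.2) := (σ.summable_iff).2 h1
  have h3 : ∑' p : ℤ × ℤ, F p.2 * G (p.1 - p.2) = (∑' n, F n) * ∑' n, G n := by
    rw [hf.summable.tsum_mul_tsum hg.summable h1]
    exact σ.tsum_eq (fun p : ℤ × ℤ => F p.1 * G p.2)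
  have h4 : Summable fun n : ℤ => ∑' m : ℤ, F m * G (n - m) := h2.prod
  have h5 : ∀ n : ℤ, Summable fun m : ℤ => F m * G (n - m) := fun n => h2.prod_factor n
  refine of_le (h4.mul_left (2 ^ j)) (fun n => ?_) ?_
  · have h6 := hasSum_coeff_mulC hf.summable_coeff (contToL2 g) n
    rw [mulC_contToL2, coeff_contToL2] at h6
    simp only [coeff_contToL2] at h6
    rw [← h6.tsum_eq, ← tsum_mul_left]
    have hle : ∀ m : ℤ, (1 + (n : ℝ) ^ 2) ^ j * ‖fourierCoeff f m * fourierCoeff g (n - m)‖ ≤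
        2 ^ j * (F m * G (n - m)) := by
      intro m
      rw [norm_mul]
      have h7 := pow_le_pow_left₀ (by positivity) (weight_le n m) j
      calc _ ≤ (2 * (1 + (m : ℝ) ^ 2) * (1 + ((n - m : ℤ) : ℝ) ^ 2)) ^ j *
            (‖fourierCoeff f m‖ * ‖fourierCoeff g (n - m)‖) :=
            mul_le_mul_of_nonneg_right h7 (by positivity)
        _ = _ := by rw [hF, hG]; simp only [mul_pow]; ring
    have hs : Summable fun m : ℤ =>
        (1 + (n : ℝ) ^ 2) ^ j * ‖fourierCoeff f m * fourierCoeff g (n - m)‖ :=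
      Summable.of_nonneg_of_le (fun m => by positivity) hle ((h5 n).mul_left _)
    have hs' : Summable fun m : ℤ => ‖fourierCoeff f m * fourierCoeff g (n - m)‖ := by
      refine (hs.mul_left ((1 + (n : ℝ) ^ 2) ^ j)⁻¹).congr fun m => ?_
      have : (1 + (n : ℝ) ^ 2) ^ j ≠ 0 := by positivity
      field_simp
    calc _ ≤ (1 + (n : ℝ) ^ 2) ^ j * ∑' m, ‖fourierCoeff f m * fourierCoeff g (n - m)‖ :=
          mul_le_mul_of_nonneg_left (norm_tsum_le_tsum_norm hs') (by positivity)
      _ = ∑' m, (1 + (n : ℝ) ^ 2) ^ j * ‖fourierCoeff f m * fourierCoeff g (n - m)‖ := by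
          rw [tsum_mul_left]
      _ ≤ _ := hs.tsum_le_tsum hle ((h5 n).mul_left _)
  · rw [tsum_mul_left, ← h2.tsum_prod, h3]
    exact mul_le_mul_of_nonneg_left (mul_le_mul hf.tsum_le hg.tsum_le (tsum_nonneg hG0) hf.nonneg)
      (by positivity)

theorem of_fourier (m : ℤ) : WienerBound j ((1 + (m : ℝ) ^ 2) ^ j) (fourier m) := by
  have h : ∀ n : ℤ, n ≠ m → (1 + (n : ℝ) ^ 2) ^ j * ‖fourierCoeff (T := 2 * Real.pi)
      (fourier m) n‖ = 0 := by
    intro n hn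
    rw [fourierCoeff_fourier, Pi.single_eq_of_ne hn, norm_zero, mul_zero]
  have h2 := hasSum_single m h
  refine ⟨h2.summable, h2.tsum_eq.le.trans ?_⟩
  rw [fourierCoeff_fourier, Pi.single_eq_same, norm_one, mul_one]

/-- `ℓ¹` dominates `ℓ²`: each weighted coefficient is at most `a`, so its square is at most `a`
times itself. -/
theorem sobolev_bound (h : WienerBound j a f) :
    contToL2 f ∈ sobolev (2 * j) ∧ sobolevNorm (2 * j) (contToL2 f) ≤ a := by
  set c : ℤ → ℝ := fun n => (1 + (n : ℝ) ^ 2) ^ j * ‖fourierCoeff f n‖ with hc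
  have hc0 : ∀ n, 0 ≤ c n := fun n => by positivity
  have hca : ∀ n, c n ≤ a := fun n => (h.summable.le_tsum n fun m _ => hc0 m).trans h.tsum_le
  have heq : ∀ n : ℤ, (1 + (n : ℝ) ^ 2) ^ (2 * j) * ‖coeff (contToL2 f) n‖ ^ 2 = c n ^ 2 := by
    intro n
    rw [coeff_contToL2, hc]; ring
  have hle : ∀ n, c n ^ 2 ≤ a * c n := fun n => by nlinarith [hca n, hc0 n]
  have hs : Summable fun n => c n ^ 2 :=
    Summable.of_nonneg_of_le (fun n => by positivity) hle (h.summable.mul_left a)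
  refine ⟨mem_sobolev.2 (hs.congr fun n => (heq n).symm), ?_⟩
  rw [sobolevNorm, tsum_congr heq]
  refine Real.sqrt_le_iff.2 ⟨h.nonneg, ?_⟩
  calc _ ≤ ∑' n, a * c n := hs.tsum_le_tsum hle (h.summable.mul_left a)
    _ = a * ∑' n, c n := tsum_mul_left
    _ ≤ a * a := mul_le_mul_of_nonneg_left h.tsum_le h.nonneg
    _ = _ := by ring

theorem norm_contToL2_le (h : WienerBound j a f) : ‖contToL2 f‖ ≤ a := by
  have h0 := h.anti (Nat.zero_le j)
  have h1 : ∀ n : ℤ, (1 + (n : ℝ) ^ 2) ^ 0 * ‖fourierCoeff f n‖ = ‖coeff (contToL2 f) n‖ := by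
    intro n; rw [pow_zero, one_mul, coeff_contToL2]
  exact (norm_le_tsum_coeff (h0.summable.congr h1)).trans
    ((tsum_congr h1).symm.le.trans h0.tsum_le)

end WienerBound

theorem summable_inv_one_add_sq : Summable fun n : ℤ => 1 / (1 + (n : ℝ) ^ 2) := by
  have h3 : Summable fun n : ℤ => 1 / |(n : ℝ)| ^ 2 := by
    simpa using Real.summable_one_div_int_pow.2 (show 1 < 2 by norm_num)
  rw [← (Set.finite_singleton (0 : ℤ)).summable_compl_iff] at h3 ⊢
  refine Summable.of_nonneg_of_le
    (fun n => by simp only [Function.comp_apply]; positivity) (fun n => ?_) h3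
  have : (n : ℤ) ≠ 0 := n.2
  have h4 : (0 : ℝ) < (((n : ℤ) : ℝ)) ^ 2 := by positivity
  simp only [Function.comp_apply, sq_abs]
  exact one_div_le_one_div_of_le h4 (by linarith)

/-- The Sobolev norm controls the supremum norm. -/
theorem wienerBound_of_mem_sobolev {u : C(Circ, ℂ)} (hu : contToL2 u ∈ sobolev 6) :
    WienerBound 0 (sobolevNorm 6 (contToL2 u) * ∑' n : ℤ, 1 / (1 + (n : ℝ) ^ 2)) u := by
  refine WienerBound.of_le (summable_inv_one_add_sq.mul_left _) (fun n => ?_) tsum_mul_left.le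
  rw [pow_zero, one_mul, mul_one_div, le_div_iff₀ (by positivity)]
  have h1 := (mem_sobolev.1 hu).le_tsum n fun m _ => by positivity
  have h2 : ((1 + (n : ℝ) ^ 2) ^ 3 * ‖fourierCoeff u n‖) ≤ sobolevNorm 6 (contToL2 u) := by
    refine Real.le_sqrt_of_sq_le ?_
    refine le_trans (le_of_eq ?_) h1
    rw [coeff_contToL2]; ring
  refine le_trans ?_ h2
  rw [mul_comm]
  have h3 : (1 : ℝ) ≤ 1 + (n : ℝ) ^ 2 := by nlinarith [sq_nonneg (n : ℝ)]
  exact mul_le_mul_of_nonneg_right (le_self_pow₀ h3 (by norm_num)) (norm_nonneg _)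

/-! ### The Bloch operator as a bounded operator in a preconditioned variable -/

/-- The symbol of the smoothing operator used as a preconditioner. -/
def weight (n : ℤ) : ℝ := if n = 0 then 1 else 1 / (n : ℝ) ^ 6

theorem weight_zero : weight 0 = 1 := by simp [weight]

theorem weight_of_ne {n : ℤ} (h : n ≠ 0) : weight n = 1 / (n : ℝ) ^ 6 := by simp [weight, h]

theorem weight_neg (n : ℤ) : weight (-n) = weight n := by
  simp only [weight, neg_eq_zero, Int.cast_neg]
  norm_num

theorem one_le_intCast_sq {n : ℤ} (h : n ≠ 0) : (1 : ℝ) ≤ (n : ℝ) ^ 2 := by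
  have : (1 : ℤ) ≤ n ^ 2 := by have := sq_nonneg n; have : n ^ 2 ≠ 0 := by positivity
                               omega
  exact_mod_cast this

theorem weight_pos (n : ℤ) : 0 < weight n := by
  unfold weight
  split_ifs with h
  · norm_num
  · have := one_le_intCast_sq h
    rw [show (n : ℝ) ^ 6 = ((n : ℝ) ^ 2) ^ 3 by ring]
    positivity

theorem weight_le_one (n : ℤ) : weight n ≤ 1 := by
  unfold weight
  split_ifs with h
  · norm_num
  · have := one_le_intCast_sq h
    rw [show (n : ℝ) ^ 6 = ((n : ℝ) ^ 2) ^ 3 by ring, div_le_one (by positivity)]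
    exact one_le_pow₀ this

theorem norm_weight_le (n : ℤ) : ‖(weight n : ℂ)‖ ≤ 1 := by
  rw [Complex.norm_real, Real.norm_of_nonneg (weight_pos n).le]
  exact weight_le_one n

/-- The smoothing operator `R : L²_per → H^6_per`. -/
def smooth : L2per →L[ℂ] L2per := multOp (fun n => (weight n : ℂ)) ⟨1, norm_weight_le⟩

theorem coeff_smooth (v : L2per) (n : ℤ) : coeff (smooth v) n = weight n * coeff v n :=
  coeff_multOp _ _ v n

theorem smooth_mem (v : L2per) : smooth v ∈ sobolev 6 := by
  rw [mem_sobolev]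
  refine Summable.of_nonneg_of_le (fun n => by positivity) (fun n => ?_)
    ((summable_coeff_sq v).mul_left 64)
  rw [coeff_smooth, norm_mul, mul_pow, ← mul_assoc, Complex.norm_real, Real.norm_eq_abs, sq_abs]
  refine mul_le_mul_of_nonneg_right ?_ (by positivity)
  rcases eq_or_ne n 0 with rfl | hn
  · norm_num [weight_zero]
  · rw [weight_of_ne hn]
    have h1 := one_le_intCast_sq hn
    rw [show (1 / (n : ℝ) ^ 6) ^ 2 = 1 / ((n : ℝ) ^ 2) ^ 6 by ring, mul_one_div,
      div_le_iff₀ (by positivity), show (64 : ℝ) = 2 ^ 6 by norm_num, ← mul_pow]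
    gcongr
    linarith

theorem exists_smooth_eq {V : L2per} (hV : V ∈ sobolev 6) : ∃ v, smooth v = V := by
  have h : Summable fun n => ‖(weight n : ℂ)⁻¹ * coeff V n‖ ^ 2 := by
    refine Summable.of_nonneg_of_le (fun n => by positivity) (fun n => ?_) (mem_sobolev.1 hV)
    rw [norm_mul, mul_pow, norm_inv, Complex.norm_real, Real.norm_of_nonneg (weight_pos n).le]
    refine mul_le_mul_of_nonneg_right ?_ (by positivity)
    rcases eq_or_ne n 0 with rfl | hn
    · norm_num [weight_zero]
    · rw [weight_of_ne hn, one_div, inv_inv, ← pow_mul,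
        show (n : ℝ) ^ (6 * 2) = ((n : ℝ) ^ 2) ^ 6 by ring]
      gcongr
      linarith
  refine ⟨ofCoeff _ h, coeff_ext fun n => ?_⟩
  rw [coeff_smooth, coeff_ofCoeff, mul_inv_cancel_left₀]
  exact_mod_cast (weight_pos n).ne'

theorem smooth_injective : Function.Injective smooth := by
  intro v w h
  refine coeff_ext fun n => ?_
  have h1 := congrArg (fun f => coeff f n) h
  simp only [coeff_smooth] at h1
  exact mul_left_cancel₀ (by exact_mod_cast (weight_pos n).ne') h1

/-- From `(n + m)² ≤ 2 n² + 2 m²`: the smoothing weight absorbs `n²`, and the remaining growth in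
`m` is paid for by the weighted coefficients of the potential. -/
theorem norm_shiftSymbol_le (m n : ℤ) :
    ‖((n + m : ℂ) ^ 2 * weight n : ℂ)‖ ≤ 2 * (1 + (m : ℝ) ^ 2) := by
  have h0 : ((n + m : ℂ) ^ 2 * weight n : ℂ) = (((n + m : ℝ) ^ 2 * weight n : ℝ) : ℂ) := by
    push_cast; ring
  have h3 := weight_pos n
  rw [h0, Complex.norm_real, Real.norm_of_nonneg (by positivity)]
  have h1 : (n : ℝ) ^ 2 * weight n ≤ 1 := by
    rcases eq_or_ne n 0 with rfl | hn
    · simp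
    · have h1 := one_le_intCast_sq hn
      rw [weight_of_ne hn, mul_one_div, show (n : ℝ) ^ 6 = ((n : ℝ) ^ 2) ^ 3 by ring]
      rw [div_le_one (by positivity)]
      exact le_self_pow₀ h1 (by norm_num)
  have h2 : (m : ℝ) ^ 2 * weight n ≤ (m : ℝ) ^ 2 :=
    mul_le_of_le_one_right (sq_nonneg _) (weight_le_one n)
  nlinarith [mul_nonneg (sq_nonneg ((n : ℝ) - m)) h3.le]

/-- `V ↦ e^{imξ} V` in the preconditioned variable, followed by the symbol `n²`. -/
def shiftOp (m : ℤ) : L2per →L[ℂ] L2per :=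
  (mulC (fourier m)).comp (multOp (fun n => (n + m : ℂ) ^ 2 * weight n)
    ⟨_, norm_shiftSymbol_le m⟩)

theorem norm_shiftOp_le (m : ℤ) : ‖shiftOp m‖ ≤ ‖mulC‖ * (2 * (1 + (m : ℝ) ^ 2)) := by
  refine (ContinuousLinearMap.opNorm_comp_le _ _).trans ?_
  refine mul_le_mul ?_ (norm_multOp_le _ (norm_shiftSymbol_le m)) (norm_nonneg _)
    (ContinuousLinearMap.opNorm_nonneg _)
  have := mulC.le_opNorm (fourier m)
  rwa [fourier_norm, mul_one] at this

theorem coeff_shiftOp (m : ℤ) (v : L2per) (n : ℤ) :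
    coeff (shiftOp m v) n = (n : ℂ) ^ 2 * coeff (smooth v) (n - m) := by
  rw [shiftOp, ContinuousLinearMap.comp_apply, coeff_mulC_fourier, coeff_multOp, coeff_smooth]
  push_cast
  ring

/-- The operator `V ↦ -∂_ξ² (w V)` in the preconditioned variable. -/
def lapMulOp (w : C(Circ, ℂ)) : L2per →L[ℂ] L2per := ∑' m, fourierCoeff w m • shiftOp m

theorem norm_smul_shiftOp_le (w : C(Circ, ℂ)) (m : ℤ) : ‖fourierCoeff w m • shiftOp m‖ ≤
    2 * ‖mulC‖ * ((1 + (m : ℝ) ^ 2) ^ 1 * ‖fourierCoeff w m‖) := by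
  rw [norm_smul]
  calc _ ≤ ‖fourierCoeff w m‖ * (‖mulC‖ * (2 * (1 + (m : ℝ) ^ 2))) :=
        mul_le_mul_of_nonneg_left (norm_shiftOp_le m) (norm_nonneg _)
    _ = _ := by ring

theorem hasSum_lapMulOp {w : C(Circ, ℂ)} {a : ℝ} (hw : WienerBound 1 a w) :
    HasSum (fun m => fourierCoeff w m • shiftOp m) (lapMulOp w) :=
  (Summable.of_norm_bounded (hw.summable.mul_left _) (norm_smul_shiftOp_le w)).hasSum

theorem norm_lapMulOp_le {w : C(Circ, ℂ)} {a : ℝ} (hw : WienerBound 1 a w) :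
    ‖lapMulOp w‖ ≤ 2 * ‖mulC‖ * a := by
  refine (tsum_of_norm_bounded (hw.summable.hasSum.mul_left _) (norm_smul_shiftOp_le w)).trans ?_
  exact mul_le_mul_of_nonneg_left hw.tsum_le (by positivity)

/-- Boundedness of `-∂_ξ² w R` comes from the norm convergent series of shifts, so no regularity of
the product `w V` has to be known beforehand. The convolution formula then identifies the sum. -/
theorem coeff_lapMulOp {w : C(Circ, ℂ)} {a : ℝ} (hw : WienerBound 1 a w) (v : L2per) (n : ℤ) :
    coeff (lapMulOp w v) n = (n : ℂ) ^ 2 * coeff (mulC w (smooth v)) n := by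
  have h1 := ((hasSum_lapMulOp hw).mapL (ContinuousLinearMap.apply ℂ L2per v)).mapL (coeffL n)
  have h2 := (hasSum_coeff_mulC hw.summable_coeff (smooth v) n).mul_left ((n : ℂ) ^ 2)
  simp only [ContinuousLinearMap.apply_apply, smul_apply, coeffL_apply,
    coeff_smul, coeff_shiftOp] at h1
  refine h1.unique (h2.congr_fun fun m => ?_)
  ring

/-! ### Cosine series of real functions -/

@[simp] theorem toComplex_apply (f : C(Circ, ℝ)) (x : Circ) : toComplex f x = (f x : ℂ) := rfl

theorem toComplex_add (f g : C(Circ, ℝ)) : toComplex (f + g) = toComplex f + toComplex g := by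
  ext x; simp

theorem toComplex_mul (f g : C(Circ, ℝ)) : toComplex (f * g) = toComplex f * toComplex g := by
  ext x; simp

theorem toComplex_smul (c : ℝ) (f : C(Circ, ℝ)) : toComplex (c • f) = (c : ℂ) • toComplex f := by
  ext x; simp

theorem toComplex_zero : toComplex 0 = 0 := by
  ext x; simp

theorem toComplex_injective : Function.Injective toComplex := by
  intro f g h
  ext x
  have := congrArg (fun w : C(Circ, ℂ) => w x) h
  simpa using this

theorem norm_toComplex_le (f : C(Circ, ℝ)) : ‖toComplex f‖ ≤ ‖f‖ := by
  rw [ContinuousMap.norm_le _ (norm_nonneg _)]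
  intro x
  rw [toComplex_apply, Complex.norm_real]
  exact f.norm_coe_le_norm x

theorem norm_le_norm_toComplex (f : C(Circ, ℝ)) : ‖f‖ ≤ ‖toComplex f‖ := by
  rw [ContinuousMap.norm_le _ (norm_nonneg _)]
  intro x
  rw [← Complex.norm_real]
  exact (toComplex f).norm_coe_le_norm x

theorem toL2_eq (f : C(Circ, ℝ)) : toL2 f = contToL2 (toComplex f) := rfl

/-- The Fourier coefficient of a real function, as a real linear functional. -/
def realFourier (n : ℤ) : C(Circ, ℝ) →ₗ[ℝ] ℂ where
  toFun f := fourierCoeff (toComplex f) n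
  map_add' f g := by
    rw [toComplex_add]; simp only [← fourierCoeffL_apply, map_add]
  map_smul' c f := by
    rw [toComplex_smul]; simp only [← fourierCoeffL_apply, map_smul]; simp

theorem realFourier_apply (n : ℤ) (f : C(Circ, ℝ)) :
    realFourier n f = fourierCoeff (toComplex f) n := rfl

theorem norm_realFourier_le (n : ℤ) (f : C(Circ, ℝ)) : ‖realFourier n f‖ ≤ ‖f‖ :=
  (norm_fourierCoeff_le _ n).trans (norm_toComplex_le f)

theorem realFourier_neg (n : ℤ) (f : C(Circ, ℝ)) :
    realFourier (-n) f = (starRingEnd ℂ) (realFourier n f) := by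
  rw [realFourier_apply, realFourier_apply, fourierCoeff, fourierCoeff, ← integral_conj]
  congr 1
  ext x
  rw [smul_eq_mul, smul_eq_mul, map_mul, ← fourier_neg, toComplex_apply, conj_ofReal]

theorem realFourier_even {f : C(Circ, ℝ)} (hf : ∀ x, f (-x) = f x) (n : ℤ) :
    realFourier (-n) f = realFourier n f := by
  rw [realFourier_apply, realFourier_apply, fourierCoeff, fourierCoeff,
    ← integral_neg_eq_self (fun x => (fourier (-n) x : ℂ) • toComplex f x)]
  congr 1
  ext x
  rw [toComplex_apply, toComplex_apply, hf, fourier_apply, fourier_apply, smul_neg, neg_smul]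

/-- The cosine coefficient `(1 / π) ∫ f(ξ) cos(n ξ) dξ`. -/
def cosCoeff (n : ℤ) : C(Circ, ℝ) →L[ℝ] ℝ :=
  LinearMap.mkContinuous ((2 : ℝ) • (reLm ∘ₗ realFourier n)) 2 fun f => by
    simp only [LinearMap.smul_apply, LinearMap.comp_apply, smul_eq_mul, norm_mul, Real.norm_ofNat]
    exact mul_le_mul_of_nonneg_left ((abs_re_le_norm _).trans (norm_realFourier_le n f)) (by norm_num)

theorem cosCoeff_apply (n : ℤ) (f : C(Circ, ℝ)) : cosCoeff n f = 2 * (realFourier n f).re := rfl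

theorem abs_cosCoeff_le (n : ℤ) (f : C(Circ, ℝ)) : |cosCoeff n f| ≤ 2 * ‖f‖ := by
  rw [cosCoeff_apply, abs_mul, abs_two]
  exact mul_le_mul_of_nonneg_left ((abs_re_le_norm _).trans (norm_realFourier_le n f)) (by norm_num)

theorem cosCoeff_neg (n : ℤ) (f : C(Circ, ℝ)) : cosCoeff (-n) f = cosCoeff n f := by
  rw [cosCoeff_apply, cosCoeff_apply, realFourier_neg, conj_re]

/-- Reality makes the coefficients conjugation symmetric and evenness makes them symmetric, so they
are real. -/
theorem realFourier_eq_cosCoeff {f : C(Circ, ℝ)} (hf : ∀ x, f (-x) = f x) (n : ℤ) :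
    realFourier n f = ((cosCoeff n f / 2 : ℝ) : ℂ) := by
  have h1 := realFourier_neg n f
  rw [realFourier_even hf] at h1
  have h2 := conj_eq_iff_re.1 h1.symm
  rw [cosCoeff_apply, mul_div_cancel_left₀ _ (two_ne_zero), h2]

/-- The function `cos(n ξ)`. -/
def cosC (n : ℤ) : C(Circ, ℝ) := ⟨fun x => (fourier n x : ℂ).re, by fun_prop⟩

theorem cosC_apply (n : ℤ) (x : Circ) : cosC n x = (fourier n x : ℂ).re := rfl

theorem toComplex_cosC (n : ℤ) :
    toComplex (cosC n) = (1 / 2 : ℂ) • (fourier n + fourier (-n)) := by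
  ext x
  rw [toComplex_apply, cosC_apply, ContinuousMap.smul_apply, ContinuousMap.add_apply, fourier_neg,
    re_eq_add_conj, smul_eq_mul]
  ring

theorem cosC_neg (n : ℤ) : cosC (-n) = cosC n := by
  ext x
  rw [cosC_apply, cosC_apply, fourier_neg, conj_re]

theorem cosC_even (n : ℤ) (x : Circ) : cosC n (-x) = cosC n x := by
  rw [cosC_apply, cosC_apply, fourier_apply, smul_neg, fourier_neg', conj_re]

theorem cosC_zero_right (n : ℤ) : cosC n 0 = 1 := by
  rw [cosC_apply, fourier_eval_zero, one_re]

theorem norm_cosC_le (n : ℤ) : ‖cosC n‖ ≤ 1 := by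
  rw [ContinuousMap.norm_le _ zero_le_one]
  intro x
  rw [cosC_apply, Real.norm_eq_abs]
  refine (abs_re_le_norm _).trans ?_
  rw [fourier_apply]
  exact (Circle.norm_coe _).le

theorem cosC_zero : cosC 0 = 1 := by
  ext x
  simp [cosC_apply]

theorem cosC_mul (m n : ℤ) : cosC m * cosC n = (1 / 2 : ℝ) • (cosC (m + n) + cosC (m - n)) := by
  ext x
  simp only [ContinuousMap.mul_apply, ContinuousMap.smul_apply, ContinuousMap.add_apply,
    cosC_apply, smul_eq_mul, sub_eq_add_neg, fourier_add, fourier_neg, mul_re, conj_re, conj_im]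
  ring

theorem realFourier_cosC (n m : ℤ) : realFourier m (cosC n) =
    (1 / 2 : ℂ) * ((if m = n then 1 else 0) + (if m = -n then 1 else 0)) := by
  rw [realFourier_apply, toComplex_cosC, ← fourierCoeffL_apply, map_smul, map_add,
    fourierCoeffL_apply, fourierCoeffL_apply, fourierCoeff_fourier, fourierCoeff_fourier,
    smul_eq_mul, Pi.single_apply, Pi.single_apply]

theorem wienerBound_cosC (j : ℕ) (n : ℤ) :
    WienerBound j ((1 + (n : ℝ) ^ 2) ^ j) (toComplex (cosC n)) := by
  rw [toComplex_cosC]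
  refine (((WienerBound.of_fourier n).add (WienerBound.of_fourier (-n))).smul (1 / 2)).mono ?_
  norm_num
  linarith

/-! ### Multipliers on cosine series -/

/-- A symbol decaying like `n⁻⁴`. -/
structure CosSymbol (D : ℝ) (κ : ℤ → ℝ) : Prop where
  even : ∀ n, κ (-n) = κ n
  nonneg : ∀ n, 0 ≤ κ n
  le : ∀ n : ℤ, κ n ≤ D / (1 + (n : ℝ) ^ 2) ^ 2

/-- The value of the series `∑ (1 + n²)⁻¹`. -/
def invSqSum : ℝ := ∑' n : ℤ, 1 / (1 + (n : ℝ) ^ 2)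

theorem invSqSum_nonneg : 0 ≤ invSqSum := tsum_nonneg fun n => by positivity

theorem CosSymbol.const_nonneg {D : ℝ} {κ : ℤ → ℝ} (h : CosSymbol D κ) : 0 ≤ D := by
  have := (h.nonneg 0).trans (h.le 0)
  simpa using this

/-- The `n`-th term of the cosine series of `f`, multiplied by `κ n`. -/
def cosTerm (κ : ℤ → ℝ) (f : C(Circ, ℝ)) (n : ℤ) : C(Circ, ℝ) := (κ n / 2 * cosCoeff n f) • cosC n

theorem CosSymbol.norm_term_le {D : ℝ} {κ : ℤ → ℝ} (h : CosSymbol D κ) (f : C(Circ, ℝ)) (n : ℤ) :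
    ‖cosTerm κ f n‖ ≤ D * ‖f‖ * (1 / (1 + (n : ℝ) ^ 2)) := by
  have hD := h.const_nonneg
  rw [cosTerm, norm_smul, norm_mul, Real.norm_of_nonneg (by have := h.nonneg n; positivity)]
  have h1 := abs_cosCoeff_le n f
  have h2 := norm_cosC_le n
  have h3 : κ n ≤ D * (1 / (1 + (n : ℝ) ^ 2)) := by
    refine (h.le n).trans ?_
    rw [mul_one_div]
    have h3 : (1 : ℝ) ≤ 1 + (n : ℝ) ^ 2 := by nlinarith [sq_nonneg (n : ℝ)]
    exact div_le_div_of_nonneg_left hD (by positivity) (le_self_pow₀ h3 (by norm_num))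
  calc _ ≤ κ n / 2 * (2 * ‖f‖) * 1 := by
        have := h.nonneg n
        rw [Real.norm_eq_abs]
        gcongr
    _ = κ n * ‖f‖ := by ring
    _ ≤ D * (1 / (1 + (n : ℝ) ^ 2)) * ‖f‖ := mul_le_mul_of_nonneg_right h3 (norm_nonneg _)
    _ = _ := by ring

theorem CosSymbol.summable_term {D : ℝ} {κ : ℤ → ℝ} (h : CosSymbol D κ) (f : C(Circ, ℝ)) :
    Summable (cosTerm κ f) :=
  Summable.of_norm_bounded (summable_inv_one_add_sq.mul_left (D * ‖f‖)) (h.norm_term_le f)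

open Classical in
/-- The cosine multiplier with symbol `κ`. -/
def cosMult (κ : ℤ → ℝ) : C(Circ, ℝ) →L[ℝ] C(Circ, ℝ) :=
  -- The chosen `D` serves only to build a bounded operator; `norm_cosMult_apply_le` recovers the
  -- bound for every admissible `D`. The default `0` is never used for symbols with the required
  -- decay.
  if h : ∃ D, CosSymbol D κ then
    LinearMap.mkContinuous
      { toFun := fun f => ∑' n : ℤ, cosTerm κ f n
        map_add' := fun f g => by
          rw [← (h.choose_spec.summable_term f).tsum_add (h.choose_spec.summable_term g)]
          refine tsum_congr fun n => ?_
          rw [cosTerm, cosTerm, cosTerm, map_add, mul_add, add_smul]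
        map_smul' := fun c f => by
          rw [RingHom.id_apply, ← (h.choose_spec.summable_term f).tsum_const_smul c]
          refine tsum_congr fun n => ?_
          rw [cosTerm, cosTerm, map_smul, smul_smul, smul_eq_mul]
          congr 1
          ring }
      (h.choose * invSqSum) fun f => by
        have h1 := (h.choose_spec.summable_term f).hasSum.norm_le_of_bounded
          (summable_inv_one_add_sq.hasSum.mul_left _) (h.choose_spec.norm_term_le f)
        rw [← invSqSum] at h1
        exact h1.trans (le_of_eq (by ring))
  else 0

namespace CosSymbol

variable {D : ℝ} {κ : ℤ → ℝ}

theorem hasSum_apply (h : CosSymbol D κ) (f : C(Circ, ℝ)) :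
    HasSum (fun n : ℤ => (κ n / 2 * cosCoeff n f) • cosC n) (cosMult κ f) := by
  have h1 : cosMult κ f = ∑' n : ℤ, cosTerm κ f n := by
    rw [cosMult, dif_pos ⟨D, h⟩]; rfl
  rw [h1]
  exact (h.summable_term f).hasSum

theorem norm_cosMult_apply_le (h : CosSymbol D κ) (f : C(Circ, ℝ)) :
    ‖cosMult κ f‖ ≤ D * invSqSum * ‖f‖ := by
  have h1 := (h.hasSum_apply f).norm_le_of_bounded
    (summable_inv_one_add_sq.hasSum.mul_left _) (h.norm_term_le f)
  rw [← invSqSum] at h1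
  exact h1.trans (le_of_eq (by ring))

/-- No parity of `f` is needed, since the cosine series discards the odd part. -/
theorem realFourier_cosMult (h : CosSymbol D κ) (f : C(Circ, ℝ)) (m : ℤ) :
    realFourier m (cosMult κ f) = ((κ m * cosCoeff m f / 2 : ℝ) : ℂ) := by
  let Λ : C(Circ, ℝ) →L[ℝ] ℂ := LinearMap.mkContinuous (realFourier m) 1 fun f => by
    rw [one_mul]; exact norm_realFourier_le m f
  have h1 := (h.hasSum_apply f).mapL Λ
  have hΛ : ∀ g, Λ g = realFourier m g := fun g => rfl
  simp only [hΛ, map_smul, realFourier_cosC] at h1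
  have h2 : HasSum (fun n : ℤ => (κ n / 2 * cosCoeff n f) •
      ((1 / 2 : ℂ) * ((if m = n then 1 else 0) + (if m = -n then 1 else 0))))
      ((κ m / 2 * cosCoeff m f) • (1 / 2 : ℂ) + (κ (-m) / 2 * cosCoeff (-m) f) • (1 / 2 : ℂ)) := by
    have h3 := hasSum_ite_eq m ((κ m / 2 * cosCoeff m f) • (1 / 2 : ℂ))
    have h4 := hasSum_ite_eq (-m) ((κ (-m) / 2 * cosCoeff (-m) f) • (1 / 2 : ℂ))
    refine (h3.add h4).congr_fun fun n => ?_
    have e1 : (m = n) ↔ (n = m) := eq_comm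
    have e2 : (m = -n) ↔ (n = -m) := by constructor <;> intro h <;> omega
    rw [mul_add, smul_add]
    congr 1
    · by_cases hn : n = m
      · subst hn; simp
      · simp [hn, e1]
    · by_cases hn : n = -m
      · subst hn; simp
      · simp [hn, e2]
  rw [h1.unique h2, h.even, cosCoeff_neg]
  simp only [real_smul]
  push_cast
  ring

theorem cosMult_even (h : CosSymbol D κ) (f : C(Circ, ℝ)) (x : Circ) :
    cosMult κ f (-x) = cosMult κ f x := by
  have h1 : ∀ y, HasSum (fun n : ℤ => κ n / 2 * cosCoeff n f * cosC n y) (cosMult κ f y) := by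
    intro y
    exact (h.hasSum_apply f).mapL (ContinuousMap.evalCLM ℝ y)
  have h2 := h1 (-x)
  simp only [cosC_even] at h2
  exact h2.unique (h1 x)

theorem cosCoeff_cosMult (h : CosSymbol D κ) (f : C(Circ, ℝ)) (m : ℤ) :
    cosCoeff m (cosMult κ f) = κ m * cosCoeff m f := by
  rw [cosCoeff_apply, h.realFourier_cosMult, ofReal_re]
  ring

/-- Entry point of the regularity bootstrap: with only the supremum norm of `f`, the decay of `κ`
beats one weight and still leaves the summable factor `1 / (1 + n²)`. -/
theorem wienerBound_one (h : CosSymbol D κ) (f : C(Circ, ℝ)) :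
    WienerBound 1 (D * invSqSum * ‖f‖) (toComplex (cosMult κ f)) := by
  refine WienerBound.of_le (summable_inv_one_add_sq.mul_left (D * ‖f‖)) (fun n => ?_) ?_
  · rw [← realFourier_apply, h.realFourier_cosMult, Complex.norm_real, Real.norm_eq_abs, abs_div,
      abs_mul, abs_two, abs_of_nonneg (h.nonneg n)]
    have h1 := abs_cosCoeff_le n f
    have hp : (0 : ℝ) < 1 + (n : ℝ) ^ 2 := by positivity
    have hD := h.const_nonneg
    have h0 := h.nonneg n
    calc _ ≤ (1 + (n : ℝ) ^ 2) ^ 1 * ((D / (1 + (n : ℝ) ^ 2) ^ 2) * (2 * ‖f‖) / 2) := by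
          gcongr
          exact h.le n
      _ = _ := by field_simp
  · rw [tsum_mul_left, ← invSqSum]
    exact le_of_eq (by ring)

/-- Bootstrap step: the decay of `κ` is worth two weights, that is, four derivatives. -/
theorem wienerBound_add_two (h : CosSymbol D κ) {j : ℕ} {a : ℝ} {f : C(Circ, ℝ)}
    (hf : WienerBound j a (toComplex f)) :
    WienerBound (j + 2) (D * a) (toComplex (cosMult κ f)) := by
  have hD := h.const_nonneg
  refine WienerBound.of_le (hf.summable.mul_left D) (fun n => ?_) ?_
  · rw [← realFourier_apply, h.realFourier_cosMult, Complex.norm_real, Real.norm_eq_abs, abs_div,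
      abs_mul, abs_two, abs_of_nonneg (h.nonneg n), cosCoeff_apply, abs_mul, abs_two]
    have hp : (0 : ℝ) < 1 + (n : ℝ) ^ 2 := by positivity
    have h0 := h.nonneg n
    have h1 : |(realFourier n f).re| ≤ ‖fourierCoeff (toComplex f) n‖ := abs_re_le_norm _
    calc _ ≤ (1 + (n : ℝ) ^ 2) ^ (j + 2) * ((D / (1 + (n : ℝ) ^ 2) ^ 2) *
          (2 * ‖fourierCoeff (toComplex f) n‖) / 2) := by
          gcongr
          exact h.le n
      _ = _ := by rw [pow_add]; field_simp
  · rw [tsum_mul_left]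
    exact mul_le_mul_of_nonneg_left hf.tsum_le hD

end CosSymbol

/-! ### The profile equation as a fixed point equation -/

theorem waveNumber_sq {ε ω : ℝ} (hε : ε ∈ Set.Icc 0 (1 / 8 : ℝ))
    (hω : ω ∈ Set.Icc (-1 / 2 : ℝ) (1 / 2)) : waveNumber ε ω ^ 2 = 1 + 2 * ω * ε := by
  rw [waveNumber, Real.sq_sqrt]
  nlinarith [hε.1, hε.2, hω.1, hω.2]

theorem abs_waveNumber_sq_sub_le {ε ω : ℝ} (hε : ε ∈ Set.Icc 0 (1 / 8 : ℝ))
    (hω : ω ∈ Set.Icc (-1 / 2 : ℝ) (1 / 2)) : |waveNumber ε ω ^ 2 - 1| ≤ ε := by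
  rw [waveNumber_sq hε hω, abs_le]
  constructor <;> nlinarith [hε.1, hε.2, hω.1, hω.2]

theorem waveNumber_sq_mem {ε ω : ℝ} (hε : ε ∈ Set.Icc 0 (1 / 8 : ℝ))
    (hω : ω ∈ Set.Icc (-1 / 2 : ℝ) (1 / 2)) : waveNumber ε ω ^ 2 ∈ Set.Icc (7 / 8 : ℝ) (9 / 8) := by
  have := abs_le.1 (abs_waveNumber_sq_sub_le hε hω)
  constructor <;> linarith [hε.2]

/-- The symbol `ε² - (1 - k² n²)²` of the linear part of the profile equation. -/
def linSymbol (ε ω : ℝ) (n : ℤ) : ℝ := ε ^ 2 - (1 - waveNumber ε ω ^ 2 * n ^ 2) ^ 2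

theorem linSymbol_neg (ε ω : ℝ) (n : ℤ) : linSymbol ε ω (-n) = linSymbol ε ω n := by
  simp [linSymbol]

/-- Since `1 - k² = -2ωε`, the critical symbol vanishes exactly at `ε = 0` or `|ω| = 1/2`, where the
pattern is trivial. -/
theorem linSymbol_one {ε ω : ℝ} (hε : ε ∈ Set.Icc 0 (1 / 8 : ℝ))
    (hω : ω ∈ Set.Icc (-1 / 2 : ℝ) (1 / 2)) : linSymbol ε ω 1 = ε ^ 2 * (1 - 4 * ω ^ 2) := by
  rw [linSymbol, waveNumber_sq hε hω]
  push_cast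
  ring

theorem four_le_sq {n : ℤ} (hn : 2 ≤ |n|) : (4 : ℝ) ≤ (n : ℝ) ^ 2 := by
  have h : (4 : ℤ) ≤ n ^ 2 := by rw [← sq_abs]; nlinarith
  exact_mod_cast h

theorem linSymbol_le {ε ω : ℝ} (hε : ε ∈ Set.Icc 0 (1 / 8 : ℝ))
    (hω : ω ∈ Set.Icc (-1 / 2 : ℝ) (1 / 2)) {n : ℤ} (hn : 2 ≤ |n|) :
    linSymbol ε ω n ≤ -((n : ℝ) ^ 2) ^ 2 / 4 := by
  have h1 := four_le_sq hn
  have h2 := waveNumber_sq_mem hε hω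
  -- Squaring this bound leaves at least `1/64` beyond `n⁴/4`, enough to absorb `ε²`.
  have h3 : (n : ℝ) ^ 2 / 2 + 1 / 8 ≤ waveNumber ε ω ^ 2 * n ^ 2 - 1 := by
    nlinarith [mul_le_mul_of_nonneg_right h2.1 (sq_nonneg (n : ℝ))]
  have h4 : ((n : ℝ) ^ 2 / 2 + 1 / 8) ^ 2 ≤ (waveNumber ε ω ^ 2 * n ^ 2 - 1) ^ 2 :=
    pow_le_pow_left₀ (by positivity) h3 2
  rw [linSymbol]
  nlinarith [hε.1, hε.2]

/-- The symbol of the inverse of the linear part on the modes `|n| ≥ 2`. -/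
def invSymbol (ε ω : ℝ) (n : ℤ) : ℝ := if 2 ≤ |n| then -(linSymbol ε ω n)⁻¹ else 0

theorem cosSymbol_invSymbol {ε ω : ℝ} (hε : ε ∈ Set.Icc 0 (1 / 8 : ℝ))
    (hω : ω ∈ Set.Icc (-1 / 2 : ℝ) (1 / 2)) : CosSymbol 7 (invSymbol ε ω) where
  even n := by simp only [invSymbol, abs_neg, linSymbol_neg]
  nonneg n := by
    rw [invSymbol]
    split_ifs with h
    · have h1 := linSymbol_le hε hω h
      have h2 : linSymbol ε ω n ≤ 0 := h1.trans (by have := four_le_sq h; nlinarith)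
      rw [neg_nonneg]
      exact inv_nonpos.2 h2
    · exact le_rfl
  le n := by
    rw [invSymbol]
    split_ifs with h
    · have h1 := linSymbol_le hε hω h
      have h2 := four_le_sq h
      rw [← inv_neg]
      -- The constant `7` comes from `(1 + x)² ≤ 7 x² / 4` for `x = n² ≥ 4`.
      have h3 : (1 + (n : ℝ) ^ 2) ^ 2 / 7 ≤ -linSymbol ε ω n := by nlinarith
      rw [← inv_div]
      exact inv_anti₀ (by positivity) h3
    · positivity

/-- The inverse of `(1 + k² ∂_ξ²)² - ε²` on the even functions with modes `|n| ≥ 2`. -/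
def greenOp (ε ω : ℝ) : C(Circ, ℝ) →L[ℝ] C(Circ, ℝ) := cosMult (invSymbol ε ω)

/-- The nonlinearity `s u² + u³`. -/
def nonlin (s : ℝ) (u : C(Circ, ℝ)) : C(Circ, ℝ) := s • u ^ 2 + u ^ 3

theorem nonlin_even {s : ℝ} {u : C(Circ, ℝ)} (hu : ∀ x, u (-x) = u x) (x : Circ) :
    nonlin s u (-x) = nonlin s u x := by
  simp [nonlin, hu]

/-- The Lyapunov--Schmidt form of the profile equation, with amplitude `A`. -/
structure ReducedProfile (s ε ω A : ℝ) (u : C(Circ, ℝ)) : Prop where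
  eq : u = A • cosC 1 - greenOp ε ω (nonlin s u)
  bifurcation : ε ^ 2 * (1 - 4 * ω ^ 2) * A = cosCoeff 1 (nonlin s u)

/-- The constant `q` has only a zeroth Fourier coefficient, so it decouples mode `0`; every other
mode satisfies a homogeneous relation. -/
theorem solvesProfile_iff (s ε ω q : ℝ) (u : RealH6) : SolvesProfile s ε ω q u ↔
    ∀ n : ℤ, -(waveNumber ε ω : ℂ) ^ 2 * (linSymbol ε ω n * realFourier n u.1 -
      realFourier n (nonlin s u.1)) = if n = 0 then (q : ℂ) else 0 := by
  have hconst : ∀ n : ℤ, realFourier n (ContinuousMap.const Circ q) = if n = 0 then (q : ℂ) else 0 := by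
    intro n
    have h : ContinuousMap.const Circ q = q • cosC 0 := by
      rw [cosC_zero]; ext; simp
    rw [h, map_smul, realFourier_cosC]
    by_cases hn : n = 0
    · subst hn; norm_num
    · simp [hn]
  have hdecomp : ε ^ 2 • u.1 - s • u.1 ^ 2 - u.1 ^ 3 = ε ^ 2 • u.1 - nonlin s u.1 := by
    rw [nonlin]; abel
  have hL : ∀ n : ℤ, coeff ((-(waveNumber ε ω : ℂ) ^ 2) •
      (-(helmholtzSq (waveNumber ε ω) 0 ⟨toL2 u.1, u.2⟩ : L2per)
        + toL2 (ε ^ 2 • u.1 - s • u.1 ^ 2 - u.1 ^ 3))) n =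
      -(waveNumber ε ω : ℂ) ^ 2 * (linSymbol ε ω n * realFourier n u.1 -
      realFourier n (nonlin s u.1)) := by
    intro n
    rw [coeff_smul, coeff_add, coeff_neg, coeff_helmholtzSq_zero, coeff_toL2, coeff_toL2, hdecomp,
      ← realFourier_apply, ← realFourier_apply, map_sub, map_smul, linSymbol, real_smul]
    push_cast
    ring
  have hR : ∀ n : ℤ, coeff (toL2 (ContinuousMap.const _ q)) n = if n = 0 then (q : ℂ) else 0 := by
    intro n
    rw [coeff_toL2, ← realFourier_apply, hconst]
  constructor
  · intro h n
    rw [← hL, ← hR]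
    exact congrArg (fun f => coeff f n) h
  · intro h
    refine coeff_ext fun n => ?_
    rw [hL, hR, h]

theorem realFourier_zero (u : C(Circ, ℝ)) :
    realFourier 0 u = ((∫ x, u x ∂AddCircle.haarAddCircle : ℝ) : ℂ) := by
  rw [realFourier_apply, fourierCoeff, ← integral_complex_ofReal]
  congr 1
  ext x
  simp

theorem greenOp_even {ε ω : ℝ} (hε : ε ∈ Set.Icc 0 (1 / 8 : ℝ))
    (hω : ω ∈ Set.Icc (-1 / 2 : ℝ) (1 / 2)) (f : C(Circ, ℝ)) (x : Circ) :
    greenOp ε ω f (-x) = greenOp ε ω f x :=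
  (cosSymbol_invSymbol hε hω).cosMult_even f x

theorem realFourier_ext {f g : C(Circ, ℝ)} (h : ∀ n, realFourier n f = realFourier n g) : f = g :=
  toComplex_injective (fourierCoeff_ext h)

theorem realFourier_cosC_one_of_two_le {n : ℤ} (hn : 2 ≤ |n|) : realFourier n (cosC 1) = 0 := by
  have h1 : n ≠ 1 := by rintro rfl; norm_num at hn
  have h2 : n ≠ -1 := by rintro rfl; norm_num at hn
  rw [realFourier_cosC, if_neg h1, if_neg h2]; simp

/-- Lyapunov–Schmidt splitting by modes: the mean vanishes, `|n| ≥ 2` is solved by the Green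
operator, and `n = ±1` is one real equation because evenness makes the coefficients real. -/
theorem IsPattern.reduced {s ε ω : ℝ} {u : RealH6} (h : IsPattern s ε ω u)
    (hε : ε ∈ Set.Icc 0 (1 / 8 : ℝ)) (hω : ω ∈ Set.Icc (-1 / 2 : ℝ) (1 / 2)) :
    ReducedProfile s ε ω (cosCoeff 1 u.1) u.1 := by
  obtain ⟨q, hq⟩ := h.profile
  rw [solvesProfile_iff] at hq
  have hk := waveNumber_sq_mem hε hω
  have hk0 : (waveNumber ε ω : ℂ) ^ 2 ≠ 0 := by
    rw [← ofReal_pow, ofReal_ne_zero]; linarith [hk.1]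
  have hn : ∀ n : ℤ, n ≠ 0 → linSymbol ε ω n * realFourier n u.1 =
      realFourier n (nonlin s u.1) := by
    intro n hn
    have := hq n
    rw [if_neg hn, mul_eq_zero, neg_eq_zero] at this
    exact sub_eq_zero.1 (this.resolve_left hk0)
  have hK := cosSymbol_invSymbol hε hω
  constructor
  · refine realFourier_ext fun n => ?_
    rw [map_sub, map_smul, greenOp, hK.realFourier_cosMult]
    rcases eq_or_ne n 0 with rfl | h0
    · rw [realFourier_zero, h.mean_zero, realFourier_cosC]
      simp [invSymbol]
    · by_cases h2 : 2 ≤ |n|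
      · rw [realFourier_cosC_one_of_two_le h2]
        have h3 := hn n h0
        have h4 := linSymbol_le hε hω h2
        have h5 : (linSymbol ε ω n : ℂ) ≠ 0 := by
          rw [ofReal_ne_zero]; have := four_le_sq h2; nlinarith
        have h6 := realFourier_eq_cosCoeff (nonlin_even (s := s) h.even) n
        rw [invSymbol, if_pos h2, mul_div_assoc, ofReal_mul, ← h6, ← h3]
        push_cast
        field_simp
        simp
      · have h3 : n = 1 ∨ n = -1 := by
          have := abs_lt.1 (not_le.1 h2)
          omega
        rw [realFourier_eq_cosCoeff h.even, invSymbol, if_neg h2, realFourier_cosC]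
        rcases h3 with rfl | rfl
        · norm_num [real_smul]
          ring
        · rw [cosCoeff_neg]
          norm_num [real_smul]
          ring
  · have h1 := hn 1 one_ne_zero
    rw [realFourier_eq_cosCoeff h.even, realFourier_eq_cosCoeff (nonlin_even h.even),
      linSymbol_one hε hω] at h1
    have h2 : ε ^ 2 * (1 - 4 * ω ^ 2) * (cosCoeff 1 u.1 / 2) = cosCoeff 1 (nonlin s u.1) / 2 := by
      exact_mod_cast h1
    linarith

theorem cosCoeff_one_cosC_one : cosCoeff 1 (cosC 1) = 1 := by
  rw [cosCoeff_apply, realFourier_cosC]; norm_num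

theorem cosCoeff_one_greenOp {ε ω : ℝ} (hε : ε ∈ Set.Icc 0 (1 / 8 : ℝ))
    (hω : ω ∈ Set.Icc (-1 / 2 : ℝ) (1 / 2)) (f : C(Circ, ℝ)) :
    cosCoeff 1 (greenOp ε ω f) = 0 := by
  rw [greenOp, (cosSymbol_invSymbol hε hω).cosCoeff_cosMult]
  simp [invSymbol]

namespace ReducedProfile

variable {s ε ω A : ℝ} {u : C(Circ, ℝ)}

theorem even (h : ReducedProfile s ε ω A u) (hε : ε ∈ Set.Icc 0 (1 / 8 : ℝ))
    (hω : ω ∈ Set.Icc (-1 / 2 : ℝ) (1 / 2)) (x : Circ) : u (-x) = u x := by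
  rw [h.eq]
  simp [cosC_even, greenOp_even hε hω]

theorem cosCoeff_one (h : ReducedProfile s ε ω A u) (hε : ε ∈ Set.Icc 0 (1 / 8 : ℝ))
    (hω : ω ∈ Set.Icc (-1 / 2 : ℝ) (1 / 2)) : cosCoeff 1 u = A := by
  rw [h.eq, map_sub, map_smul, cosCoeff_one_cosC_one, cosCoeff_one_greenOp hε hω]
  simp

theorem realFourier_zero (h : ReducedProfile s ε ω A u) (hε : ε ∈ Set.Icc 0 (1 / 8 : ℝ))
    (hω : ω ∈ Set.Icc (-1 / 2 : ℝ) (1 / 2)) : realFourier 0 u = 0 := by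
  rw [h.eq, map_sub, map_smul, greenOp, (cosSymbol_invSymbol hε hω).realFourier_cosMult,
    realFourier_cosC]
  simp [invSymbol]

/-- Converse of the splitting: for `|n| ≥ 2` the linear symbol undoes the Green operator, and at `n
= ±1` the identity is the bifurcation equation. Mode `0` is left to the constant `q`. -/
theorem linSymbol_mul (h : ReducedProfile s ε ω A u) (hε : ε ∈ Set.Icc 0 (1 / 8 : ℝ))
    (hω : ω ∈ Set.Icc (-1 / 2 : ℝ) (1 / 2)) {n : ℤ} (hn : n ≠ 0) :
    linSymbol ε ω n * realFourier n u = realFourier n (nonlin s u) := by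
  have hK := cosSymbol_invSymbol hε hω
  have hev := nonlin_even (s := s) (h.even hε hω)
  by_cases h2 : 2 ≤ |n|
  · have h3 : realFourier n u = realFourier n (A • cosC 1 - greenOp ε ω (nonlin s u)) := by
      rw [← h.eq]
    rw [h3, map_sub, map_smul, greenOp, hK.realFourier_cosMult, realFourier_cosC_one_of_two_le h2,
      realFourier_eq_cosCoeff hev, invSymbol, if_pos h2]
    have h4 := linSymbol_le hε hω h2
    have h5 : (linSymbol ε ω n : ℂ) ≠ 0 := by
      rw [ofReal_ne_zero]; have := four_le_sq h2; nlinarith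
    push_cast
    field_simp
    simp
  · have h1 : linSymbol ε ω 1 * cosCoeff 1 u = cosCoeff 1 (nonlin s u) := by
      rw [linSymbol_one hε hω, h.cosCoeff_one hε hω, h.bifurcation]
    have h3 : n = 1 ∨ n = -1 := by
      have := abs_lt.1 (not_le.1 h2)
      omega
    rw [realFourier_eq_cosCoeff (h.even hε hω), realFourier_eq_cosCoeff hev]
    rcases h3 with rfl | rfl
    · rw [← h1]; push_cast; ring
    · rw [linSymbol_neg, cosCoeff_neg, cosCoeff_neg, ← h1]; push_cast; ring

theorem exists_solvesProfile {u : RealH6} (h : ReducedProfile s ε ω A u.1)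
    (hε : ε ∈ Set.Icc 0 (1 / 8 : ℝ)) (hω : ω ∈ Set.Icc (-1 / 2 : ℝ) (1 / 2)) :
    ∃ q : ℝ, SolvesProfile s ε ω q u := by
  -- Since `u` has mean zero, mode `0` of the equation determines `q` as `k²` times the mean of the
  -- nonlinearity.
  refine ⟨waveNumber ε ω ^ 2 * (cosCoeff 0 (nonlin s u.1) / 2), ?_⟩
  rw [solvesProfile_iff]
  intro n
  split_ifs with hn
  · subst hn
    rw [h.realFourier_zero hε hω, realFourier_eq_cosCoeff (nonlin_even (h.even hε hω))]
    push_cast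
    ring
  · rw [h.linSymbol_mul hε hω hn, sub_self, mul_zero]

theorem isPattern {u : RealH6} (h : ReducedProfile s ε ω A u.1)
    (hε : ε ∈ Set.Icc 0 (1 / 8 : ℝ)) (hω : ω ∈ Set.Icc (-1 / 2 : ℝ) (1 / 2))
    (hpos : 0 < ε → |ω| < 1 / 2 → 0 < u.1 0) (htriv : ε = 0 ∨ |ω| = 1 / 2 → u.1 = 0) :
    IsPattern s ε ω u where
  profile := h.exists_solvesProfile hε hω
  mean_zero := by
    have h1 := MatthewsCox.realFourier_zero u.1
    rw [h.realFourier_zero hε hω] at h1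
    exact_mod_cast h1.symm
  even := h.even hε hω
  pos := hpos
  trivial_state := htriv

end ReducedProfile

/-! ### Analysis of the reduced profile equation -/

/-- The norm bound for the Green operator. -/
def greenBound : ℝ := 7 * invSqSum

theorem greenBound_nonneg : 0 ≤ greenBound := mul_nonneg (by norm_num) invSqSum_nonneg

theorem norm_greenOp_le {ε ω : ℝ} (hε : ε ∈ Set.Icc 0 (1 / 8 : ℝ))
    (hω : ω ∈ Set.Icc (-1 / 2 : ℝ) (1 / 2)) (f : C(Circ, ℝ)) :
    ‖greenOp ε ω f‖ ≤ greenBound * ‖f‖ :=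
  (cosSymbol_invSymbol hε hω).norm_cosMult_apply_le f

/-- The profile, divided by its amplitude `A`. -/
def shape (A : ℝ) (g : C(Circ, ℝ)) : C(Circ, ℝ) := cosC 1 + A • g

/-- The nonlinearity at `A • shape A g`, divided by `A²`. -/
def scaledNonlin (s A : ℝ) (g : C(Circ, ℝ)) : C(Circ, ℝ) :=
  s • shape A g ^ 2 + A • shape A g ^ 3

theorem nonlin_smul_shape (s A : ℝ) (g : C(Circ, ℝ)) :
    nonlin s (A • shape A g) = A ^ 2 • scaledNonlin s A g := by
  ext x
  simp only [nonlin, scaledNonlin, ContinuousMap.add_apply, ContinuousMap.smul_apply,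
    ContinuousMap.pow_apply, smul_eq_mul]
  ring

/-- The coefficient in the bifurcation equation `ε² (1 - 4ω²) = A² Γ`. -/
def bifCoeff (s A : ℝ) (g : C(Circ, ℝ)) : ℝ :=
  s * (2 * cosCoeff 1 (cosC 1 * g) + A * cosCoeff 1 (g ^ 2)) + cosCoeff 1 (shape A g ^ 3)

theorem cosCoeff_cosC (m n : ℤ) :
    cosCoeff m (cosC n) = (if m = n then 1 else 0) + (if m = -n then 1 else 0) := by
  rw [cosCoeff_apply, realFourier_cosC]
  split_ifs <;> norm_num

theorem cosC_one_sq : cosC 1 ^ 2 = (1 / 2 : ℝ) • (cosC 2 + cosC 0) := by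
  rw [sq, cosC_mul]; norm_num

theorem cosC_one_mul_two : cosC 1 * cosC 2 = (1 / 2 : ℝ) • (cosC 3 + cosC 1) := by
  rw [cosC_mul, show (1 : ℤ) - 2 = -1 by norm_num, cosC_neg]; norm_num

theorem cosCoeff_one_cosC_sq : cosCoeff 1 (cosC 1 ^ 2) = 0 := by
  rw [cosC_one_sq, map_smul, map_add, cosCoeff_cosC, cosCoeff_cosC]; norm_num

theorem cosCoeff_one_cosC_one_mul_two : cosCoeff 1 (cosC 1 * cosC 2) = 1 / 2 := by
  rw [cosC_one_mul_two, map_smul, map_add, cosCoeff_cosC, cosCoeff_cosC]; norm_num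

theorem cosCoeff_one_cosC_cube : cosCoeff 1 (cosC 1 ^ 3) = 3 / 4 := by
  have h : cosC 1 ^ 3 = (1 / 2 : ℝ) • (cosC 1 * cosC 2 + cosC 1) := by
    rw [pow_succ', cosC_one_sq, mul_smul_comm, mul_add, cosC_zero, mul_one]
  rw [h, map_smul, map_add, cosCoeff_one_cosC_one_mul_two, cosCoeff_one_cosC_one]; norm_num

theorem CosSymbol.cosMult_cosC {D : ℝ} {κ : ℤ → ℝ} (h : CosSymbol D κ) (m : ℤ) :
    cosMult κ (cosC m) = κ m • cosC m := by
  refine realFourier_ext fun n => ?_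
  rw [h.realFourier_cosMult, map_smul, realFourier_cosC, cosCoeff_cosC]
  by_cases h1 : n = m
  · subst h1
    rw [if_pos rfl, if_pos rfl, real_smul]
    by_cases h2 : n = -n
    · rw [if_pos h2, if_pos h2]; push_cast; ring
    · rw [if_neg h2, if_neg h2]; push_cast; ring
  · by_cases h2 : n = -m
    · subst h2
      rw [h.even]
      simp [h1]
      ring
    · simp [h1, h2]

/-- `cos² ξ` has no first harmonic, so the quadratic term contributes only one order later. This is
what allows a factor `A` to be divided out of the bifurcation equation. -/
theorem cosCoeff_one_scaledNonlin (s A : ℝ) (g : C(Circ, ℝ)) :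
    cosCoeff 1 (scaledNonlin s A g) = A * bifCoeff s A g := by
  have h : shape A g ^ 2 = cosC 1 ^ 2 + (2 * A) • (cosC 1 * g) + A ^ 2 • g ^ 2 := by
    ext x
    simp only [shape, ContinuousMap.add_apply, ContinuousMap.smul_apply, ContinuousMap.mul_apply,
      ContinuousMap.pow_apply, smul_eq_mul]
    ring
  rw [scaledNonlin, bifCoeff, map_add, map_smul, map_smul, h, map_add, map_add, map_smul, map_smul,
    cosCoeff_one_cosC_sq]
  simp only [smul_eq_mul]
  ring

/-- The scaled profile equation for the correction `g`. -/
structure ScaledProfile (s ε ω A : ℝ) (g : C(Circ, ℝ)) : Prop where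
  eq : g = -greenOp ε ω (scaledNonlin s A g)
  bifurcation : ε ^ 2 * (1 - 4 * ω ^ 2) = A ^ 2 * bifCoeff s A g

theorem ScaledProfile.reducedProfile {s ε ω A : ℝ} {g : C(Circ, ℝ)}
    (h : ScaledProfile s ε ω A g) : ReducedProfile s ε ω A (A • shape A g) where
  eq := by
    rw [nonlin_smul_shape, map_smul, shape, smul_add, smul_smul, sub_eq_add_neg, ← smul_neg,
      ← h.eq, sq]
  bifurcation := by
    rw [nonlin_smul_shape, map_smul, cosCoeff_one_scaledNonlin, h.bifurcation, smul_eq_mul]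
    ring

theorem ReducedProfile.scaledProfile {s ε ω A : ℝ} {g : C(Circ, ℝ)} (hA : A ≠ 0)
    (h : ReducedProfile s ε ω A (A • shape A g)) : ScaledProfile s ε ω A g where
  eq := by
    have h1 := h.eq
    rw [nonlin_smul_shape, map_smul, shape, smul_add, smul_smul, sub_eq_add_neg, ← smul_neg,
      ← sq] at h1
    exact smul_right_injective _ (pow_ne_zero 2 hA) (add_left_cancel h1)
  bifurcation := by
    have h1 := h.bifurcation
    rw [nonlin_smul_shape, map_smul, cosCoeff_one_scaledNonlin, smul_eq_mul] at h1
    refine mul_right_cancel₀ hA ?_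
    rw [h1]; ring

/-- A bound for the correction `g`. -/
def corrBound (s : ℝ) : ℝ := greenBound * (4 * |s| + 8) + 1

/-- A Lipschitz constant of the fixed point map. -/
def corrLip (s : ℝ) : ℝ := greenBound * ((4 * |s| + 12) * corrBound s + 8) + 1

/-- The range of amplitudes in which the fixed point map is a contraction. -/
def ampBound (s : ℝ) : ℝ := 1 / (2 * corrLip s + 2 * corrBound s)

theorem one_le_corrBound (s : ℝ) : 1 ≤ corrBound s := by
  have := greenBound_nonneg
  have h : 0 ≤ greenBound * (4 * |s| + 8) := by positivity
  rw [corrBound]; linarith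

theorem one_le_corrLip (s : ℝ) : 1 ≤ corrLip s := by
  have := greenBound_nonneg
  have := one_le_corrBound s
  have h : 0 ≤ greenBound * ((4 * |s| + 12) * corrBound s + 8) := by positivity
  rw [corrLip]; linarith

theorem ampBound_pos (s : ℝ) : 0 < ampBound s := by
  have := one_le_corrBound s
  have := one_le_corrLip s
  rw [ampBound]; positivity

/-! ### Contraction and Lipschitz estimates, uniform in `ε` and `ω` -/

section Estimates

variable {s A A₁ A₂ : ℝ} {g g₁ g₂ : C(Circ, ℝ)}

theorem abs_mul_corrBound_le (hA : |A| ≤ ampBound s) : |A| * corrBound s ≤ 1 / 2 := by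
  have h1 := one_le_corrBound s
  have h2 := one_le_corrLip s
  rw [ampBound, le_div_iff₀ (by positivity)] at hA
  nlinarith [abs_nonneg A]

theorem abs_mul_corrLip_le (hA : |A| ≤ ampBound s) : |A| * corrLip s ≤ 1 / 2 := by
  have h1 := one_le_corrBound s
  have h2 := one_le_corrLip s
  rw [ampBound, le_div_iff₀ (by positivity)] at hA
  nlinarith [abs_nonneg A]

theorem abs_le_one_of_le_ampBound (hA : |A| ≤ ampBound s) : |A| ≤ 1 := by
  have := abs_mul_corrLip_le hA
  nlinarith [one_le_corrLip s, abs_nonneg A]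

theorem norm_smul_corr_le (hA : |A| ≤ ampBound s) (hg : ‖g‖ ≤ corrBound s) :
    ‖A • g‖ ≤ 1 / 2 := by
  rw [norm_smul, Real.norm_eq_abs]
  exact (mul_le_mul_of_nonneg_left hg (abs_nonneg _)).trans (abs_mul_corrBound_le hA)

theorem norm_shape_le (hA : |A| ≤ ampBound s) (hg : ‖g‖ ≤ corrBound s) : ‖shape A g‖ ≤ 2 := by
  have h1 := norm_add_le (cosC 1) (A • g)
  have h2 := norm_cosC_le 1
  have h3 := norm_smul_corr_le hA hg
  rw [shape]; linarith

theorem norm_scaledNonlin_le (hA : |A| ≤ ampBound s) (hg : ‖g‖ ≤ corrBound s) :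
    ‖scaledNonlin s A g‖ ≤ 4 * |s| + 8 := by
  have h1 := norm_shape_le hA hg
  have h2 := abs_le_one_of_le_ampBound hA
  rw [scaledNonlin]
  calc _ ≤ |s| * ‖shape A g‖ ^ 2 + |A| * ‖shape A g‖ ^ 3 := by
        refine (norm_add_le _ _).trans ?_
        rw [norm_smul, norm_smul, Real.norm_eq_abs, Real.norm_eq_abs]
        gcongr
        · exact norm_pow_le _ _
        · exact norm_pow_le _ _
    _ ≤ |s| * 2 ^ 2 + 1 * 2 ^ 3 := by gcongr
    _ = _ := by ring

/-- In the splitting `(A₁ - A₂) g₁ + A₂ (g₁ - g₂)` the difference of the corrections carries the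
small factor `A₂`; this makes the fixed point map a contraction. -/
theorem norm_shape_sub_le (hg₁ : ‖g₁‖ ≤ corrBound s) :
    ‖shape A₁ g₁ - shape A₂ g₂‖ ≤ corrBound s * |A₁ - A₂| + |A₂| * ‖g₁ - g₂‖ := by
  have h : shape A₁ g₁ - shape A₂ g₂ = (A₁ - A₂) • g₁ + A₂ • (g₁ - g₂) := by
    rw [shape, shape, sub_smul, smul_sub]; abel
  rw [h]
  refine (norm_add_le _ _).trans ?_
  rw [norm_smul, norm_smul, Real.norm_eq_abs, Real.norm_eq_abs, mul_comm (corrBound s)]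
  gcongr

theorem norm_sq_sub_sq_le {a b : C(Circ, ℝ)} {r : ℝ} (ha : ‖a‖ ≤ r) (hb : ‖b‖ ≤ r) :
    ‖a ^ 2 - b ^ 2‖ ≤ 2 * r * ‖a - b‖ := by
  rw [sq_sub_sq]
  refine (norm_mul_le _ _).trans (mul_le_mul_of_nonneg_right ?_ (norm_nonneg _))
  exact (norm_add_le _ _).trans (by linarith)

theorem norm_cube_sub_cube_le {a b : C(Circ, ℝ)} {r : ℝ} (ha : ‖a‖ ≤ r) (hb : ‖b‖ ≤ r) :
    ‖a ^ 3 - b ^ 3‖ ≤ 3 * r ^ 2 * ‖a - b‖ := by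
  have h : a ^ 3 - b ^ 3 = (a * a + a * b + b * b) * (a - b) := by ring
  have hr : 0 ≤ r := (norm_nonneg _).trans ha
  rw [h]
  refine (norm_mul_le _ _).trans (mul_le_mul_of_nonneg_right ?_ (norm_nonneg _))
  calc _ ≤ ‖a‖ * ‖a‖ + ‖a‖ * ‖b‖ + ‖b‖ * ‖b‖ := by
        refine (norm_add_le _ _).trans (add_le_add ((norm_add_le _ _).trans ?_) (norm_mul_le _ _))
        exact add_le_add (norm_mul_le _ _) (norm_mul_le _ _)
    _ ≤ r * r + r * r + r * r := by gcongr
    _ = _ := by ring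

theorem norm_scaledNonlin_sub_le (hA₁ : |A₁| ≤ ampBound s) (hA₂ : |A₂| ≤ ampBound s)
    (hg₁ : ‖g₁‖ ≤ corrBound s) (hg₂ : ‖g₂‖ ≤ corrBound s) :
    ‖scaledNonlin s A₁ g₁ - scaledNonlin s A₂ g₂‖ ≤
      ((4 * |s| + 12) * corrBound s + 8) * (|A₁ - A₂| + |A₂| * ‖g₁ - g₂‖) := by
  set y₁ := shape A₁ g₁
  set y₂ := shape A₂ g₂
  have h1 : ‖y₁‖ ≤ 2 := norm_shape_le hA₁ hg₁
  have h2 : ‖y₂‖ ≤ 2 := norm_shape_le hA₂ hg₂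
  have h3 : ‖y₁ - y₂‖ ≤ _ := norm_shape_sub_le (A₁ := A₁) (A₂ := A₂) (g₂ := g₂) hg₁
  have h4 := norm_sq_sub_sq_le h1 h2
  have h5 := norm_cube_sub_cube_le h1 h2
  have hA2 := abs_le_one_of_le_ampBound hA₂
  have hρ := one_le_corrBound s
  have h : scaledNonlin s A₁ g₁ - scaledNonlin s A₂ g₂ =
      s • (y₁ ^ 2 - y₂ ^ 2) + (A₁ - A₂) • y₁ ^ 3 + A₂ • (y₁ ^ 3 - y₂ ^ 3) := by
    rw [scaledNonlin, scaledNonlin, smul_sub, smul_sub, sub_smul]; abel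
  have h6 : ‖y₁ ^ 3‖ ≤ 8 := by
    refine (norm_pow_le _ _).trans ?_
    calc _ ≤ (2 : ℝ) ^ 3 := by gcongr
      _ = 8 := by norm_num
  rw [h]
  set d := |A₁ - A₂|
  set e := |A₂| * ‖g₁ - g₂‖
  have hd : 0 ≤ d := abs_nonneg _
  have he : 0 ≤ e := by positivity
  have hs := abs_nonneg s
  calc _ ≤ |s| * (2 * 2 * ‖y₁ - y₂‖) + d * 8 + 1 * (3 * 2 ^ 2 * ‖y₁ - y₂‖) := by
        refine (norm_add_le _ _).trans (add_le_add ((norm_add_le _ _).trans ?_) ?_)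
        · rw [norm_smul, norm_smul, Real.norm_eq_abs, Real.norm_eq_abs]
          gcongr
        · rw [norm_smul, Real.norm_eq_abs]
          gcongr
    _ = (4 * |s| + 12) * ‖y₁ - y₂‖ + 8 * d := by ring
    _ ≤ (4 * |s| + 12) * (corrBound s * d + e) + 8 * d := by gcongr
    _ ≤ _ := by
        have : 0 ≤ (4 * |s| + 12) * e * (corrBound s - 1) := by
          have := sub_nonneg.2 hρ; positivity
        nlinarith

theorem norm_green_scaledNonlin_sub_le {ε ω : ℝ} (hε : ε ∈ Set.Icc 0 (1 / 8 : ℝ))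
    (hω : ω ∈ Set.Icc (-1 / 2 : ℝ) (1 / 2)) (hA₁ : |A₁| ≤ ampBound s) (hA₂ : |A₂| ≤ ampBound s)
    (hg₁ : ‖g₁‖ ≤ corrBound s) (hg₂ : ‖g₂‖ ≤ corrBound s) :
    ‖greenOp ε ω (scaledNonlin s A₁ g₁) - greenOp ε ω (scaledNonlin s A₂ g₂)‖ ≤
      corrLip s * (|A₁ - A₂| + |A₂| * ‖g₁ - g₂‖) := by
  rw [← map_sub]
  refine (norm_greenOp_le hε hω _).trans ?_
  have h1 := mul_le_mul_of_nonneg_left (norm_scaledNonlin_sub_le hA₁ hA₂ hg₁ hg₂) greenBound_nonneg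
  refine h1.trans ?_
  rw [corrLip, ← mul_assoc]
  refine mul_le_mul_of_nonneg_right (by linarith) (by positivity)

/-- The term with `g₁ - g₂` on the right has a factor at most `1/2` and is absorbed on the left. For
`A₁ = A₂` this contains uniqueness of the fixed point. -/
theorem norm_sub_le_of_fixed {ε ω : ℝ} (hε : ε ∈ Set.Icc 0 (1 / 8 : ℝ))
    (hω : ω ∈ Set.Icc (-1 / 2 : ℝ) (1 / 2)) (hA₁ : |A₁| ≤ ampBound s) (hA₂ : |A₂| ≤ ampBound s)
    (hg₁ : ‖g₁‖ ≤ corrBound s) (hg₂ : ‖g₂‖ ≤ corrBound s)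
    (h₁ : g₁ = -greenOp ε ω (scaledNonlin s A₁ g₁))
    (h₂ : g₂ = -greenOp ε ω (scaledNonlin s A₂ g₂)) :
    ‖g₁ - g₂‖ ≤ 2 * corrLip s * |A₁ - A₂| := by
  have h3 := norm_green_scaledNonlin_sub_le hε hω hA₁ hA₂ hg₁ hg₂
  have h4 : ‖g₁ - g₂‖ =
      ‖greenOp ε ω (scaledNonlin s A₁ g₁) - greenOp ε ω (scaledNonlin s A₂ g₂)‖ := by
    conv_lhs => rw [h₁, h₂]
    rw [← norm_neg]
    congr 1
    abel
  rw [← h4] at h3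
  have h5 := abs_mul_corrLip_le hA₂
  nlinarith [norm_nonneg (g₁ - g₂)]

/-- For each small amplitude the fixed point equation is solvable. -/
theorem exists_fixed {ε ω : ℝ} (hε : ε ∈ Set.Icc 0 (1 / 8 : ℝ))
    (hω : ω ∈ Set.Icc (-1 / 2 : ℝ) (1 / 2)) (hA : |A| ≤ ampBound s) :
    ∃ g, ‖g‖ ≤ corrBound s ∧ g = -greenOp ε ω (scaledNonlin s A g) := by
  set B : Set C(Circ, ℝ) := Metric.closedBall 0 (corrBound s) with hB
  have hBm : ∀ g, g ∈ B ↔ ‖g‖ ≤ corrBound s := fun g => by rw [hB, mem_closedBall_zero_iff]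
  have hmaps : Set.MapsTo (fun g => -greenOp ε ω (scaledNonlin s A g)) B B := by
    intro g hg
    rw [hBm] at hg ⊢
    rw [norm_neg]
    refine (norm_greenOp_le hε hω _).trans ?_
    have := mul_le_mul_of_nonneg_left (norm_scaledNonlin_le hA hg) greenBound_nonneg
    rw [corrBound]; linarith
  have hK : ContractingWith (1 / 2) (hmaps.restrict _ _ _) := by
    refine ⟨by norm_num, LipschitzWith.of_dist_le_mul fun g₁ g₂ => ?_⟩
    have h3 := norm_green_scaledNonlin_sub_le hε hω hA hA ((hBm _).1 g₁.2) ((hBm _).1 g₂.2)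
    rw [sub_self, abs_zero, zero_add] at h3
    rw [Subtype.dist_eq, Subtype.dist_eq, dist_eq_norm, dist_eq_norm]
    change ‖-greenOp ε ω (scaledNonlin s A g₁) - -greenOp ε ω (scaledNonlin s A g₂)‖ ≤ _
    rw [neg_sub_neg, norm_sub_rev]
    refine h3.trans ?_
    have h5 := abs_mul_corrLip_le hA
    rw [← mul_assoc, mul_comm (corrLip s)]
    refine mul_le_mul_of_nonneg_right ?_ (norm_nonneg _)
    simpa using h5
  obtain ⟨g, hg, hfix, -⟩ := hK.exists_fixedPoint' Metric.isClosed_closedBall.isComplete hmaps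
    (x := 0) ((hBm _).2 (by simpa using zero_le_one.trans (one_le_corrBound s))) (edist_ne_top _ _)
  exact ⟨g, (hBm g).1 hg, hfix.symm⟩

/-- A Lipschitz constant of the bifurcation coefficient. -/
def bifLip (s : ℝ) : ℝ :=
  2 * (|s| * (4 + corrBound s ^ 2) + 12 * corrBound s + 12) * (1 + 2 * corrLip s)

theorem bifLip_pos (s : ℝ) : 0 < bifLip s := by
  have := one_le_corrBound s
  have := one_le_corrLip s
  rw [bifLip]; positivity

theorem abs_bifCoeff_sub_le (hA₁ : |A₁| ≤ ampBound s) (hA₂ : |A₂| ≤ ampBound s)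
    (hg₁ : ‖g₁‖ ≤ corrBound s) (hg₂ : ‖g₂‖ ≤ corrBound s)
    (hg : ‖g₁ - g₂‖ ≤ 2 * corrLip s * |A₁ - A₂|) :
    |bifCoeff s A₁ g₁ - bifCoeff s A₂ g₂| ≤ bifLip s * |A₁ - A₂| := by
  have h1 := norm_shape_le hA₁ hg₁
  have h2 := norm_shape_le hA₂ hg₂
  have h3 := norm_shape_sub_le (A₁ := A₁) (A₂ := A₂) (g₂ := g₂) hg₁
  have hA2 := abs_le_one_of_le_ampBound hA₂
  have hρ := one_le_corrBound s
  set d := |A₁ - A₂|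
  set e := ‖g₁ - g₂‖
  have hd : 0 ≤ d := abs_nonneg _
  have he : 0 ≤ e := norm_nonneg _
  have h : bifCoeff s A₁ g₁ - bifCoeff s A₂ g₂ = cosCoeff 1
      (s • ((2 : ℝ) • (cosC 1 * (g₁ - g₂)) + (A₁ - A₂) • g₁ ^ 2 + A₂ • (g₁ ^ 2 - g₂ ^ 2)) +
        (shape A₁ g₁ ^ 3 - shape A₂ g₂ ^ 3)) := by
    rw [bifCoeff, bifCoeff]
    simp only [mul_sub, map_add, map_sub, map_smul, smul_eq_mul]
    ring
  rw [h]
  refine (abs_cosCoeff_le _ _).trans ?_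
  have h4 : ‖cosC 1 * (g₁ - g₂)‖ ≤ 1 * e :=
    (norm_mul_le _ _).trans (mul_le_mul_of_nonneg_right (norm_cosC_le 1) he)
  have h5 : ‖g₁ ^ 2‖ ≤ corrBound s ^ 2 :=
    (norm_pow_le _ _).trans (pow_le_pow_left₀ (norm_nonneg _) hg₁ 2)
  have h6 : ‖A₂ • (g₁ ^ 2 - g₂ ^ 2)‖ ≤ 1 * e := by
    rw [norm_smul, Real.norm_eq_abs]
    calc _ ≤ |A₂| * (2 * corrBound s * e) :=
          mul_le_mul_of_nonneg_left (norm_sq_sub_sq_le hg₁ hg₂) (abs_nonneg _)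
      _ = 2 * (|A₂| * corrBound s) * e := by ring
      _ ≤ 2 * (1 / 2) * e := by
          have := abs_mul_corrBound_le hA₂
          gcongr
      _ = _ := by ring
  have h7 := norm_cube_sub_cube_le h1 h2
  have h8 : ‖shape A₁ g₁ - shape A₂ g₂‖ ≤ corrBound s * d + 1 * e :=
    h3.trans (by gcongr)
  have h9 : ‖s • ((2 : ℝ) • (cosC 1 * (g₁ - g₂)) + (A₁ - A₂) • g₁ ^ 2 + A₂ • (g₁ ^ 2 - g₂ ^ 2)) +
        (shape A₁ g₁ ^ 3 - shape A₂ g₂ ^ 3)‖ ≤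
      |s| * (2 * (1 * e) + d * corrBound s ^ 2 + 1 * e) +
        3 * 2 ^ 2 * (corrBound s * d + 1 * e) := by
    refine (norm_add_le _ _).trans (add_le_add ?_ (h7.trans (by gcongr)))
    rw [norm_smul, Real.norm_eq_abs]
    refine mul_le_mul_of_nonneg_left ?_ (abs_nonneg _)
    refine (norm_add_le _ _).trans (add_le_add ((norm_add_le _ _).trans (add_le_add ?_ ?_)) h6)
    · rw [norm_smul, Real.norm_ofNat]
      gcongr
    · rw [norm_smul, Real.norm_eq_abs]
      gcongr
  have h10 : |s| * (2 * (1 * e) + d * corrBound s ^ 2 + 1 * e) +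
        3 * 2 ^ 2 * (corrBound s * d + 1 * e) ≤
      (|s| * (4 + corrBound s ^ 2) + 12 * corrBound s + 12) * (d + e) := by
    have e1 : 0 ≤ |s| * (e + 4 * d + corrBound s ^ 2 * e) := by positivity
    have e2 : 0 ≤ corrBound s * e := by positivity
    nlinarith
  have h11 : d + e ≤ (1 + 2 * corrLip s) * d := by linarith
  have h12 : 0 ≤ |s| * (4 + corrBound s ^ 2) + 12 * corrBound s + 12 := by positivity
  rw [bifLip]
  have h13 := mul_le_mul_of_nonneg_left h11 h12
  linarith

end Estimates

/-! ### The bifurcation coefficient and the amplitude equation -/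

/-- The cubic coefficient of the amplitude equation. -/
def landau (s : ℝ) : ℝ := 3 / 4 - s ^ 2 / 18

theorem landau_pos {s : ℝ} (hs : s ∈ Set.Ioo (-Real.sqrt (27 / 2)) (Real.sqrt (27 / 2))) :
    0 < landau s := by
  have h1 : s ^ 2 < 27 / 2 := by
    have := sq_lt_sq' hs.1 hs.2
    rwa [Real.sq_sqrt (by norm_num)] at this
  rw [landau]; linarith

/-- At `k = 1` and `ε = 0` the second harmonic has symbol `-(1 - 4)² = -9`; the term `24 ε` covers
the variation of `k²`. -/
theorem invSymbol_two_le {ε ω : ℝ} (hε : ε ∈ Set.Icc 0 (1 / 8 : ℝ))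
    (hω : ω ∈ Set.Icc (-1 / 2 : ℝ) (1 / 2)) : invSymbol ε ω 2 ≤ 1 / (9 - 24 * ε) := by
  have h1 := abs_le.1 (abs_waveNumber_sq_sub_le hε hω)
  have h2 : 9 - 24 * ε ≤ -linSymbol ε ω 2 := by
    rw [linSymbol]
    push_cast
    have h3 : 3 - 4 * ε ≤ waveNumber ε ω ^ 2 * 2 ^ 2 - 1 := by linarith
    have h4 := pow_le_pow_left₀ (by linarith [hε.2]) h3 2
    nlinarith [hε.1]
  rw [invSymbol, if_pos (by norm_num), ← inv_neg, one_div]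
  exact inv_anti₀ (by linarith [hε.2]) h2

/-- At `A = 0` the fixed point equation is explicit: only the second harmonic of `cos²` passes the
Green operator, so `g = -(s κ₂ / 2) cos 2ξ` with `κ₂ = invSymbol ε ω 2`. Its product with `cos ξ`
feeds back into the first harmonic and gives `3/4 - s² κ₂ / 2`. The error `3 ε` is `(2/9) s² ε` with
`s² < 27/2`. -/
theorem bifCoeff_zero_ge {s ε ω : ℝ} (hs : 0 < landau s) (hε : ε ∈ Set.Icc 0 (1 / 8 : ℝ))
    (hω : ω ∈ Set.Icc (-1 / 2 : ℝ) (1 / 2)) {g : C(Circ, ℝ)}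
    (hg : g = -greenOp ε ω (scaledNonlin s 0 g)) : landau s - 3 * ε ≤ bifCoeff s 0 g := by
  have hK := cosSymbol_invSymbol hε hω
  have h0 : invSymbol ε ω 0 = 0 := by simp [invSymbol]
  have h1 : g = (-(s * invSymbol ε ω 2 / 2)) • cosC 2 := by
    rw [hg, scaledNonlin, shape, zero_smul, zero_smul, add_zero, add_zero, map_smul, cosC_one_sq,
      map_smul, map_add, greenOp, hK.cosMult_cosC, hK.cosMult_cosC, h0, zero_smul, add_zero,
      smul_smul, smul_smul, neg_smul]
    congr 2
    ring
  have h2 : bifCoeff s 0 g = 3 / 4 - s ^ 2 * invSymbol ε ω 2 / 2 := by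
    rw [bifCoeff, shape, zero_smul, add_zero, cosCoeff_one_cosC_cube, h1, mul_smul_comm, map_smul,
      cosCoeff_one_cosC_one_mul_two, smul_eq_mul]
    ring
  rw [h2]
  rw [landau] at hs ⊢
  -- A linear upper bound for `1 / (9 - 24 ε)`, valid on `0 ≤ ε ≤ 1/8` with equality at both ends.
  have h3 : invSymbol ε ω 2 ≤ 1 / 9 + 4 / 9 * ε := by
    refine (invSymbol_two_le hε hω).trans ?_
    rw [div_le_iff₀ (by linarith [hε.2])]
    nlinarith [hε.1, hε.2]
  have h4 : s ^ 2 * invSymbol ε ω 2 ≤ s ^ 2 * (1 / 9 + 4 / 9 * ε) :=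
    mul_le_mul_of_nonneg_left h3 (sq_nonneg _)
  nlinarith [hε.1]

/-- A range of amplitudes in which the bifurcation coefficient is bounded below. -/
def smallAmp (s : ℝ) : ℝ := min (ampBound s) (landau s / (4 * bifLip s))

theorem smallAmp_pos {s : ℝ} (hs : 0 < landau s) : 0 < smallAmp s :=
  lt_min (ampBound_pos s) (div_pos hs (mul_pos (by norm_num) (bifLip_pos s)))

theorem smallAmp_le_ampBound (s : ℝ) : smallAmp s ≤ ampBound s := min_le_left _ _

theorem mul_bifLip_le {s A : ℝ} (hA : |A| ≤ smallAmp s) : |A| * bifLip s ≤ landau s / 4 := by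
  have h := hA.trans (min_le_right _ _)
  rw [le_div_iff₀ (mul_pos (by norm_num) (bifLip_pos s))] at h
  linarith

/-- Comparison with amplitude zero: `landau s` loses a quarter to `3 ε` and a quarter to the
Lipschitz variation in `A`. -/
theorem bifCoeff_ge {s ε ω A : ℝ} (hs : 0 < landau s) (hε : ε ∈ Set.Icc 0 (1 / 8 : ℝ))
    (hω : ω ∈ Set.Icc (-1 / 2 : ℝ) (1 / 2)) (hε' : ε ≤ landau s / 12) (hA : |A| ≤ smallAmp s)
    {g : C(Circ, ℝ)} (hgn : ‖g‖ ≤ corrBound s) (hg : g = -greenOp ε ω (scaledNonlin s A g)) :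
    landau s / 2 ≤ bifCoeff s A g := by
  have h0 : |(0 : ℝ)| ≤ ampBound s := by rw [abs_zero]; exact (ampBound_pos s).le
  have hA' := hA.trans (smallAmp_le_ampBound s)
  obtain ⟨g₀, hg₀n, hg₀⟩ := exists_fixed hε hω h0
  have h1 := abs_bifCoeff_sub_le hA' h0 hgn hg₀n (norm_sub_le_of_fixed hε hω hA' h0 hgn hg₀n hg hg₀)
  have h2 := bifCoeff_zero_ge hs hε hω hg₀
  rw [sub_zero] at h1
  have h3 := (abs_le.1 h1).1
  have h4 := mul_bifLip_le hA
  linarith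

/-- Existence of a solution of the scaled profile equation. -/
theorem exists_scaledProfile {s ε ω : ℝ} (hs : 0 < landau s) (hε : ε ∈ Set.Icc 0 (1 / 8 : ℝ))
    (hω : ω ∈ Set.Icc (-1 / 2 : ℝ) (1 / 2)) (hε' : ε ≤ landau s / 12)
    (hε'' : ε ^ 2 ≤ smallAmp s ^ 2 * (landau s / 2)) :
    ∃ A ∈ Set.Icc 0 (smallAmp s), ∃ g, ‖g‖ ≤ corrBound s ∧ ScaledProfile s ε ω A g := by
  have hβ0 : 0 ≤ 1 - 4 * ω ^ 2 := by nlinarith [hω.1, hω.2]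
  have hβ1 : 1 - 4 * ω ^ 2 ≤ 1 := by nlinarith [sq_nonneg ω]
  have ha := smallAmp_pos hs
  have hex : ∀ A : Set.Icc 0 (smallAmp s), ∃ g, ‖g‖ ≤ corrBound s ∧
      g = -greenOp ε ω (scaledNonlin s A g) := fun A =>
    exists_fixed hε hω (by rw [abs_of_nonneg A.2.1]; exact A.2.2.trans (smallAmp_le_ampBound s))
  choose G hGn hG using hex
  have hAb : ∀ A : Set.Icc 0 (smallAmp s), |(A : ℝ)| ≤ smallAmp s := fun A => by
    rw [abs_of_nonneg A.2.1]; exact A.2.2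
  -- The intermediate value theorem is applied to `A² Γ(A)` along the fixed points; `Γ` is Lipschitz
  -- there, and at the right end the lower bound on `Γ` exceeds the target.
  let Φ : Set.Icc 0 (smallAmp s) → ℝ := fun A => (A : ℝ) ^ 2 * bifCoeff s A (G A)
  have hlip : LipschitzWith (Real.toNNReal (bifLip s))
      (fun A : Set.Icc 0 (smallAmp s) => bifCoeff s A (G A)) := by
    refine LipschitzWith.of_dist_le_mul fun A₁ A₂ => ?_
    have h1 := (hAb A₁).trans (smallAmp_le_ampBound s)
    have h2 := (hAb A₂).trans (smallAmp_le_ampBound s)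
    rw [Real.coe_toNNReal _ (bifLip_pos s).le, Real.dist_eq, Subtype.dist_eq, Real.dist_eq]
    exact abs_bifCoeff_sub_le h1 h2 (hGn _) (hGn _)
      (norm_sub_le_of_fixed hε hω h1 h2 (hGn _) (hGn _) (hG _) (hG _))
  have hcont : Continuous Φ := (continuous_subtype_val.pow 2).mul hlip.continuous
  have h0 : (0 : ℝ) ∈ Set.Icc 0 (smallAmp s) := ⟨le_rfl, ha.le⟩
  have h1 : smallAmp s ∈ Set.Icc 0 (smallAmp s) := ⟨ha.le, le_rfl⟩
  have : PreconnectedSpace (Set.Icc 0 (smallAmp s)) :=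
    Subtype.preconnectedSpace isPreconnected_Icc
  have hmem : ε ^ 2 * (1 - 4 * ω ^ 2) ∈ Set.Icc (Φ ⟨0, h0⟩) (Φ ⟨smallAmp s, h1⟩) := by
    constructor
    · change (0 : ℝ) ^ 2 * _ ≤ _
      rw [zero_pow two_ne_zero, zero_mul]
      positivity
    · have h2 := bifCoeff_ge hs hε hω hε' (hAb ⟨_, h1⟩) (hGn ⟨_, h1⟩) (hG ⟨_, h1⟩)
      calc ε ^ 2 * (1 - 4 * ω ^ 2) ≤ ε ^ 2 * 1 := by gcongr
        _ ≤ smallAmp s ^ 2 * (landau s / 2) := by linarith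
        _ ≤ _ := mul_le_mul_of_nonneg_left h2 (sq_nonneg _)
  obtain ⟨A, hA⟩ := intermediate_value_univ _ _ hcont hmem
  exact ⟨A, A.2, G A, hGn A, hG A, hA.symm⟩

/-- Uniqueness for the scaled profile equation. -/
theorem scaledProfile_unique {s ε ω A₁ A₂ : ℝ} {g₁ g₂ : C(Circ, ℝ)} (hs : 0 < landau s)
    (hε : ε ∈ Set.Icc 0 (1 / 8 : ℝ)) (hω : ω ∈ Set.Icc (-1 / 2 : ℝ) (1 / 2))
    (hε' : ε ≤ landau s / 12) (h₁ : ScaledProfile s ε ω A₁ g₁) (h₂ : ScaledProfile s ε ω A₂ g₂)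
    (hp₁ : 0 < A₁) (hp₂ : 0 < A₂) (hA₁ : A₁ ≤ smallAmp s) (hA₂ : A₂ ≤ smallAmp s)
    (hg₁ : ‖g₁‖ ≤ corrBound s) (hg₂ : ‖g₂‖ ≤ corrBound s) : A₁ = A₂ ∧ g₁ = g₂ := by
  have hb₁ : |A₁| ≤ smallAmp s := by rwa [abs_of_pos hp₁]
  have hb₂ : |A₂| ≤ smallAmp s := by rwa [abs_of_pos hp₂]
  have hc₁ := hb₁.trans (smallAmp_le_ampBound s)
  have hc₂ := hb₂.trans (smallAmp_le_ampBound s)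
  have hd := norm_sub_le_of_fixed hε hω hc₁ hc₂ hg₁ hg₂ h₁.eq h₂.eq
  have hl := abs_bifCoeff_sub_le hc₁ hc₂ hg₁ hg₂ hd
  have hlow := bifCoeff_ge hs hε hω hε' hb₁ hg₁ h₁.eq
  have hsm := mul_bifLip_le hb₂
  rw [abs_of_pos hp₂] at hsm
  have heq : A₁ ^ 2 * bifCoeff s A₁ g₁ = A₂ ^ 2 * bifCoeff s A₂ g₂ := by
    rw [← h₁.bifurcation, ← h₂.bifurcation]
  have hA : A₁ = A₂ := by
    by_contra hne
    have hpos : 0 < |A₁ - A₂| := abs_pos.2 (sub_ne_zero.2 hne)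
    -- From `A₁² Γ₁ = A₂² Γ₂`. After division by `|A₁ - A₂|` the left side is at least `(A₁ + A₂)
    -- landau s / 2` and the right side at most `A₂ landau s / 4`, a contradiction.
    have e1 : |A₁ - A₂| * ((A₁ + A₂) * bifCoeff s A₁ g₁) =
        A₂ ^ 2 * |bifCoeff s A₁ g₁ - bifCoeff s A₂ g₂| := by
      have e2 : (A₁ - A₂) * ((A₁ + A₂) * bifCoeff s A₁ g₁) =
        -(A₂ ^ 2 * (bifCoeff s A₁ g₁ - bifCoeff s A₂ g₂)) := by linear_combination heq
      have e3 : 0 < (A₁ + A₂) * bifCoeff s A₁ g₁ := by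
        have : 0 < bifCoeff s A₁ g₁ := by linarith
        positivity
      rw [← abs_of_pos e3, ← abs_mul, e2, abs_neg, abs_mul, abs_of_nonneg (sq_nonneg A₂)]
    have e4 : |A₁ - A₂| * ((A₁ + A₂) * bifCoeff s A₁ g₁) ≤
        |A₁ - A₂| * (A₂ ^ 2 * bifLip s) := by
      rw [e1]
      have := mul_le_mul_of_nonneg_left hl (sq_nonneg A₂)
      linarith
    have e5 := le_of_mul_le_mul_left e4 hpos
    have e6 : (A₁ + A₂) * (landau s / 2) ≤ A₂ * (A₂ * bifLip s) := by
      have : (A₁ + A₂) * (landau s / 2) ≤ (A₁ + A₂) * bifCoeff s A₁ g₁ := by gcongr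
      linarith
    have e7 : A₂ * (A₂ * bifLip s) ≤ A₂ * (landau s / 4) := by gcongr
    nlinarith [mul_pos hp₁ hs, mul_pos hp₂ hs]
  refine ⟨hA, ?_⟩
  rw [hA, sub_self, abs_zero, mul_zero] at hd
  exact sub_eq_zero.1 (norm_le_zero_iff.1 hd)

/-- A bound for the profile that ensures the a priori estimates. -/
def smallProfile (s : ℝ) : ℝ := min (1 / (2 * corrBound s)) (smallAmp s / 2)

theorem smallProfile_pos {s : ℝ} (hs : 0 < landau s) : 0 < smallProfile s := by
  have := one_le_corrBound s
  exact lt_min (by positivity) (half_pos (smallAmp_pos hs))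

/-- Every small solution of the reduced profile equation has the scaled form. -/
theorem ReducedProfile.exists_scaled {s ε ω A : ℝ} {u : C(Circ, ℝ)}
    (h : ReducedProfile s ε ω A u) (hε : ε ∈ Set.Icc 0 (1 / 8 : ℝ))
    (hω : ω ∈ Set.Icc (-1 / 2 : ℝ) (1 / 2)) (hu : ‖u‖ ≤ smallProfile s) :
    |A| ≤ smallAmp s ∧ ((A = 0 ∧ u = 0) ∨
      (A ≠ 0 ∧ ∃ g, u = A • shape A g ∧ ‖g‖ ≤ corrBound s ∧ ScaledProfile s ε ω A g)) := by
  have hA : |A| ≤ 2 * ‖u‖ := by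
    rw [← h.cosCoeff_one hε hω]; exact abs_cosCoeff_le 1 u
  have hρ := one_le_corrBound s
  have h1 : ‖u‖ * corrBound s ≤ 1 / 2 := by
    have h2 := hu.trans (min_le_left _ _)
    rw [le_div_iff₀ (by positivity)] at h2
    linarith
  have hu1 : ‖u‖ ≤ 1 := by nlinarith [norm_nonneg u]
  set w := greenOp ε ω (nonlin s u) with hw
  have hus : u = A • cosC 1 - w := h.eq
  have hun := norm_nonneg u
  have h2 : ‖nonlin s u‖ ≤ (|s| + 1) * ‖u‖ ^ 2 := by
    rw [nonlin]
    calc _ ≤ |s| * ‖u‖ ^ 2 + ‖u‖ ^ 3 := by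
          refine (norm_add_le _ _).trans (add_le_add ?_ (norm_pow_le _ _))
          rw [norm_smul, Real.norm_eq_abs]
          exact mul_le_mul_of_nonneg_left (norm_pow_le _ _) (abs_nonneg _)
      _ ≤ _ := by nlinarith [sq_nonneg ‖u‖]
  have hG := greenBound_nonneg
  have h3 : ‖w‖ ≤ greenBound * ((|s| + 1) * ‖u‖ ^ 2) :=
    (norm_greenOp_le hε hω _).trans (mul_le_mul_of_nonneg_left h2 hG)
  have hGs : 4 * (greenBound * (|s| + 1)) ≤ corrBound s := by
    rw [corrBound]; nlinarith
  -- The nonlinearity is quadratic, so a small `u` is dominated by its first harmonic. Then `‖u‖ ≤ 2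
  -- |A|`, which improves the bound on `w` to `O(A²)`, with the constant built into `corrBound`.
  have h4 : ‖w‖ ≤ 1 / 2 * ‖u‖ := by
    have hx : greenBound * (|s| + 1) * ‖u‖ ≤ 1 / 2 := by nlinarith [abs_nonneg s]
    calc ‖w‖ ≤ (greenBound * (|s| + 1) * ‖u‖) * ‖u‖ := h3.trans (le_of_eq (by ring))
      _ ≤ _ := by gcongr
  have h5 : ‖u‖ ≤ |A| + ‖w‖ := by
    conv_lhs => rw [hus]
    refine (norm_sub_le _ _).trans (add_le_add ?_ le_rfl)
    rw [norm_smul, Real.norm_eq_abs]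
    exact mul_le_of_le_one_right (abs_nonneg _) (norm_cosC_le 1)
  have h6 : ‖u‖ ≤ 2 * |A| := by linarith
  refine ⟨hA.trans (by linarith [hu.trans (min_le_right _ _)]), ?_⟩
  by_cases hA0 : A = 0
  · left
    refine ⟨hA0, ?_⟩
    rw [hA0, abs_zero, mul_zero] at h6
    exact norm_le_zero_iff.1 h6
  · right
    refine ⟨hA0, -(A ^ 2)⁻¹ • w, ?_⟩
    have hform : u = A • shape A (-(A ^ 2)⁻¹ • w) := by
      rw [shape, smul_add, smul_smul, smul_smul, hus, sub_eq_add_neg, ← neg_one_smul ℝ w]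
      congr 2
      field_simp
    refine ⟨hform, ?_, ?_⟩
    · rw [norm_smul, norm_neg, norm_inv, norm_pow, Real.norm_eq_abs, inv_mul_le_iff₀ (by positivity)]
      have h7 : ‖u‖ ^ 2 ≤ (2 * |A|) ^ 2 := pow_le_pow_left₀ hun h6 2
      calc ‖w‖ ≤ greenBound * (|s| + 1) * (2 * |A|) ^ 2 := by
            refine h3.trans ?_
            rw [← mul_assoc]
            gcongr
        _ = |A| ^ 2 * (4 * (greenBound * (|s| + 1))) := by ring
        _ ≤ _ := by gcongr
    · rw [hform] at h
      exact h.scaledProfile hA0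

/-! ### Regularity and smallness of the profile -/

section RealWiener

variable {j : ℕ} {a b : ℝ} {f g : C(Circ, ℝ)}

theorem WienerBound.real_smul (c : ℝ) (h : WienerBound j a (toComplex f)) :
    WienerBound j (|c| * a) (toComplex (c • f)) := by
  rw [toComplex_smul]
  have := h.smul (c : ℂ)
  rwa [Complex.norm_real, Real.norm_eq_abs] at this

theorem WienerBound.real_add (hf : WienerBound j a (toComplex f))
    (hg : WienerBound j b (toComplex g)) : WienerBound j (a + b) (toComplex (f + g)) := by
  rw [toComplex_add]; exact hf.add hg

theorem WienerBound.real_neg (hf : WienerBound j a (toComplex f)) :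
    WienerBound j a (toComplex (-f)) := by
  have := hf.real_smul (-1)
  rwa [abs_neg, abs_one, one_mul, neg_one_smul] at this

theorem WienerBound.real_mul (hf : WienerBound j a (toComplex f))
    (hg : WienerBound j b (toComplex g)) : WienerBound j (2 ^ j * (a * b)) (toComplex (f * g)) := by
  rw [toComplex_mul]; exact hf.mul hg

theorem WienerBound.real_sq (hf : WienerBound j a (toComplex f)) :
    WienerBound j (2 ^ j * (a * a)) (toComplex (f ^ 2)) := by
  rw [sq]; exact hf.real_mul hf

theorem WienerBound.real_cube (hf : WienerBound j a (toComplex f)) :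
    WienerBound j (2 ^ j * (a * (2 ^ j * (a * a)))) (toComplex (f ^ 3)) := by
  rw [pow_succ']; exact hf.real_mul hf.real_sq

end RealWiener

/-- Elliptic bootstrap: the weighted spaces are algebras and the Green operator gains two weights,
so the weight climbs from `1` to `3` to `5`. Weight `3` would give `H⁶` only; the translation mode
`u'` lies in the domain once `u ∈ H⁷`. -/
theorem ReducedProfile.exists_wienerBound {s ε ω A : ℝ} {u : C(Circ, ℝ)}
    (h : ReducedProfile s ε ω A u) (hε : ε ∈ Set.Icc 0 (1 / 8 : ℝ))
    (hω : ω ∈ Set.Icc (-1 / 2 : ℝ) (1 / 2)) : ∃ a, WienerBound 5 a (toComplex u) := by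
  have hK := cosSymbol_invSymbol hε hω
  have step : ∀ j : ℕ, (∃ a, WienerBound j a (toComplex (greenOp ε ω (nonlin s u)))) →
      ∃ a, WienerBound j a (toComplex u) := by
    rintro j ⟨a, ha⟩
    rw [h.eq, sub_eq_add_neg]
    exact ⟨_, ((wienerBound_cosC j 1).real_smul A).real_add ha.real_neg⟩
  have step' : ∀ j : ℕ, (∃ a, WienerBound j a (toComplex u)) →
      ∃ a, WienerBound (j + 2) a (toComplex (greenOp ε ω (nonlin s u))) := by
    rintro j ⟨a, ha⟩
    exact ⟨_, hK.wienerBound_add_two ((ha.real_sq.real_smul s).real_add ha.real_cube)⟩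
  have h1 := step 1 ⟨_, hK.wienerBound_one _⟩
  exact step 5 (step' 3 (step 3 (step' 1 h1)))

/-- A bound for the weighted Fourier series of the profile divided by its amplitude. -/
def profBound (s : ℝ) : ℝ := 8 + 7 * (18 * |s| + 108)

theorem profBound_pos (s : ℝ) : 0 < profBound s := by
  rw [profBound]; positivity

section ScaledWiener

variable {s ε ω A : ℝ} {g : C(Circ, ℝ)}

theorem wienerBound_corr (hε : ε ∈ Set.Icc 0 (1 / 8 : ℝ)) (hω : ω ∈ Set.Icc (-1 / 2 : ℝ) (1 / 2))
    (hA : |A| ≤ ampBound s) (hg : ‖g‖ ≤ corrBound s)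
    (hfix : g = -greenOp ε ω (scaledNonlin s A g)) : WienerBound 1 (corrBound s) (toComplex g) := by
  rw [hfix]
  refine ((cosSymbol_invSymbol hε hω).wienerBound_one _).real_neg.mono ?_
  have := mul_le_mul_of_nonneg_left (norm_scaledNonlin_le hA hg) greenBound_nonneg
  rw [greenBound] at this
  rw [corrBound, greenBound]
  linarith

theorem wienerBound_shape (hε : ε ∈ Set.Icc 0 (1 / 8 : ℝ)) (hω : ω ∈ Set.Icc (-1 / 2 : ℝ) (1 / 2))
    (hA : |A| ≤ ampBound s) (hg : ‖g‖ ≤ corrBound s)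
    (hfix : g = -greenOp ε ω (scaledNonlin s A g)) : WienerBound 1 3 (toComplex (shape A g)) := by
  refine ((wienerBound_cosC 1 1).real_add
    ((wienerBound_corr hε hω hA hg hfix).real_smul A)).mono ?_
  have := abs_mul_corrBound_le hA
  norm_num
  linarith

/-- One bootstrap step with explicit constants. With bound `3` for the shape in weight `1`, the
square has bound `2 · 3² = 18` and the cube `2 · 3 · 18 = 108`. -/
theorem wienerBound_corr_three (hε : ε ∈ Set.Icc 0 (1 / 8 : ℝ))
    (hω : ω ∈ Set.Icc (-1 / 2 : ℝ) (1 / 2)) (hA : |A| ≤ ampBound s) (hg : ‖g‖ ≤ corrBound s)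
    (hfix : g = -greenOp ε ω (scaledNonlin s A g)) :
    WienerBound 3 (7 * (18 * |s| + 108)) (toComplex g) := by
  have hy := wienerBound_shape hε hω hA hg hfix
  rw [hfix]
  refine (((cosSymbol_invSymbol hε hω).wienerBound_add_two
    ((hy.real_sq.real_smul s).real_add (hy.real_cube.real_smul A)))).real_neg.mono ?_
  have := abs_le_one_of_le_ampBound hA
  norm_num
  linarith

theorem wienerBound_profile (hε : ε ∈ Set.Icc 0 (1 / 8 : ℝ))
    (hω : ω ∈ Set.Icc (-1 / 2 : ℝ) (1 / 2)) (hA : |A| ≤ ampBound s) (hg : ‖g‖ ≤ corrBound s)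
    (hfix : g = -greenOp ε ω (scaledNonlin s A g)) :
    WienerBound 3 (|A| * profBound s) (toComplex (A • shape A g)) := by
  refine (((wienerBound_cosC 3 1).real_add
    ((wienerBound_corr_three hε hω hA hg hfix).real_smul A)).real_smul A).mono ?_
  have h1 := abs_le_one_of_le_ampBound hA
  have h2 : |A| * (7 * (18 * |s| + 108)) ≤ 1 * (7 * (18 * |s| + 108)) := by gcongr
  rw [profBound]
  refine mul_le_mul_of_nonneg_left ?_ (abs_nonneg _)
  norm_num
  linarith

/-- Ties the sign of `u(0)` to that of `A`, so the positivity condition selects one of the two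
solutions `±A` related by a half-period shift. -/
theorem half_le_shape_zero (hA : |A| ≤ ampBound s) (hg : ‖g‖ ≤ corrBound s) :
    1 / 2 ≤ shape A g 0 := by
  have h1 := norm_smul_corr_le hA hg
  have h2 := ((A • g).norm_coe_le_norm 0).trans h1
  rw [Real.norm_eq_abs] at h2
  have h3 : shape A g 0 = 1 + (A • g) 0 := by
    rw [shape, ContinuousMap.add_apply, cosC_zero_right]
  rw [h3]
  linarith [(abs_le.1 h2).1]

end ScaledWiener

/-! ### Existence and uniqueness of the pattern in a small ball -/

/-- The radius of the ball in `H^6_per` in which the pattern is unique. -/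
def patternRadius (s : ℝ) : ℝ := smallProfile s / (invSqSum + 1)

theorem patternRadius_pos {s : ℝ} (hs : 0 < landau s) : 0 < patternRadius s :=
  div_pos (smallProfile_pos hs) (by linarith [invSqSum_nonneg])

theorem norm_le_smallProfile {s : ℝ} {u : RealH6}
    (hu : sobolevNorm 6 (toL2 u.1) < patternRadius s) : ‖u.1‖ ≤ smallProfile s := by
  refine (norm_le_norm_toComplex _).trans ((wienerBound_of_mem_sobolev u.2).norm_le.trans ?_)
  rw [patternRadius, lt_div_iff₀ (by linarith [invSqSum_nonneg])] at hu
  have h1 : 0 ≤ sobolevNorm 6 (toL2 u.1) := Real.sqrt_nonneg _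
  rw [← invSqSum]
  change sobolevNorm 6 (toL2 u.1) * _ ≤ _
  nlinarith

/-- The dichotomy between the trivial state and a nontrivial pattern. -/
theorem IsPattern.cases {s ε ω : ℝ} {u : RealH6} (h : IsPattern s ε ω u)
    (hε : ε ∈ Set.Icc 0 (1 / 8 : ℝ)) (hω : ω ∈ Set.Icc (-1 / 2 : ℝ) (1 / 2))
    (hu : sobolevNorm 6 (toL2 u.1) < patternRadius s) :
    ((ε = 0 ∨ |ω| = 1 / 2) ∧ u.1 = 0) ∨ (0 < ε ∧ |ω| < 1 / 2 ∧ ∃ A : ℝ, 0 < A ∧ A ≤ smallAmp s ∧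
      ∃ g, u.1 = A • shape A g ∧ ‖g‖ ≤ corrBound s ∧ ScaledProfile s ε ω A g) := by
  by_cases htr : ε = 0 ∨ |ω| = 1 / 2
  · exact Or.inl ⟨htr, h.trivial_state htr⟩
  right
  push Not at htr
  have hε0 : 0 < ε := lt_of_le_of_ne hε.1 (Ne.symm htr.1)
  have hω0 : |ω| < 1 / 2 :=
    lt_of_le_of_ne (abs_le.2 ⟨by linarith [hω.1], hω.2⟩) htr.2
  have hpos := h.pos hε0 hω0
  obtain ⟨hA, ⟨-, h0⟩ | ⟨hA0, g, hg1, hg2, hg3⟩⟩ :=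
    (h.reduced hε hω).exists_scaled hε hω (norm_le_smallProfile hu)
  · rw [h0] at hpos
    exact absurd hpos (lt_irrefl _)
  · have hsh := half_le_shape_zero (hA.trans (smallAmp_le_ampBound s)) hg2
    have hApos : 0 < cosCoeff 1 u.1 := by
      rw [hg1, ContinuousMap.smul_apply, smul_eq_mul] at hpos
      exact pos_of_mul_pos_left hpos (by linarith)
    exact ⟨hε0, hω0, _, hApos, (le_abs_self _).trans hA, g, hg1, hg2, hg3⟩

/-- The range of the bifurcation parameter. -/
def patternRange (s : ℝ) : ℝ :=
  min (min (1 / 8) (landau s / 12)) (min (smallAmp s) (patternRadius s / profBound s) * (landau s / 2))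

theorem landau_le (s : ℝ) : landau s / 2 ≤ 1 := by
  rw [landau]; nlinarith [sq_nonneg s]

theorem patternRange_pos {s : ℝ} (hs : 0 < landau s) : 0 < patternRange s := by
  have h1 := smallAmp_pos hs
  have h2 := div_pos (patternRadius_pos hs) (profBound_pos s)
  have h3 := lt_min h1 h2
  exact lt_min (lt_min (by norm_num) (by positivity)) (by positivity)

section Range

variable {s ε : ℝ}

theorem mem_Icc_of_lt_patternRange (h0 : 0 ≤ ε) (h : ε < patternRange s) :
    ε ∈ Set.Icc 0 (1 / 8 : ℝ) :=
  ⟨h0, (h.le.trans (min_le_left _ _)).trans (min_le_left _ _)⟩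

theorem le_landau_of_lt_patternRange (h : ε < patternRange s) : ε ≤ landau s / 12 :=
  (h.le.trans (min_le_left _ _)).trans (min_le_right _ _)

theorem sq_lt_of_lt_patternRange (hs : 0 < landau s) (h0 : 0 ≤ ε) (h : ε < patternRange s) :
    ε ^ 2 < min (smallAmp s) (patternRadius s / profBound s) ^ 2 * (landau s / 2) := by
  have h1 := smallAmp_pos hs
  have h2 := div_pos (patternRadius_pos hs) (profBound_pos s)
  have h3 := lt_min h1 h2
  set t := min (smallAmp s) (patternRadius s / profBound s)
  have h4 : ε < t * (landau s / 2) := h.trans_le (min_le_right _ _)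
  have h5 := landau_le s
  calc ε ^ 2 < (t * (landau s / 2)) ^ 2 := pow_lt_pow_left₀ h4 h0 two_ne_zero
    _ = t ^ 2 * ((landau s / 2) * (landau s / 2)) := by ring
    _ ≤ t ^ 2 * ((landau s / 2) * 1) := by gcongr
    _ = _ := by ring

end Range

theorem reducedProfile_zero (s ε ω : ℝ) : ReducedProfile s ε ω 0 0 where
  eq := by simp [nonlin]
  bifurcation := by simp [nonlin]

theorem toL2_zero : toL2 0 = 0 := by
  rw [toL2, toComplex_zero]; exact map_zero _

theorem sobolevNorm_zero (m : ℕ) : sobolevNorm m 0 = 0 := by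
  simp [sobolevNorm, coeff_zero]

/-- The lower bound on `Γ` in the amplitude equation forces `A = O(ε)`, uniformly in `ω`. -/
theorem sq_amp_mul_le {s ε ω A : ℝ} {g : C(Circ, ℝ)} (hs : 0 < landau s)
    (hε : ε ∈ Set.Icc 0 (1 / 8 : ℝ)) (hω : ω ∈ Set.Icc (-1 / 2 : ℝ) (1 / 2))
    (hε' : ε ≤ landau s / 12) (hA : |A| ≤ smallAmp s) (hg : ‖g‖ ≤ corrBound s)
    (h : ScaledProfile s ε ω A g) : A ^ 2 * (landau s / 2) ≤ ε ^ 2 := by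
  have h1 := bifCoeff_ge hs hε hω hε' hA hg h.eq
  have h2 := h.bifurcation
  have h3 := mul_le_mul_of_nonneg_left h1 (sq_nonneg A)
  nlinarith [mul_nonneg (sq_nonneg ε) (sq_nonneg ω)]

/-- Away from the boundary of the parameter range, the solution of the amplitude equation lies in
the Sobolev ball because its norm is `O(A)`. Any competitor in the ball has the scaled form with
positive amplitude and falls under `scaledProfile_unique`. -/
theorem existsUnique_pattern {s ε ω : ℝ} (hs : 0 < landau s) (h0 : 0 ≤ ε)
    (hε : ε < patternRange s) (hω : ω ∈ Set.Icc (-1 / 2 : ℝ) (1 / 2)) :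
    ∃! u : RealH6, IsPattern s ε ω u ∧ sobolevNorm 6 (toL2 u.1) < patternRadius s := by
  have hε8 := mem_Icc_of_lt_patternRange h0 hε
  have hεl := le_landau_of_lt_patternRange hε
  have hsq := sq_lt_of_lt_patternRange hs h0 hε
  by_cases htr : ε = 0 ∨ |ω| = 1 / 2
  · have hmem : toL2 0 ∈ sobolev 6 := by rw [toL2_zero]; exact zero_mem _
    refine ⟨⟨0, hmem⟩, ⟨?_, ?_⟩, ?_⟩
    · refine ReducedProfile.isPattern (A := 0) (reducedProfile_zero s ε ω) hε8 hω ?_ fun _ => rfl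
      intro h1 h2
      rcases htr with h | h
      · exact absurd h h1.ne'
      · exact absurd h h2.ne
    · change sobolevNorm 6 (toL2 0) < _
      rw [toL2_zero, sobolevNorm_zero]
      exact patternRadius_pos hs
    · rintro v ⟨hv, -⟩
      exact Subtype.ext (hv.trivial_state htr)
  · have htr' := htr
    push Not at htr
    have hε0 : 0 < ε := lt_of_le_of_ne h0 (Ne.symm htr.1)
    have hω0 : |ω| < 1 / 2 :=
      lt_of_le_of_ne (abs_le.2 ⟨by linarith [hω.1], hω.2⟩) htr.2
    have hamp := smallAmp_pos hs
    have ht := lt_min hamp (div_pos (patternRadius_pos hs) (profBound_pos s))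
    obtain ⟨A, hA, g, hg, hsc⟩ := exists_scaledProfile hs hε8 hω hεl (hsq.le.trans (by
      gcongr; exact min_le_left _ _))
    have hAa : |A| ≤ smallAmp s := by rw [abs_of_nonneg hA.1]; exact hA.2
    have hAb := hAa.trans (smallAmp_le_ampBound s)
    have hA0 : 0 < A := by
      refine lt_of_le_of_ne hA.1 ?_
      rintro rfl
      have h1 := hsc.bifurcation
      rw [zero_pow two_ne_zero, zero_mul] at h1
      have h2 : ω ^ 2 < (1 / 2) ^ 2 := by rw [← sq_abs]; gcongr
      have h3 : 0 < ε ^ 2 * (1 - 4 * ω ^ 2) := mul_pos (by positivity) (by linarith)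
      exact h3.ne' h1
    have hwb := wienerBound_profile hε8 hω hAb hg hsc.eq
    obtain ⟨hmem, hnorm⟩ := hwb.sobolev_bound
    let u : RealH6 := ⟨A • shape A g, hmem⟩
    have hsmall : sobolevNorm 6 (toL2 u.1) < patternRadius s := by
      refine hnorm.trans_lt ?_
      rw [abs_of_pos hA0, ← lt_div_iff₀ (profBound_pos s)]
      have h1 := (sq_amp_mul_le hs hε8 hω hεl hAa hg hsc).trans_lt hsq
      have h2 := lt_of_mul_lt_mul_right h1 (by positivity)
      -- `A² landau s / 2 ≤ ε²` and the definition of `patternRange` bound `A` by the minimum that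
      -- includes `patternRadius s / profBound s`.
      exact (lt_of_pow_lt_pow_left₀ 2 ht.le h2).trans_le (min_le_right _ _)
    refine ⟨u, ⟨hsc.reducedProfile.isPattern hε8 hω ?_ fun h => absurd h htr', hsmall⟩, ?_⟩
    · intro _ _
      have h1 := half_le_shape_zero hAb hg
      rw [ContinuousMap.smul_apply, smul_eq_mul]
      exact mul_pos hA0 (by linarith)
    · rintro v ⟨hv, hvn⟩
      obtain ⟨h1, -⟩ | ⟨-, -, A', hA', hA's, g', hvg, hg', hsc'⟩ := hv.cases hε8 hω hvn
      · exact absurd h1 htr'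
      · obtain ⟨rfl, rfl⟩ := scaledProfile_unique hs hε8 hω hεl hsc' hsc hA' hA0 hA's hA.2 hg' hg
        exact Subtype.ext hvg

/-! ### The linearised operator on functions of given parity -/

/-- The symbol `k² n² (ε² - (1 - k² n²)²)` of the linearisation at the trivial state. -/
def modeSymbol (ε ω : ℝ) (n : ℤ) : ℝ := waveNumber ε ω ^ 2 * n ^ 2 * linSymbol ε ω n

theorem modeSymbol_neg (ε ω : ℝ) (n : ℤ) : modeSymbol ε ω (-n) = modeSymbol ε ω n := by
  rw [modeSymbol, modeSymbol, linSymbol_neg]; push_cast; ring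

theorem modeSymbol_zero (ε ω : ℝ) : modeSymbol ε ω 0 = 0 := by simp [modeSymbol]

theorem norm_modeSymbol_mul_weight_le (ε ω : ℝ) (n : ℤ) :
    ‖((modeSymbol ε ω n * weight n : ℝ) : ℂ)‖ ≤
      waveNumber ε ω ^ 2 * (ε ^ 2 + (1 + waveNumber ε ω ^ 2) ^ 2) := by
  set k2 := waveNumber ε ω ^ 2 with hk2
  have hk : 0 ≤ k2 := sq_nonneg _
  rw [Complex.norm_real, Real.norm_eq_abs]
  rcases eq_or_ne n 0 with rfl | hn
  · rw [modeSymbol_zero, zero_mul, abs_zero]; positivity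
  · have h1 := one_le_intCast_sq hn
    set x := (n : ℝ) ^ 2 with hx
    have h2 : |linSymbol ε ω n| ≤ (ε ^ 2 + (1 + k2) ^ 2) * x ^ 2 := by
      rw [linSymbol, ← hk2, ← hx]
      refine (abs_sub _ _).trans ?_
      rw [abs_of_nonneg (sq_nonneg ε), abs_of_nonneg (sq_nonneg _)]
      have h3 : (1 - k2 * x) ^ 2 ≤ ((1 + k2) * x) ^ 2 := by
        apply sq_le_sq'
        · nlinarith [mul_nonneg hk (zero_le_one.trans h1)]
        · nlinarith [mul_nonneg hk (zero_le_one.trans h1)]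
      have h4 : ε ^ 2 * 1 ≤ ε ^ 2 * x ^ 2 := by gcongr; exact one_le_pow₀ h1
      nlinarith
    rw [modeSymbol, weight_of_ne hn, ← hk2, ← hx, abs_mul, abs_mul,
      abs_of_nonneg (by positivity : 0 ≤ k2 * x),
      abs_of_nonneg (by positivity : (0 : ℝ) ≤ 1 / (n : ℝ) ^ 6),
      show (n : ℝ) ^ 6 = x ^ 3 by rw [hx]; ring, mul_one_div, div_le_iff₀ (by positivity)]
    calc _ ≤ k2 * x * ((ε ^ 2 + (1 + k2) ^ 2) * x ^ 2) := by gcongr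
      _ = _ := by ring

/-- The linearised operator with potential `w` in the preconditioned variable. -/
def linOp (ε ω : ℝ) (w : C(Circ, ℝ)) : L2per →L[ℂ] L2per :=
  multOp (fun n => ((modeSymbol ε ω n * weight n : ℝ) : ℂ)) ⟨_, norm_modeSymbol_mul_weight_le ε ω⟩ +
    ((waveNumber ε ω ^ 2 : ℝ) : ℂ) • lapMulOp (toComplex w)

theorem coeff_linOp {ε ω : ℝ} {w : C(Circ, ℝ)} {a : ℝ} (hw : WienerBound 1 a (toComplex w))
    (v : L2per) (n : ℤ) : coeff (linOp ε ω w v) n = modeSymbol ε ω n * coeff (smooth v) n +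
      (waveNumber ε ω ^ 2 : ℝ) * ((n : ℂ) ^ 2 * coeff (mulC (toComplex w) (smooth v)) n) := by
  rw [linOp, add_apply, smul_apply, coeff_add, coeff_smul,
    coeff_multOp, coeff_lapMulOp hw, coeff_smooth]
  push_cast
  ring

/-- The symbol of the linearisation on the critical modes `n = ±1`. -/
def critSymbol (ε ω : ℝ) (n : ℤ) : ℝ := if |n| = 1 then modeSymbol ε ω 1 else 0

theorem norm_critSymbol_le (ε ω : ℝ) (n : ℤ) :
    ‖(critSymbol ε ω n : ℂ)‖ ≤ |modeSymbol ε ω 1| := by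
  rw [Complex.norm_real, Real.norm_eq_abs, critSymbol]
  split_ifs
  · exact le_rfl
  · rw [abs_zero]; exact abs_nonneg _

/-- The part of the linearised operator which is treated as a perturbation. -/
def pertOp (ε ω : ℝ) (w : C(Circ, ℝ)) : L2per →L[ℂ] L2per :=
  multOp (fun n => (critSymbol ε ω n : ℂ)) ⟨_, norm_critSymbol_le ε ω⟩ +
    ((waveNumber ε ω ^ 2 : ℝ) : ℂ) • lapMulOp (toComplex w)

theorem coeff_pertOp {ε ω : ℝ} {w : C(Circ, ℝ)} {a : ℝ} (hw : WienerBound 1 a (toComplex w))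
    (v : L2per) (n : ℤ) : coeff (pertOp ε ω w v) n = critSymbol ε ω n * coeff v n +
      (waveNumber ε ω ^ 2 : ℝ) * ((n : ℂ) ^ 2 * coeff (mulC (toComplex w) (smooth v)) n) := by
  rw [pertOp, add_apply, smul_apply, coeff_add, coeff_smul, coeff_multOp, coeff_lapMulOp hw]

/-- A bound for the norm of the perturbation. -/
def pertBound (ε ω a : ℝ) : ℝ := |modeSymbol ε ω 1| + 9 / 8 * (2 * ‖mulC‖ * a)

theorem norm_pertOp_le {ε ω : ℝ} (hε : ε ∈ Set.Icc 0 (1 / 8 : ℝ))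
    (hω : ω ∈ Set.Icc (-1 / 2 : ℝ) (1 / 2)) {w : C(Circ, ℝ)} {a : ℝ}
    (hw : WienerBound 1 a (toComplex w)) : ‖pertOp ε ω w‖ ≤ pertBound ε ω a := by
  rw [pertOp, pertBound]
  refine (norm_add_le _ _).trans (add_le_add (norm_multOp_le _ (norm_critSymbol_le ε ω)) ?_)
  have hk := waveNumber_sq_mem hε hω
  rw [norm_smul, Complex.norm_real, Real.norm_of_nonneg (sq_nonneg _)]
  exact mul_le_mul hk.2 (norm_lapMulOp_le hw) (norm_nonneg _) (by norm_num)

/-- The spectral gap: on `|n| ≥ 2` the symbol is at most `-7 n⁶ / 32`. Since `n⁶ ≥ 64`, moving `z`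
up to the line `Re z = -1` still leaves `n⁶ / 16`. -/
theorem norm_modeSymbol_sub_ge {ε ω : ℝ} (hε : ε ∈ Set.Icc 0 (1 / 8 : ℝ))
    (hω : ω ∈ Set.Icc (-1 / 2 : ℝ) (1 / 2)) {z : ℂ} (hz : -1 ≤ z.re) {n : ℤ} (hn : 2 ≤ |n|) :
    (n : ℝ) ^ 6 / 16 ≤ ‖(modeSymbol ε ω n : ℂ) - z‖ := by
  have h1 := four_le_sq hn
  have h2 := linSymbol_le hε hω hn
  have h3 := waveNumber_sq_mem hε hω
  have h4 := abs_re_le_norm ((modeSymbol ε ω n : ℂ) - z)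
  rw [sub_re, ofReal_re] at h4
  refine le_trans ?_ h4
  refine le_trans ?_ (neg_le_abs _)
  rw [modeSymbol, show (n : ℝ) ^ 6 = ((n : ℝ) ^ 2) ^ 3 by ring]
  set x := (n : ℝ) ^ 2
  have h5 : 7 / 8 * x * (x ^ 2 / 4) ≤ waveNumber ε ω ^ 2 * x * (-linSymbol ε ω n) := by
    have : x ^ 2 / 4 ≤ -linSymbol ε ω n := by linarith
    gcongr
    exact h3.1
  have h6 : 64 ≤ x ^ 3 := by
    calc (64 : ℝ) = 4 ^ 3 := by norm_num
      _ ≤ x ^ 3 := by gcongr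
  nlinarith

open Classical in
/-- The symbol of the inverse of `linOp - z • smooth` on the modes `|n| ≥ 2` for `w = 0`. -/
def resolventSymbol (ε ω : ℝ) (z : ℂ) (n : ℤ) : ℂ :=
  if ε ∈ Set.Icc 0 (1 / 8 : ℝ) ∧ ω ∈ Set.Icc (-1 / 2 : ℝ) (1 / 2) ∧ -1 ≤ z.re ∧ 2 ≤ |n| then
    (n : ℂ) ^ 6 / (modeSymbol ε ω n - z) else 0

theorem resolventSymbol_neg (ε ω : ℝ) (z : ℂ) (n : ℤ) :
    resolventSymbol ε ω z (-n) = resolventSymbol ε ω z n := by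
  rw [resolventSymbol, resolventSymbol, abs_neg, modeSymbol_neg]
  push_cast
  rw [Even.neg_pow (by decide)]

/-- The admissible range is part of the symbol, which vanishes outside it; hence the bound needs no
hypotheses and `resolventOp` is defined for all parameters. -/
theorem norm_resolventSymbol_le (ε ω : ℝ) (z : ℂ) (n : ℤ) : ‖resolventSymbol ε ω z n‖ ≤ 16 := by
  rw [resolventSymbol]
  split_ifs with h
  · obtain ⟨hε, hω, hz, hn⟩ := h
    have h1 := norm_modeSymbol_sub_ge hε hω hz hn
    have h2 := four_le_sq hn
    have h3 : (0 : ℝ) < (n : ℝ) ^ 6 := by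
      rw [show (n : ℝ) ^ 6 = ((n : ℝ) ^ 2) ^ 3 by ring]; positivity
    have h4 : ‖(n : ℂ) ^ 6‖ = (n : ℝ) ^ 6 := by
      rw [norm_pow, Complex.norm_intCast, Even.pow_abs (by decide)]
    rw [norm_div, h4, div_le_iff₀ (lt_of_lt_of_le (by positivity) h1)]
    linarith
  · rw [norm_zero]; norm_num

/-- The inverse of `linOp - z • smooth` on the modes `|n| ≥ 2` for `w = 0`. -/
def resolventOp (ε ω : ℝ) (z : ℂ) : L2per →L[ℂ] L2per :=
  multOp (resolventSymbol ε ω z) ⟨16, norm_resolventSymbol_le ε ω z⟩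

theorem coeff_resolventOp (ε ω : ℝ) (z : ℂ) (f : L2per) (n : ℤ) :
    coeff (resolventOp ε ω z f) n = resolventSymbol ε ω z n * coeff f n := coeff_multOp _ _ f n

theorem resolventSymbol_of_abs_lt {ε ω : ℝ} {z : ℂ} {n : ℤ} (hn : |n| < 2) :
    resolventSymbol ε ω z n = 0 := by
  rw [resolventSymbol, if_neg]
  rintro ⟨-, -, -, h⟩
  omega

theorem norm_resolventSymbol_sub_le {ε ω : ℝ} (hε : ε ∈ Set.Icc 0 (1 / 8 : ℝ))
    (hω : ω ∈ Set.Icc (-1 / 2 : ℝ) (1 / 2)) {z w : ℂ} (hz : -1 ≤ z.re) (hw : -1 ≤ w.re) (n : ℤ) :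
    ‖resolventSymbol ε ω z n - resolventSymbol ε ω w n‖ ≤ 16 * ‖z - w‖ := by
  by_cases hn : 2 ≤ |n|
  · rw [resolventSymbol, resolventSymbol, if_pos ⟨hε, hω, hz, hn⟩, if_pos ⟨hε, hω, hw, hn⟩]
    have h1 := norm_modeSymbol_sub_ge hε hω hz hn
    have h1' := norm_modeSymbol_sub_ge hε hω hw hn
    have h2 := four_le_sq hn
    have h3 : (64 : ℝ) ≤ (n : ℝ) ^ 6 := by
      rw [show (n : ℝ) ^ 6 = ((n : ℝ) ^ 2) ^ 3 by ring]
      calc (64 : ℝ) = 4 ^ 3 := by norm_num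
        _ ≤ ((n : ℝ) ^ 2) ^ 3 := by gcongr
    have h4 : ‖(n : ℂ) ^ 6‖ = (n : ℝ) ^ 6 := by
      rw [norm_pow, Complex.norm_intCast, Even.pow_abs (by decide)]
    have hp : 0 < ‖(modeSymbol ε ω n : ℂ) - z‖ := lt_of_lt_of_le (by positivity) h1
    have hp' : 0 < ‖(modeSymbol ε ω n : ℂ) - w‖ := lt_of_lt_of_le (by positivity) h1'
    have h5 : (n : ℂ) ^ 6 / (modeSymbol ε ω n - z) - (n : ℂ) ^ 6 / (modeSymbol ε ω n - w) =
        (n : ℂ) ^ 6 * (z - w) / ((modeSymbol ε ω n - z) * (modeSymbol ε ω n - w)) := by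
      have e1 := norm_pos_iff.1 hp
      have e2 := norm_pos_iff.1 hp'
      field_simp
      ring
    rw [h5, norm_div, norm_mul, norm_mul, h4, div_le_iff₀ (by positivity)]
    have h6 := mul_le_mul h1 h1' (by positivity) (norm_nonneg _)
    have h7 : (n : ℝ) ^ 6 ≤ 16 * (‖(modeSymbol ε ω n : ℂ) - z‖ * ‖(modeSymbol ε ω n : ℂ) - w‖) := by
      nlinarith
    calc _ ≤ 16 * (‖(modeSymbol ε ω n : ℂ) - z‖ * ‖(modeSymbol ε ω n : ℂ) - w‖) * ‖z - w‖ := by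
          gcongr
      _ = _ := by ring
  · rw [resolventSymbol_of_abs_lt (not_le.1 hn), resolventSymbol_of_abs_lt (not_le.1 hn), sub_zero,
      norm_zero]
    positivity

/-! ### Parity sectors and their Schur pencils -/

/-- Mean zero functions of parity `τ = ±1`. -/
def parity (τ : ℂ) : Submodule ℂ L2per where
  carrier := {f | coeff f 0 = 0 ∧ ∀ n, coeff f (-n) = τ * coeff f n}
  zero_mem' := ⟨coeff_zero 0, fun n => by rw [coeff_zero, coeff_zero, mul_zero]⟩
  add_mem' := by
    rintro f g ⟨hf0, hf⟩ ⟨hg0, hg⟩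
    exact ⟨by rw [coeff_add, hf0, hg0, add_zero], fun n => by
      rw [coeff_add, coeff_add, hf, hg, mul_add]⟩
  smul_mem' := by
    rintro c f ⟨hf0, hf⟩
    exact ⟨by rw [coeff_smul, hf0, mul_zero], fun n => by
      rw [coeff_smul, coeff_smul, hf]; ring⟩

theorem mem_parity {τ : ℂ} {f : L2per} :
    f ∈ parity τ ↔ coeff f 0 = 0 ∧ ∀ n, coeff f (-n) = τ * coeff f n := Iff.rfl

instance completeSpace_parity (τ : ℂ) : CompleteSpace (parity τ) := by
  have h : IsClosed (parity τ : Set L2per) := by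
    have h1 : (parity τ : Set L2per) = {f | coeffL 0 f = 0} ∩
        ⋂ n : ℤ, {f | coeffL (-n) f = τ * coeffL n f} := by
      ext f
      simp only [SetLike.mem_coe, mem_parity, Set.mem_inter_iff, Set.mem_iInter, Set.mem_ofPred_eq,
        coeffL_apply]
    rw [h1]
    refine (isClosed_eq (coeffL 0).continuous continuous_const).inter (isClosed_iInter fun n => ?_)
    exact isClosed_eq (coeffL (-n)).continuous (continuous_const.mul (coeffL n).continuous)
  exact h.completeSpace_coe

theorem multOp_mem_parity {τ : ℂ} {a : ℤ → ℂ} (ha : ∃ C, ∀ n, ‖a n‖ ≤ C)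
    (heven : ∀ n, a (-n) = a n) (f : L2per) (hf : f ∈ parity τ) : multOp a ha f ∈ parity τ :=
  ⟨by rw [coeff_multOp, hf.1, mul_zero], fun n => by
    rw [coeff_multOp, coeff_multOp, heven, hf.2]; ring⟩

theorem coeff_mulC_neg {τ : ℂ} {w : C(Circ, ℝ)} {a : ℝ} (hw : WienerBound 1 a (toComplex w))
    (heven : ∀ x, w (-x) = w x) {f : L2per} (hf : f ∈ parity τ) (n : ℤ) :
    coeff (mulC (toComplex w) f) (-n) = τ * coeff (mulC (toComplex w) f) n := by
  have h1 := (hasSum_coeff_mulC hw.summable_coeff f n).mul_left τ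
  have h2 := hasSum_coeff_mulC hw.summable_coeff f (-n)
  rw [← (Equiv.neg ℤ).hasSum_iff] at h2
  refine h2.unique (h1.congr_fun fun m => ?_)
  simp only [Function.comp_apply, Equiv.neg_apply]
  rw [show -n - -m = -(n - m) by ring, hf.2, ← realFourier_apply, ← realFourier_apply,
    realFourier_even heven]
  ring

theorem smooth_mem_parity {τ : ℂ} (f : L2per) (hf : f ∈ parity τ) : smooth f ∈ parity τ :=
  multOp_mem_parity _ (fun n => by rw [weight_neg]) f hf

theorem lapMulOp_mem_parity {τ : ℂ} {w : C(Circ, ℝ)} {a : ℝ} (hw : WienerBound 1 a (toComplex w))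
    (heven : ∀ x, w (-x) = w x) (f : L2per) (hf : f ∈ parity τ) :
    lapMulOp (toComplex w) f ∈ parity τ := by
  refine ⟨?_, fun n => ?_⟩
  · rw [coeff_lapMulOp hw]; simp
  · rw [coeff_lapMulOp hw, coeff_lapMulOp hw, coeff_mulC_neg hw heven (smooth_mem_parity f hf)]
    push_cast
    ring

theorem linOp_mem_parity {τ : ℂ} {ε ω : ℝ} {w : C(Circ, ℝ)} {a : ℝ}
    (hw : WienerBound 1 a (toComplex w)) (heven : ∀ x, w (-x) = w x) (f : L2per)
    (hf : f ∈ parity τ) : linOp ε ω w f ∈ parity τ :=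
  add_mem (multOp_mem_parity _ (fun n => by rw [modeSymbol_neg, weight_neg]) f hf)
    (Submodule.smul_mem _ _ (lapMulOp_mem_parity hw heven f hf))

theorem pertOp_mem_parity {τ : ℂ} {ε ω : ℝ} {w : C(Circ, ℝ)} {a : ℝ}
    (hw : WienerBound 1 a (toComplex w)) (heven : ∀ x, w (-x) = w x) (f : L2per)
    (hf : f ∈ parity τ) : pertOp ε ω w f ∈ parity τ :=
  add_mem (multOp_mem_parity _ (fun n => by rw [critSymbol, critSymbol, abs_neg]) f hf)
    (Submodule.smul_mem _ _ (lapMulOp_mem_parity hw heven f hf))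

theorem resolventOp_mem_parity {τ : ℂ} (ε ω : ℝ) (z : ℂ) (f : L2per) (hf : f ∈ parity τ) :
    resolventOp ε ω z f ∈ parity τ :=
  multOp_mem_parity _ (resolventSymbol_neg ε ω z) f hf

/-- The critical mode of parity `τ`. -/
def critVec (τ : ℂ) : L2per := contToL2 (fourier 1 + τ • fourier (-1))

theorem coeff_critVec (τ : ℂ) (n : ℤ) :
    coeff (critVec τ) n = (if n = 1 then 1 else 0) + τ * (if n = -1 then 1 else 0) := by
  rw [critVec, coeff_contToL2, ← fourierCoeffL_apply, map_add, map_smul, fourierCoeffL_apply,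
    fourierCoeffL_apply, fourierCoeff_fourier, fourierCoeff_fourier, Pi.single_apply,
    Pi.single_apply, smul_eq_mul]

theorem critVec_mem {τ : ℂ} (hτ : τ * τ = 1) : critVec τ ∈ parity τ := by
  refine ⟨by rw [coeff_critVec]; norm_num, fun n => ?_⟩
  rw [coeff_critVec, coeff_critVec]
  have e1 : (-n = 1) ↔ (n = -1) := by constructor <;> intro h <;> omega
  have e2 : (-n = -1) ↔ (n = 1) := by constructor <;> intro h <;> omega
  simp only [e1, e2]
  rw [mul_add, ← mul_assoc, hτ]
  ring

theorem norm_critVec_le {τ : ℂ} (hτ : τ * τ = 1) : ‖critVec τ‖ ≤ 2 := by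
  have hn : ‖τ‖ = 1 := by
    have h1 : ‖τ‖ * ‖τ‖ = 1 := by rw [← norm_mul, hτ, norm_one]
    nlinarith [norm_nonneg τ]
  have h := (WienerBound.of_fourier (j := 0) 1).add ((WienerBound.of_fourier (j := 0) (-1)).smul τ)
  refine h.norm_contToL2_le.trans ?_
  rw [hn]; norm_num

theorem norm_restrict_le {τ : ℂ} {A : L2per →L[ℂ] L2per} (h : ∀ f ∈ parity τ, A f ∈ parity τ)
    {C : ℝ} (hC : ‖A‖ ≤ C) : ‖A.restrict h‖ ≤ C := by
  refine ContinuousLinearMap.opNorm_le_bound _ ((norm_nonneg _).trans hC) fun f => ?_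
  exact A.le_of_opNorm_le hC f

section Pencil

variable {ε ω a : ℝ} {w : C(Circ, ℝ)} {τ : ℂ}

/-- The linearised operator on functions of parity `τ`. -/
def linOpP (τ : ℂ) (ε ω : ℝ) (hw : WienerBound 1 a (toComplex w)) (heven : ∀ x, w (-x) = w x) :
    parity τ →L[ℂ] parity τ := (linOp ε ω w).restrict (linOp_mem_parity hw heven)

/-- The smoothing operator on functions of parity `τ`. -/
def smoothP (τ : ℂ) : parity τ →L[ℂ] parity τ := smooth.restrict smooth_mem_parity

/-- The perturbation on functions of parity `τ`. -/
def pertOpP (τ : ℂ) (ε ω : ℝ) (hw : WienerBound 1 a (toComplex w)) (heven : ∀ x, w (-x) = w x) :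
    parity τ →L[ℂ] parity τ := (pertOp ε ω w).restrict (pertOp_mem_parity hw heven)

/-- The approximate resolvent on functions of parity `τ`. -/
def resolventOpP (τ : ℂ) (ε ω : ℝ) (z : ℂ) : parity τ →L[ℂ] parity τ :=
  (resolventOp ε ω z).restrict (resolventOp_mem_parity ε ω z)

/-- The critical Fourier coefficient on functions of parity `τ`. -/
def critCoeff (τ : ℂ) : parity τ →L[ℂ] ℂ := (coeffL 1).comp (parity τ).subtypeL

theorem critCoeff_apply (f : parity τ) : critCoeff τ f = coeff (f : L2per) 1 :=
  coeffL_apply 1 (f : L2per)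

theorem int_cases (n : ℤ) : n = 0 ∨ n = 1 ∨ n = -1 ∨ 2 ≤ |n| := by
  by_cases h : 2 ≤ |n|
  · exact Or.inr (Or.inr (Or.inr h))
  · have := abs_lt.1 (not_le.1 h)
    omega

theorem coeff_linOp_sub (hw : WienerBound 1 a (toComplex w)) (v : L2per) (z : ℂ) (n : ℤ) :
    coeff (linOp ε ω w v - z • smooth v) n =
      ((modeSymbol ε ω n - z) * weight n - critSymbol ε ω n) * coeff v n +
        coeff (pertOp ε ω w v) n := by
  rw [coeff_sub, coeff_smul, coeff_linOp hw, coeff_pertOp hw, coeff_smooth]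
  ring

/-- The restrictions of the operators to the functions of parity `τ` form a Schur pencil. -/
theorem schurPencil (hτ : τ * τ = 1) (hε : ε ∈ Set.Icc 0 (1 / 8 : ℝ))
    (hω : ω ∈ Set.Icc (-1 / 2 : ℝ) (1 / 2)) (hw : WienerBound 1 a (toComplex w))
    (heven : ∀ x, w (-x) = w x) (hsmall : 256 * pertBound ε ω a ≤ 1) :
    SchurPencil (linOpP τ ε ω hw heven) (smoothP τ) (pertOpP τ ε ω hw heven) (critCoeff τ)
      ⟨critVec τ, critVec_mem hτ⟩ (resolventOpP τ ε ω) 16 where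
  eq_iff z hz v f := by
    obtain ⟨v, hv⟩ := v
    obtain ⟨f, hf⟩ := f
    have hp := pertOp_mem_parity (ε := ε) (ω := ω) hw heven v hv
    have hl : linOp ε ω w v - z • smooth v ∈ parity τ :=
      sub_mem (linOp_mem_parity hw heven v hv) (Submodule.smul_mem _ _ (smooth_mem_parity v hv))
    -- The pencil is diagonal up to `P`. With the critical symbol moved into `P`, the diagonal
    -- factor at `n = 1` is exactly `-z`; for `|n| ≥ 2` it is `(modeSymbol - z) / n⁶`, which
    -- `resolventSymbol` inverts.
    have hcoef := fun n => coeff_linOp_sub (ε := ε) (ω := ω) hw v z n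
    have hw1 : weight 1 = 1 := by rw [weight_of_ne one_ne_zero]; norm_num
    have hc1 : critSymbol ε ω 1 = modeSymbol ε ω 1 := by simp [critSymbol]
    have hcn : ∀ n : ℤ, 2 ≤ |n| → critSymbol ε ω n = 0 := fun n hn => by
      rw [critSymbol, if_neg (by omega)]
    have hne : ∀ n : ℤ, 2 ≤ |n| → (modeSymbol ε ω n : ℂ) - z ≠ 0 ∧ (n : ℂ) ≠ 0 := by
      intro n hn
      have h2 := four_le_sq hn
      have h3 : (0 : ℝ) < (n : ℝ) ^ 6 := by
        rw [show (n : ℝ) ^ 6 = ((n : ℝ) ^ 2) ^ 3 by ring]; positivity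
      refine ⟨norm_pos_iff.1 (lt_of_lt_of_le (by positivity)
        (norm_modeSymbol_sub_ge hε hω hz hn)), ?_⟩
      rintro h
      have : n = 0 := by exact_mod_cast h
      rw [this] at hn
      norm_num at hn
    have hwn : ∀ n : ℤ, 2 ≤ |n| → (weight n : ℂ) = 1 / (n : ℂ) ^ 6 := by
      intro n hn
      rw [weight_of_ne (by rintro rfl; norm_num at hn)]
      push_cast
      ring
    have hrn : ∀ n : ℤ, 2 ≤ |n| → resolventSymbol ε ω z n = (n : ℂ) ^ 6 / (modeSymbol ε ω n - z) :=
      fun n hn => by rw [resolventSymbol, if_pos ⟨hε, hω, hz, hn⟩]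
    have e1 : linOpP τ ε ω hw heven ⟨v, hv⟩ - z • smoothP τ ⟨v, hv⟩ = ⟨f, hf⟩ ↔
        linOp ε ω w v - z • smooth v = f := Subtype.ext_iff
    have e2 : (⟨v, hv⟩ : parity τ) = critCoeff τ ⟨v, hv⟩ • ⟨critVec τ, critVec_mem hτ⟩ +
        resolventOpP τ ε ω z (⟨f, hf⟩ - pertOpP τ ε ω hw heven ⟨v, hv⟩) ↔
        v = coeff v 1 • critVec τ + resolventOp ε ω z (f - pertOp ε ω w v) := by
      rw [critCoeff_apply]; exact Subtype.ext_iff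
    have hcoef2 : ∀ n, coeff (coeff v 1 • critVec τ + resolventOp ε ω z (f - pertOp ε ω w v)) n =
        coeff v 1 * coeff (critVec τ) n +
          resolventSymbol ε ω z n * (coeff f n - coeff (pertOp ε ω w v) n) := by
      intro n
      rw [coeff_add, coeff_smul, coeff_resolventOp, coeff_sub]
    rw [e1, e2, critCoeff_apply, critCoeff_apply, critCoeff_apply]
    change _ ↔ -z * coeff v 1 + coeff (pertOp ε ω w v) 1 = coeff f 1 ∧ _
    constructor
    · intro h
      have hn : ∀ n, ((modeSymbol ε ω n - z) * weight n - critSymbol ε ω n) * coeff v n +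
          coeff (pertOp ε ω w v) n = coeff f n := fun n => by rw [← hcoef, h]
      refine ⟨?_, coeff_ext fun n => ?_⟩
      · have := hn 1
        rw [hw1, hc1] at this
        rw [← this]; push_cast; ring
      · rw [hcoef2]
        rcases int_cases n with rfl | rfl | rfl | h2
        · rw [hv.1, resolventSymbol_of_abs_lt (by norm_num), coeff_critVec]; norm_num
        · rw [resolventSymbol_of_abs_lt (by norm_num), coeff_critVec]; norm_num
        · rw [resolventSymbol_of_abs_lt (by norm_num), coeff_critVec, hv.2 1]
          norm_num
          ring
        · have h3 := hn n
          rw [hwn n h2, hcn n h2] at h3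
          obtain ⟨h4, h5⟩ := hne n h2
          rw [hrn n h2, ← h3, coeff_critVec, if_neg (by rintro rfl; norm_num at h2),
            if_neg (by rintro rfl; norm_num at h2)]
          push_cast
          field_simp
          ring
    · rintro ⟨h1, h⟩
      have hone : coeff (linOp ε ω w v - z • smooth v) 1 = coeff f 1 := by
        rw [hcoef, hw1, hc1, ← h1]; push_cast; ring
      refine coeff_ext fun n => ?_
      rcases int_cases n with rfl | rfl | rfl | h2
      · rw [hl.1, hf.1]
      · exact hone
      -- Mode `-1` is determined by mode `1` through parity, so one scalar equation controls both
      -- critical modes.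
      · rw [hl.2 1, hf.2 1, hone]
      · have h3 := (congrArg (fun g => coeff g n) h).trans (hcoef2 n)
        obtain ⟨h4, h5⟩ := hne n h2
        rw [coeff_critVec, if_neg (by rintro rfl; norm_num at h2),
            if_neg (by rintro rfl; norm_num at h2), hrn n h2] at h3
        rw [hcoef, hwn n h2, hcn n h2, h3]
        push_cast
        field_simp
        ring
  norm_inv_le z _ := norm_restrict_le _ (norm_multOp_le _ (norm_resolventSymbol_le ε ω z))
  norm_inv_sub_le z x hz hx := by
    refine ContinuousLinearMap.opNorm_le_bound _ (by positivity) fun f => ?_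
    refine norm_le_of_coeff_le (by positivity) fun n => ?_
    change ‖coeff (resolventOp ε ω z f - resolventOp ε ω x f) n‖ ≤
      16 * ‖z - x‖ * ‖coeff (f : L2per) n‖
    rw [coeff_sub, coeff_resolventOp, coeff_resolventOp, ← sub_mul, norm_mul]
    exact mul_le_mul_of_nonneg_right (norm_resolventSymbol_sub_le hε hω hz hx n) (norm_nonneg _)
  apply_inv z f := by
    rw [critCoeff_apply]
    change coeff (resolventOp ε ω z f) 1 = 0
    rw [coeff_resolventOp, resolventSymbol_of_abs_lt (by norm_num), zero_mul]
  inv_apply z := by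
    apply Subtype.ext
    refine coeff_ext fun n => ?_
    change coeff (resolventOp ε ω z (critVec τ)) n = coeff 0 n
    rw [coeff_resolventOp, coeff_zero, coeff_critVec]
    rcases int_cases n with rfl | rfl | rfl | h2
    · rw [resolventSymbol_of_abs_lt (by norm_num), zero_mul]
    · rw [resolventSymbol_of_abs_lt (by norm_num), zero_mul]
    · rw [resolventSymbol_of_abs_lt (by norm_num), zero_mul]
    · rw [if_neg (by rintro rfl; norm_num at h2), if_neg (by rintro rfl; norm_num at h2)]
      ring
  apply_vec := by
    rw [critCoeff_apply, coeff_critVec]; norm_num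
  norm_functional_le := by
    refine ContinuousLinearMap.opNorm_le_bound _ zero_le_one fun f => ?_
    rw [critCoeff_apply, one_mul]
    exact norm_coeff_le _ 1
  norm_weight_le := norm_restrict_le _ (norm_multOp_le _ norm_weight_le)
  apply_weight v := by
    rw [critCoeff_apply, critCoeff_apply]
    change coeff (smooth v) 1 = _
    rw [coeff_smooth, weight_of_ne one_ne_zero]
    norm_num
  norm_vec_le := norm_critVec_le hτ
  one_le := by norm_num
  small := by
    have h1 : ‖pertOpP τ ε ω hw heven‖ ≤ pertBound ε ω a :=
      norm_restrict_le _ (norm_pertOp_le hε hω hw)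
    linarith

end Pencil

/-! ### The spectrum from the even and odd sectors -/

/-- The reflection `f ↦ f(-·)`. -/
def reflectL2 (f : L2per) : L2per :=
  ofCoeff (fun n => coeff f (-n)) ((Equiv.neg ℤ).summable_iff.2 (summable_coeff_sq f))

theorem coeff_reflectL2 (f : L2per) (n : ℤ) : coeff (reflectL2 f) n = coeff f (-n) :=
  coeff_ofCoeff _ ((Equiv.neg ℤ).summable_iff.2 (summable_coeff_sq f)) n

theorem exists_parity_decomp {f : L2per} (h0 : coeff f 0 = 0) :
    ∃ f₁ ∈ parity 1, ∃ f₂ ∈ parity (-1), f = f₁ + f₂ := by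
  refine ⟨(1 / 2 : ℂ) • (f + reflectL2 f), ⟨?_, fun n => ?_⟩,
    (1 / 2 : ℂ) • (f - reflectL2 f), ⟨?_, fun n => ?_⟩, coeff_ext fun n => ?_⟩
  all_goals simp only [coeff_add, coeff_sub, coeff_smul, coeff_reflectL2, neg_zero, neg_neg, h0]
  all_goals ring

theorem eq_zero_of_mem_parity {f : L2per} (h₁ : f ∈ parity 1) (h₂ : f ∈ parity (-1)) : f = 0 := by
  refine coeff_ext fun n => ?_
  have e1 := h₁.2 n
  have e2 := h₂.2 n
  rw [coeff_zero]
  linear_combination (e2 - e1) / 2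

/-- The spectral properties, in `Re z ≥ -1`, of the pencil `L - z R` on functions of parity `τ`:
there is precisely one eigenvalue `μ` and it is simple, with eigenvector `x`. -/
structure Sector (L : L2per →L[ℂ] L2per) (τ μ : ℂ) (x : L2per) : Prop where
  mem : x ∈ parity τ
  coeff_one : coeff x 1 = 1
  eigen : L x = μ • smooth x
  simple : ∀ v ∈ parity τ, ∀ c : ℂ, L v - μ • smooth v = c • smooth x → c = 0 ∧ v = coeff v 1 • x
  inj : ∀ z : ℂ, -1 ≤ z.re → z ≠ μ → ∀ v ∈ parity τ, L v - z • smooth v = 0 → v = 0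
  surj : ∀ z : ℂ, -1 ≤ z.re → z ≠ μ → ∀ f ∈ parity τ, ∃ v ∈ parity τ, L v - z • smooth v = f

/-- `T` becomes the bounded operator `L` in the preconditioned variable, and `L` maps to mean zero
functions and preserves parity. -/
structure Precond (T : L2per →ₗ.[ℂ] L2per) (L : L2per →L[ℂ] L2per) : Prop where
  apply : ∀ v, ∃ h : smooth v ∈ T.domain, T ⟨smooth v, h⟩ = L v
  exists_eq : ∀ V : T.domain, ∃ v, smooth v = V
  mean : ∀ v, coeff (L v) 0 = 0
  parity : ∀ τ : ℂ, ∀ v ∈ parity τ, L v ∈ MatthewsCox.parity τ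

section Spectral

variable {T : L2per →ₗ.[ℂ] L2per} {L : L2per →L[ℂ] L2per}

namespace Precond

theorem apply_eq (hP : Precond T L) {V : T.domain} {v : L2per} (h : smooth v = V) : T V = L v := by
  obtain ⟨h1, h2⟩ := hP.apply v
  rw [← h2]
  congr 1
  exact Subtype.ext h.symm

/-- The open mapping theorem makes the bijective pencil boundedly invertible; the resolvent is that
inverse followed by `smooth`. -/
theorem mem_resolventSet (hP : Precond T L) {z : ℂ}
    (hbij : Function.Bijective fun v => L v - z • smooth v) : z ∈ resolventSetOf T := by
  let A : L2per →L[ℂ] L2per := L - z • smooth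
  have hA : ∀ v, A v = L v - z • smooth v := fun v => rfl
  have hinj : LinearMap.ker (A : L2per →ₗ[ℂ] L2per) = ⊥ := LinearMap.ker_eq_bot.2 hbij.1
  have hsurj : LinearMap.range (A : L2per →ₗ[ℂ] L2per) = ⊤ := LinearMap.range_eq_top.2 hbij.2
  let Φ := ContinuousLinearEquiv.ofBijective A hinj hsurj
  have hΦ : ∀ v, Φ v = L v - z • smooth v := fun v => rfl
  refine ⟨smooth.comp (Φ.symm : L2per →L[ℂ] L2per), fun f => ?_, fun V => ?_⟩
  · obtain ⟨h1, h2⟩ := hP.apply (Φ.symm f)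
    refine ⟨h1, ?_⟩
    change T ⟨smooth (Φ.symm f), h1⟩ - z • smooth (Φ.symm f) = f
    rw [h2, ← hΦ, Φ.apply_symm_apply]
  · obtain ⟨v, hv⟩ := hP.exists_eq V
    rw [hP.apply_eq hv, ← hv, ← hΦ]
    change smooth (Φ.symm (Φ v)) = smooth v
    rw [Φ.symm_apply_apply]

theorem mem_spectrum (hP : Precond T L) {z : ℂ} {v : L2per} (hv : L v = z • smooth v)
    (hv0 : v ≠ 0) : z ∈ spectrumOf T := by
  rintro ⟨R, -, hR⟩
  obtain ⟨h1, h2⟩ := hP.apply v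
  have h3 := hR ⟨smooth v, h1⟩
  rw [h2, hv, sub_self, map_zero] at h3
  exact hv0 (smooth_injective (by rw [map_zero]; exact h3.symm))

/-- Both operators preserve parity, and a function that is both even and odd vanishes, so the
equation decouples. -/
theorem split (hP : Precond T L) {z : ℂ} {v₁ v₂ f₁ f₂ : L2per} (hv₁ : v₁ ∈ MatthewsCox.parity 1)
    (hv₂ : v₂ ∈ MatthewsCox.parity (-1)) (hf₁ : f₁ ∈ MatthewsCox.parity 1)
    (hf₂ : f₂ ∈ MatthewsCox.parity (-1))
    (h : L (v₁ + v₂) - z • smooth (v₁ + v₂) = f₁ + f₂) :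
    L v₁ - z • smooth v₁ = f₁ ∧ L v₂ - z • smooth v₂ = f₂ := by
  have e1 : L v₁ - z • smooth v₁ - f₁ ∈ MatthewsCox.parity 1 :=
    sub_mem (sub_mem (hP.parity 1 _ hv₁) (Submodule.smul_mem _ _ (smooth_mem_parity _ hv₁))) hf₁
  have e2 : L v₂ - z • smooth v₂ - f₂ ∈ MatthewsCox.parity (-1) :=
    sub_mem (sub_mem (hP.parity _ _ hv₂) (Submodule.smul_mem _ _ (smooth_mem_parity _ hv₂))) hf₂
  have e3 : L v₁ - z • smooth v₁ - f₁ = -(L v₂ - z • smooth v₂ - f₂) := by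
    rw [map_add, map_add, smul_add] at h
    rw [← sub_eq_zero] at h ⊢
    rw [← h]; abel
  have e4 : L v₁ - z • smooth v₁ - f₁ = 0 :=
    eq_zero_of_mem_parity e1 (by rw [e3]; exact neg_mem e2)
  refine ⟨sub_eq_zero.1 e4, sub_eq_zero.1 ?_⟩
  rw [e4] at e3
  exact neg_eq_zero.1 e3.symm

end Precond

/-- The constant function one. -/
def oneL2 : L2per := contToL2 (fourier 0)

theorem coeff_oneL2 (n : ℤ) : coeff oneL2 n = if n = 0 then 1 else 0 := by
  rw [oneL2, coeff_contToL2, fourierCoeff_fourier, Pi.single_apply]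

theorem coeff_smooth_zero (v : L2per) : coeff (smooth v) 0 = coeff v 0 := by
  rw [coeff_smooth, weight_zero, ofReal_one, one_mul]

variable {μ : ℂ} {xe xo : L2per}

/-- For `z ≠ 0` the mean is fixed by `-z v̂(0) = f̂(0)`, since `L` has mean zero range. After
removal of a constant the problem splits into the two sectors. -/
theorem Precond.bijective (hP : Precond T L) (he : Sector L 1 μ xe) (ho : Sector L (-1) 0 xo)
    {z : ℂ} (hz : -1 ≤ z.re) (hz0 : z ≠ 0) (hzμ : z ≠ μ) :
    Function.Bijective fun v => L v - z • smooth v := by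
  constructor
  · suffices h : ∀ v, L v - z • smooth v = 0 → v = 0 by
      intro v w hvw
      have h1 : L (v - w) - z • smooth (v - w) = 0 := by
        have : L v - z • smooth v = L w - z • smooth w := hvw
        rw [map_sub, map_sub, smul_sub, ← sub_eq_zero.2 this]; abel
      exact sub_eq_zero.1 (h _ h1)
    intro v hv
    have h0 : coeff v 0 = 0 := by
      have h1 := congrArg (fun f => coeff f 0) hv
      simp only [coeff_sub, coeff_smul, hP.mean, coeff_smooth_zero, coeff_zero, zero_sub,
        neg_eq_zero, mul_eq_zero, hz0, false_or] at h1
      exact h1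
    obtain ⟨v₁, hv₁, v₂, hv₂, rfl⟩ := exists_parity_decomp h0
    obtain ⟨h1, h2⟩ := hP.split hv₁ hv₂ (zero_mem _) (zero_mem _) (hv.trans (add_zero 0).symm)
    rw [he.inj z hz hzμ v₁ hv₁ h1, ho.inj z hz hz0 v₂ hv₂ h2, add_zero]
  · intro f
    -- The constant whose image under the pencil has the same mean as `f`.
    set c := -(coeff f 0 / z) with hc
    set f' := f - (L (c • oneL2) - z • smooth (c • oneL2)) with hf'
    have h0 : coeff f' 0 = 0 := by
      rw [hf', coeff_sub, coeff_sub, hP.mean, coeff_smul, coeff_smooth_zero, coeff_smul, coeff_oneL2,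
        if_pos rfl, hc]
      field_simp
      ring
    obtain ⟨f₁, hf₁, f₂, hf₂, hff⟩ := exists_parity_decomp h0
    obtain ⟨v₁, -, h1⟩ := he.surj z hz hzμ f₁ hf₁
    obtain ⟨v₂, -, h2⟩ := ho.surj z hz hz0 f₂ hf₂
    refine ⟨c • oneL2 + (v₁ + v₂), ?_⟩
    have h3 : f = (L (c • oneL2) - z • smooth (c • oneL2)) +
        ((L v₁ - z • smooth v₁) + (L v₂ - z • smooth v₂)) := by
      rw [h1, h2, ← hff, hf']; abel
    rw [h3]
    simp only [map_add, smul_add]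
    abel

/-- If `U` consists of eigenvectors and no preimage of `U` under `T - μ` leaves `U`, then no chain
of generalised eigenvectors gets beyond the first step. -/
theorem iSup_genEigenspace_eq {E : Type*} [NormedAddCommGroup E] [NormedSpace ℂ E]
    {T : E →ₗ.[ℂ] E} {μ : ℂ} {U : Submodule ℂ E}
    (h1 : ∀ V ∈ U, ∃ h : V ∈ T.domain, T ⟨V, h⟩ = μ • V)
    (h2 : ∀ V : T.domain, T V - μ • (V : E) ∈ U → (V : E) ∈ U) :
    ⨆ n, genEigenspace T μ n = U := by
  apply le_antisymm
  · refine iSup_le fun n => ?_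
    induction n with
    | zero => exact bot_le
    | succ n ih =>
      rintro x ⟨V, hV, rfl⟩
      exact h2 V (ih hV)
  · refine le_trans ?_ (le_iSup (genEigenspace T μ) 1)
    intro V hV
    obtain ⟨h, hT⟩ := h1 V hV
    refine ⟨⟨V, h⟩, ?_, rfl⟩
    change T ⟨V, h⟩ - μ • V ∈ (⊥ : Submodule ℂ E)
    rw [hT, sub_self]
    exact zero_mem _

/-- The criterion for semisimplicity in the preconditioned variable. Eigenvectors of `T` are `smooth
(x i)`, which is why the right side in `hgen` carries `smooth`. -/
theorem Precond.algMultiplicity_eq (hP : Precond T L) {z : ℂ} {m : ℕ} (x : Fin m → L2per)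
    (hli : LinearIndependent ℂ x) (heig : ∀ i, L (x i) = z • smooth (x i))
    (hgen : ∀ v : L2per, ∀ c : Fin m → ℂ, L v - z • smooth v = ∑ i, c i • smooth (x i) →
      ∃ d : Fin m → ℂ, v = ∑ i, d i • x i) : algMultiplicity T z = m := by
  have hli' : LinearIndependent ℂ (fun i => smooth (x i)) :=
    hli.map' (smooth : L2per →ₗ[ℂ] L2per) (LinearMap.ker_eq_bot.2 smooth_injective)
  have hU : ⨆ n, genEigenspace T z n = Submodule.span ℂ (Set.range fun i => smooth (x i)) := by
    apply iSup_genEigenspace_eq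
    · intro V hV
      obtain ⟨c, rfl⟩ := (Submodule.mem_span_range_iff_exists_fun ℂ).1 hV
      have h1 : smooth (∑ i, c i • x i) = ∑ i, c i • smooth (x i) := by
        simp only [map_sum, map_smul]
      obtain ⟨h2, h3⟩ := hP.apply (∑ i, c i • x i)
      have h4 : (∑ i, c i • smooth (x i)) ∈ T.domain := by rw [← h1]; exact h2
      refine ⟨h4, ?_⟩
      rw [hP.apply_eq (V := ⟨_, h4⟩) h1, map_sum, Finset.smul_sum]
      refine Finset.sum_congr rfl fun i _ => ?_
      rw [map_smul, heig, smul_comm]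
    · intro V hV
      obtain ⟨v, hv⟩ := hP.exists_eq V
      rw [hP.apply_eq hv, ← hv] at hV
      obtain ⟨c, hc⟩ := (Submodule.mem_span_range_iff_exists_fun ℂ).1 hV
      obtain ⟨d, hd⟩ := hgen v c hc.symm
      rw [← hv, hd, map_sum]
      refine Submodule.sum_mem _ fun i _ => ?_
      rw [map_smul]
      exact Submodule.smul_mem _ _ (Submodule.subset_span ⟨i, rfl⟩)
  rw [algMultiplicity, hU, finrank_span_eq_card hli', Fintype.card_fin]

theorem Sector.ne_zero {τ μ : ℂ} {x : L2per} (h : Sector L τ μ x) : x ≠ 0 := by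
  rintro rfl
  have := h.coeff_one
  rw [coeff_zero] at this
  exact zero_ne_one this

/-- The modes `0`, `1`, `-1` separate the vectors: the mean detects `w₀`, and the even and odd
vectors differ in sign at `-1`. -/
theorem linearIndependent_three {w₀ : L2per} (h0 : coeff w₀ 0 = 1) (he : Sector L 1 μ xe)
    (ho : Sector L (-1) 0 xo) : LinearIndependent ℂ ![w₀, xo, xe] := by
  rw [Fintype.linearIndependent_iff]
  intro c hc
  simp only [Fin.sum_univ_three, Matrix.cons_val] at hc
  have h1 := fun n => congrArg (fun f => coeff f n) hc
  simp only [coeff_add, coeff_smul, coeff_zero] at h1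
  have e0 := h1 0
  have e1 := h1 1
  have e2 := h1 (-1)
  rw [h0, ho.mem.1, he.mem.1] at e0
  have c0 : c 0 = 0 := by linear_combination e0
  rw [c0, ho.coeff_one, he.coeff_one] at e1
  rw [c0, ho.mem.2, he.mem.2, ho.coeff_one, he.coeff_one] at e2
  have c1 : c 1 = 0 := by linear_combination (e1 - e2) / 2
  have c2 : c 2 = 0 := by linear_combination (e1 + e2) / 2
  intro i
  fin_cases i
  · exact c0
  · exact c1
  · exact c2

/-- The spectrum of `T` to the right of `-1`, with multiplicities. -/
theorem Precond.spectrum (hP : Precond T L) (he : Sector L 1 μ xe) (ho : Sector L (-1) 0 xo)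
    (hμ : -1 < μ.re) {w₀ : L2per} (h0 : coeff w₀ 0 = 1) (hw₀ : L w₀ = 0) :
    spectrumOf T = {z ∈ spectrumOf T | z.re < -1} ∪ {μ, 0, 0} ∧
      ∀ z ∈ ({μ, 0, 0} : Set ℂ), algMultiplicity T z = Multiset.count z {μ, 0, 0} := by
  have hmean : ∀ {v f : L2per} {z : ℂ}, L v - z • smooth v = f → -z * coeff v 0 = coeff f 0 := by
    intro v f z h
    rw [← h, coeff_sub, coeff_smul, hP.mean, coeff_smooth_zero]; ring
  constructor
  · ext z
    constructor
    · intro hz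
      by_cases h : z.re < -1
      · exact Or.inl ⟨hz, h⟩
      · right
        by_contra hne
        simp only [Set.mem_insert_iff, Set.mem_singleton_iff, not_or] at hne
        exact hz (hP.mem_resolventSet (hP.bijective he ho (not_lt.1 h) hne.2.1 hne.1))
    · rintro (hz | hz)
      · exact hz.1
      · simp only [Set.mem_insert_iff, Set.mem_singleton_iff, or_self] at hz
        rcases hz with rfl | rfl
        · exact hP.mem_spectrum he.eigen he.ne_zero
        · exact hP.mem_spectrum ho.eigen ho.ne_zero
  · have hli := linearIndependent_three h0 he ho
    intro z hz
    simp only [Set.mem_insert_iff, Set.mem_singleton_iff, or_self] at hz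
    by_cases hμ0 : μ = 0
    · have hz0 : z = 0 := by rcases hz with h | h <;> simp [h, hμ0]
      subst hz0
      have hcount : Multiset.count (0 : ℂ) {μ, 0, 0} = 3 := by
        simp [hμ0]
      rw [hcount]
      refine hP.algMultiplicity_eq _ hli ?_ ?_
      · intro i
        fin_cases i
        · exact hw₀.trans (zero_smul _ _).symm
        · exact ho.eigen
        · exact he.eigen.trans (by rw [hμ0]; rfl)
      · intro v c hc
        simp only [Fin.sum_univ_three, Matrix.cons_val] at hc ⊢
        have e0 := hmean hc
        rw [neg_zero, zero_mul, coeff_add, coeff_add, coeff_smul, coeff_smul, coeff_smul,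
          coeff_smooth_zero, coeff_smooth_zero, coeff_smooth_zero, h0, ho.mem.1, he.mem.1] at e0
        -- The left side has mean zero and `w₀` has mean one, so no Jordan block sits above `w₀`.
        -- Subtracting the multiple of `w₀` with the mean of `v` then reduces to the two sectors.
        have c0 : c 0 = 0 := by linear_combination -e0
        rw [c0, zero_smul ℂ (smooth w₀), zero_add, add_comm] at hc
        have hv' : coeff (v - coeff v 0 • w₀) 0 = 0 := by rw [coeff_sub, coeff_smul, h0]; ring
        obtain ⟨v₁, hv₁, v₂, hv₂, hv⟩ := exists_parity_decomp hv'
        have hL : L (v₁ + v₂) - (0 : ℂ) • smooth (v₁ + v₂) =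
            c 2 • smooth xe + c 1 • smooth xo := by
          rw [← hc, ← hv, map_sub, map_smul, hw₀, smul_zero, sub_zero, zero_smul, zero_smul]
        obtain ⟨h1, h2⟩ := hP.split hv₁ hv₂
          (Submodule.smul_mem _ _ (smooth_mem_parity _ he.mem))
          (Submodule.smul_mem _ _ (smooth_mem_parity _ ho.mem)) hL
        rw [← hμ0] at h1
        obtain ⟨-, e1⟩ := he.simple v₁ hv₁ _ h1
        obtain ⟨-, e2⟩ := ho.simple v₂ hv₂ _ h2
        refine ⟨![coeff v 0, coeff v₂ 1, coeff v₁ 1], ?_⟩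
        simp only [Matrix.cons_val]
        rw [← e1, ← e2]
        exact (sub_eq_iff_eq_add.1 hv).trans (by abel)
    · by_cases hz0 : z = 0
      · subst hz0
        have hcount : Multiset.count (0 : ℂ) {μ, 0, 0} = 2 := by
          simp [Ne.symm hμ0]
        rw [hcount]
        have hli2 : LinearIndependent ℂ ![w₀, xo] := by
          have := hli.comp (Fin.castSucc : Fin 2 → Fin 3) (Fin.castSucc_injective 2)
          convert! this using 1
          ext i
          fin_cases i <;> rfl
        refine hP.algMultiplicity_eq _ hli2 ?_ ?_
        · intro i
          fin_cases i
          · exact hw₀.trans (zero_smul _ _).symm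
          · exact ho.eigen
        · intro v c hc
          simp only [Fin.sum_univ_two, Matrix.cons_val] at hc ⊢
          have e0 := hmean hc
          rw [neg_zero, zero_mul, coeff_add, coeff_smul, coeff_smul,
            coeff_smooth_zero, coeff_smooth_zero, h0, ho.mem.1] at e0
          have c0 : c 0 = 0 := by linear_combination -e0
          rw [c0, zero_smul ℂ (smooth w₀), zero_add] at hc
          have hv' : coeff (v - coeff v 0 • w₀) 0 = 0 := by rw [coeff_sub, coeff_smul, h0]; ring
          obtain ⟨v₁, hv₁, v₂, hv₂, hv⟩ := exists_parity_decomp hv'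
          have hL : L (v₁ + v₂) - (0 : ℂ) • smooth (v₁ + v₂) = 0 + c 1 • smooth xo := by
            rw [zero_add, ← hc, ← hv, map_sub, map_smul, hw₀, smul_zero, sub_zero, zero_smul,
              zero_smul]
          obtain ⟨h1, h2⟩ := hP.split hv₁ hv₂ (zero_mem _)
            (Submodule.smul_mem _ _ (smooth_mem_parity _ ho.mem)) hL
          -- For `μ ≠ 0` the even sector has no kernel, so only `w₀` and the odd vector contribute.
          have e1 := he.inj 0 (by simp) (Ne.symm hμ0) v₁ hv₁ h1
          obtain ⟨-, e2⟩ := ho.simple v₂ hv₂ _ h2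
          refine ⟨![coeff v 0, coeff v₂ 1], ?_⟩
          simp only [Matrix.cons_val]
          rw [e1] at hv
          rw [← e2]
          exact (sub_eq_iff_eq_add.1 hv).trans (by abel)
      · obtain rfl : z = μ := hz.resolve_right hz0
        have hcount : Multiset.count z {z, 0, 0} = 1 := by
          simp [hz0]
        rw [hcount]
        have hli1 : LinearIndependent ℂ ![xe] := by
          rw [linearIndependent_unique_iff]
          exact he.ne_zero
        refine hP.algMultiplicity_eq _ hli1 ?_ ?_
        · intro i
          fin_cases i
          exact he.eigen
        · intro v c hc
          simp only [Fin.sum_univ_one, Matrix.cons_val_fin_one] at hc ⊢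
          have e0 := hmean hc
          rw [coeff_smul, coeff_smooth_zero, he.mem.1, mul_zero, mul_eq_zero, neg_eq_zero] at e0
          obtain ⟨v₁, hv₁, v₂, hv₂, rfl⟩ := exists_parity_decomp (e0.resolve_left hz0)
          obtain ⟨h1, h2⟩ := hP.split hv₁ hv₂
            (Submodule.smul_mem _ _ (smooth_mem_parity _ he.mem)) (zero_mem _)
            (hc.trans (add_zero _).symm)
          obtain ⟨-, e1⟩ := he.simple v₁ hv₁ _ h1
          have e2 := ho.inj z hμ.le hz0 v₂ hv₂ h2
          refine ⟨fun _ => coeff v₁ 1, ?_⟩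
          rw [← e1, e2, add_zero]

end Spectral

/-! ### The linearisation at a pattern -/

/-- The potential `-2 s u - 3 u²`. -/
def potential (s : ℝ) (u : C(Circ, ℝ)) : C(Circ, ℝ) := -((2 * s) • u + (3 : ℝ) • u ^ 2)

theorem potential_even {s : ℝ} {u : C(Circ, ℝ)} (hu : ∀ x, u (-x) = u x) (x : Circ) :
    potential s u (-x) = potential s u x := by
  simp [potential, hu]

theorem mulC_potential (s : ℝ) (u : C(Circ, ℝ)) (f : L2per) :
    mulC (toComplex (potential s u)) f =
      -((2 * s : ℂ) • mulC (toComplex u) f + (3 : ℂ) • mulC (toComplex u) (mulC (toComplex u) f)) := by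
  have h : toComplex (potential s u) =
      -((2 * s : ℂ) • toComplex u + (3 : ℂ) • (toComplex u * toComplex u)) := by
    ext x
    simp [potential, sq]
  rw [h, map_neg, map_add, map_smul, map_smul, neg_apply, add_apply,
    smul_apply, smul_apply, mulC_mul]

theorem mulC_dfCoeff_eq (s ε : ℝ) (u : C(Circ, ℝ)) (f : L2per) :
    mulC (toComplex (dfCoeff s ε u)) f =
      ((ε : ℂ) ^ 2) • f + mulC (toComplex (potential s u)) f := by
  rw [mulC_dfCoeff, mulC_potential]; abel

/-- The constant `ε²` in `df(u)` joins the diagonal symbol, so the remaining potential vanishes with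
the pattern and can be treated as small. -/
theorem precond_blochOp (s ε ω : ℝ) (u : RealH6) {a : ℝ}
    (hw : WienerBound 1 a (toComplex (potential s u.1))) (hu : ∀ x, u.1 (-x) = u.1 x) :
    Precond (blochOp s ε ω 0 u) (linOp ε ω (potential s u.1)) where
  apply v := by
    refine ⟨smooth_mem v, coeff_ext fun n => ?_⟩
    change coeff ((blochOp s ε ω 0 u).toFun ⟨smooth v, smooth_mem v⟩) n = _
    refine (coeff_blochOp_zero s ε ω u ⟨smooth v, smooth_mem v⟩ n).trans ?_
    rw [coeff_linOp hw, mulC_dfCoeff_eq, coeff_add, coeff_smul, modeSymbol,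
      linSymbol]
    push_cast
    ring
  exists_eq V := exists_smooth_eq V.2
  mean v := by
    rw [coeff_linOp hw, modeSymbol_zero]
    simp
  parity τ v hv := linOp_mem_parity hw (potential_even hu) v hv

section SectorOfPencil

variable {ε ω a : ℝ} {w : C(Circ, ℝ)} {τ : ℂ}

/-- The abstract Schur results with `M = 16`, read back in `L²_per`; this gives the constants `256 =
16 M` and `32 = 2 M`. -/
theorem exists_sector (hτ : τ * τ = 1) (hε : ε ∈ Set.Icc 0 (1 / 8 : ℝ))
    (hω : ω ∈ Set.Icc (-1 / 2 : ℝ) (1 / 2)) (hw : WienerBound 1 a (toComplex w))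
    (heven : ∀ x, w (-x) = w x) (hsmall : 256 * pertBound ε ω a ≤ 1) :
    ∃ (μ : ℂ) (x : L2per), -1 < μ.re ∧ Sector (linOp ε ω w) τ μ x ∧
      ∀ v ∈ parity τ, ∀ ρ ∈ parity τ, ∀ b : ℂ, linOp ε ω w v = b • critVec τ + ρ →
        coeff v 1 = 1 → coeff ρ 1 = 0 → ‖b - μ‖ ≤ 32 * pertBound ε ω a *
          (‖ρ‖ + 4 * pertBound ε ω a * ‖smooth v - critVec τ‖) := by
  have h := schurPencil hτ hε hω hw heven hsmall
  obtain ⟨μ, hμ, hfix, -⟩ := h.exists_eigenvalue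
  set X := SchurPencil.corr (pertOpP τ ε ω hw heven) (resolventOpP τ ε ω) μ
    ⟨critVec τ, critVec_mem hτ⟩ with hX
  obtain ⟨hX1, hX2⟩ := h.eigenvector hμ.le hfix
  rw [← hX] at hX1 hX2
  rw [critCoeff_apply] at hX2
  have hsub : ∀ (z : ℂ) (v f : parity τ), linOpP τ ε ω hw heven v - z • smoothP τ v = f ↔
      linOp ε ω w v - z • smooth v = f := fun z v f => Subtype.ext_iff
  have hpb : ‖pertOpP τ ε ω hw heven‖ ≤ pertBound ε ω a :=
    norm_restrict_le _ (norm_pertOp_le hε hω hw)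
  refine ⟨μ, X, hμ, ⟨X.2, hX2, ?_, ?_, ?_, ?_⟩, ?_⟩
  · exact sub_eq_zero.1 ((hsub μ X 0).1 hX1)
  · intro v hv c hc
    obtain ⟨h1, h2⟩ := h.mem_span hμ.le hfix (v := ⟨v, hv⟩) (a := c) ((hsub μ ⟨v, hv⟩ _).2 hc)
    have h3 := Subtype.ext_iff.1 h2
    rw [critCoeff_apply] at h3
    exact ⟨h1, h3⟩
  · intro z hz hne v hv h0
    have h1 : SchurPencil.schur (pertOpP τ ε ω hw heven) (critCoeff τ)
        ⟨critVec τ, critVec_mem hτ⟩ (resolventOpP τ ε ω) z ≠ z :=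
      fun h2 => hne (h.schur_unique hz hμ.le h2 hfix)
    have h2 := (h.bijective hz h1).1 (a₁ := ⟨v, hv⟩) (a₂ := 0) (by
      simp only [map_zero, smul_zero, sub_zero]
      exact (hsub z ⟨v, hv⟩ 0).2 h0)
    exact Subtype.ext_iff.1 h2
  · intro z hz hne f hf
    have h1 : SchurPencil.schur (pertOpP τ ε ω hw heven) (critCoeff τ)
        ⟨critVec τ, critVec_mem hτ⟩ (resolventOpP τ ε ω) z ≠ z :=
      fun h2 => hne (h.schur_unique hz hμ.le h2 hfix)
    obtain ⟨v, hv⟩ := (h.bijective hz h1).2 ⟨f, hf⟩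
    exact ⟨v, v.2, (hsub z v ⟨f, hf⟩).1 hv⟩
  · intro v hv ρ hρ b hb hv1 hρ1
    have h1 := h.norm_sub_le hμ.le hfix (v := ⟨v, hv⟩) (ρ := ⟨ρ, hρ⟩) (b := b)
      (Subtype.ext hb) (by rw [critCoeff_apply]; exact hv1) (by rw [critCoeff_apply]; exact hρ1)
    refine h1.trans ?_
    change 2 * 16 * ‖pertOpP τ ε ω hw heven‖ *
      (‖ρ‖ + 4 * ‖pertOpP τ ε ω hw heven‖ * ‖smooth v - critVec τ‖) ≤ _
    have h0 := norm_nonneg (pertOpP τ ε ω hw heven)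
    calc _ ≤ 2 * 16 * pertBound ε ω a * (‖ρ‖ + 4 * pertBound ε ω a * ‖smooth v - critVec τ‖) := by
          have := h0.trans hpb
          gcongr
      _ = _ := by ring

end SectorOfPencil

/-! ### Reality of the even eigenvalue -/

/-- The function whose Fourier coefficients are the conjugates of those of `f`. -/
def conjCoeffL2 (f : L2per) : L2per :=
  ofCoeff (fun n => (starRingEnd ℂ) (coeff f n)) (by simpa using summable_coeff_sq f)

theorem coeff_conjCoeffL2 (f : L2per) (n : ℤ) :
    coeff (conjCoeffL2 f) n = (starRingEnd ℂ) (coeff f n) :=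
  coeff_ofCoeff _ _ n

theorem coeff_mulC_conj {w : C(Circ, ℝ)} {a : ℝ} (hw : WienerBound 1 a (toComplex w))
    (heven : ∀ x, w (-x) = w x) {f g : L2per}
    (hfg : ∀ n, coeff g n = (starRingEnd ℂ) (coeff f n)) (n : ℤ) :
    coeff (mulC (toComplex w) g) n = (starRingEnd ℂ) (coeff (mulC (toComplex w) f) n) := by
  have h1 := hasSum_coeff_mulC hw.summable_coeff f n
  have h2 := hasSum_coeff_mulC hw.summable_coeff g n
  refine h2.unique ((hasSum_conj'.2 h1).congr_fun fun m => ?_)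
  rw [map_mul, ← hfg, ← realFourier_apply, realFourier_eq_cosCoeff heven, conj_ofReal]

/-- An even real potential has real Fourier coefficients, so conjugating the coefficients of the
eigenvector gives an even eigenvector for the conjugate eigenvalue. The sector has only one
eigenvalue, hence it is real. -/
theorem Sector.conj_eq {ε ω a : ℝ} {w : C(Circ, ℝ)} (hw : WienerBound 1 a (toComplex w))
    (heven : ∀ x, w (-x) = w x) {μ : ℂ} {x : L2per} (h : Sector (linOp ε ω w) 1 μ x)
    (hμ : -1 < μ.re) : (starRingEnd ℂ) μ = μ := by
  by_contra hne
  have hs : ∀ n, coeff (smooth (conjCoeffL2 x)) n = (starRingEnd ℂ) (coeff (smooth x) n) := by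
    intro n
    rw [coeff_smooth, coeff_smooth, coeff_conjCoeffL2, map_mul, conj_ofReal]
  have h1 : linOp ε ω w (conjCoeffL2 x) - (starRingEnd ℂ) μ • smooth (conjCoeffL2 x) = 0 := by
    refine coeff_ext fun n => ?_
    have h2 := congrArg (fun f => (starRingEnd ℂ) (coeff f n)) h.eigen
    simp only [coeff_smul, coeff_linOp hw, map_mul, map_add, conj_ofReal, map_pow, map_intCast] at h2
    rw [coeff_sub, coeff_smul, coeff_linOp hw, coeff_mulC_conj hw heven hs, hs, coeff_zero, h2,
      sub_self]
  have h3 : conjCoeffL2 x ∈ parity 1 := by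
    refine ⟨by rw [coeff_conjCoeffL2, h.mem.1, map_zero], fun n => ?_⟩
    rw [coeff_conjCoeffL2, coeff_conjCoeffL2, h.mem.2, map_mul, map_one]
  have h4 := h.inj _ (by rw [conj_re]; exact hμ.le) hne _ h3 h1
  have h5 := coeff_conjCoeffL2 x 1
  rw [h4, coeff_zero, h.coeff_one, map_one] at h5
  exact zero_ne_one h5

/-! ### The trivial state -/

theorem linOp_critVec_of_trivial {ε ω : ℝ} (h : modeSymbol ε ω 1 = 0) (τ : ℂ)
    (hw : WienerBound 1 0 (toComplex 0)) : linOp ε ω 0 (critVec τ) = 0 := by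
  refine coeff_ext fun n => ?_
  rw [coeff_linOp hw, toComplex_zero, map_zero, zero_apply, coeff_zero, coeff_smooth, coeff_critVec]
  rcases int_cases n with rfl | rfl | rfl | h2
  · rw [modeSymbol_zero]; simp
  · rw [h]; simp
  · rw [modeSymbol_neg, h]; simp
  · rw [if_neg (by rintro rfl; norm_num at h2), if_neg (by rintro rfl; norm_num at h2)]
    simp

theorem smooth_oneL2 : smooth oneL2 = oneL2 := by
  refine coeff_ext fun n => ?_
  rw [coeff_smooth, coeff_oneL2]
  split_ifs with h
  · rw [h, weight_zero]; simp
  · simp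

theorem linOp_oneL2_of_trivial {ε ω : ℝ} (hw : WienerBound 1 0 (toComplex 0)) :
    linOp ε ω 0 oneL2 = 0 := by
  refine coeff_ext fun n => ?_
  rw [coeff_linOp hw, toComplex_zero, map_zero, zero_apply, coeff_zero, mul_zero, mul_zero, add_zero, smooth_oneL2,
    coeff_oneL2]
  split_ifs with h
  · rw [h, modeSymbol_zero]; simp
  · simp

/-- The sector has a unique eigenvalue with `Re z ≥ -1`, so any kernel element identifies it. -/
theorem Sector.eigenvalue_eq_zero {L : L2per →L[ℂ] L2per} {τ μ : ℂ} {x : L2per}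
    (h : Sector L τ μ x) {v : L2per} (hv : v ∈ parity τ) (hL : L v = 0) (hv0 : v ≠ 0) : μ = 0 := by
  by_contra hne
  exact hv0 (h.inj 0 (by simp) (Ne.symm hne) v hv (by rw [hL, zero_smul, sub_zero]))

theorem critVec_ne_zero (τ : ℂ) : critVec τ ≠ 0 := by
  intro h
  have := coeff_critVec τ 1
  rw [h, coeff_zero] at this
  norm_num at this

/-! ### The translational eigenfunction -/

/-- `g` is the weak derivative of `f`. -/
def IsWeakDeriv (f : C(Circ, ℂ)) (g : L2per) : Prop :=
  ∀ n : ℤ, coeff g n = I * n * fourierCoeff f n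

/-- Leibniz rule in Fourier variables: in the convolution, split `n = m + (n - m)`. -/
theorem IsWeakDeriv.mul {f₁ f₂ : C(Circ, ℂ)} {g₁ g₂ : L2per} (h₁ : IsWeakDeriv f₁ g₁)
    (h₂ : IsWeakDeriv f₂ g₂) (hs₁ : Summable (fourierCoeff f₁)) (hs₂ : Summable (fourierCoeff f₂)) :
    IsWeakDeriv (f₁ * f₂) (mulC f₁ g₂ + mulC f₂ g₁) := by
  intro n
  have e1 := hasSum_coeff_mulC hs₁ g₂ n
  have e2 := hasSum_coeff_mulC hs₂ g₁ n
  have e3 := (hasSum_coeff_mulC hs₁ (contToL2 f₂) n).mul_left (I * n)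
  rw [mulC_contToL2, coeff_contToL2] at e3
  rw [← (Equiv.subLeft n).hasSum_iff] at e2
  rw [coeff_add]
  refine (e1.add e2).unique (e3.congr_fun fun m => ?_)
  simp only [Function.comp_apply, Equiv.subLeft_apply, sub_sub_cancel, coeff_contToL2]
  rw [h₁, h₂]
  push_cast
  ring

/-- Chain rule for `s u² + u³`, obtained from the Leibniz rule for `u²` and `u · u²`. -/
theorem mulC_potential_deriv {s a : ℝ} {u : C(Circ, ℝ)} {j : ℕ}
    (hu : WienerBound j a (toComplex u)) {V : L2per} (hV : IsWeakDeriv (toComplex u) V) (n : ℤ) :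
    coeff (mulC (toComplex (potential s u)) V) n = -(I * n * realFourier n (nonlin s u)) := by
  have hs := hu.summable_coeff
  have h2 := hV.mul hV hs hs
  have hs2 := (hu.mul hu).summable_coeff
  have h3 := hV.mul h2 hs hs2
  have e2 := h2 n
  have e3 := h3 n
  have hn : realFourier n (nonlin s u) = s * fourierCoeff (toComplex u * toComplex u) n +
      fourierCoeff (toComplex u * (toComplex u * toComplex u)) n := by
    rw [nonlin, map_add, map_smul, realFourier_apply, realFourier_apply, pow_succ' u 2, sq,
      toComplex_mul, toComplex_mul, toComplex_mul, real_smul]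
  rw [map_add, mulC_mul] at e3
  simp only [coeff_add] at e2 e3
  rw [hn, mulC_potential, coeff_neg, coeff_add, coeff_smul, coeff_smul]
  linear_combination (-s : ℂ) * e2 - e3

/-- Differentiating the profile equation removes `q` and shows that `u'` is annihilated. It is odd
since `u` is even, and nonzero since its first harmonic is proportional to `A`. -/
theorem exists_translation_mode {s ε ω A a : ℝ} {u : C(Circ, ℝ)} (hu : ReducedProfile s ε ω A u)
    (hε : ε ∈ Set.Icc 0 (1 / 8 : ℝ)) (hω : ω ∈ Set.Icc (-1 / 2 : ℝ) (1 / 2)) (hA : A ≠ 0)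
    (hw : WienerBound 1 a (toComplex (potential s u))) :
    ∃ v ∈ parity (-1), linOp ε ω (potential s u) v = 0 ∧ v ≠ 0 := by
  obtain ⟨b, hb⟩ := hu.exists_wienerBound hε hω
  have hmem : toL2 u ∈ sobolev (6 + 1) := sobolev_anti (by norm_num) hb.sobolev_bound.1
  set V : sobolev 6 := perDeriv 6 ⟨toL2 u, hmem⟩ with hV
  have hVd : IsWeakDeriv (toComplex u) (V : L2per) := by
    intro n
    rw [hV, coeff_perDeriv, coeff_toL2]
  obtain ⟨v, hv⟩ := exists_smooth_eq V.2
  have hvc : ∀ n : ℤ, weight n * coeff v n = I * n * realFourier n u := by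
    intro n
    rw [← coeff_smooth, hv, hVd]; rfl
  have hev := hu.even hε hω
  have hwne : ∀ n : ℤ, (weight n : ℂ) ≠ 0 := fun n => by exact_mod_cast (weight_pos n).ne'
  refine ⟨v, ⟨?_, fun n => ?_⟩, coeff_ext fun n => ?_, ?_⟩
  · have := hvc 0
    simpa [weight_zero] using this
  · refine mul_left_cancel₀ (hwne n) ?_
    have h1 := hvc (-n)
    rw [weight_neg, realFourier_even hev] at h1
    rw [h1, mul_left_comm, hvc]
    push_cast
    ring
  · rw [coeff_linOp hw, hv, mulC_potential_deriv hb hVd, hVd, coeff_zero, modeSymbol]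
    rcases eq_or_ne n 0 with rfl | hn
    · simp
    · have h1 := hu.linSymbol_mul hε hω hn
      rw [← h1, ← realFourier_apply]
      push_cast
      ring
  · rintro rfl
    have h1 := hvc 1
    rw [coeff_zero, mul_zero, realFourier_eq_cosCoeff hev, hu.cosCoeff_one hε hω] at h1
    have h2 : ((A / 2 : ℝ) : ℂ) ≠ 0 := by
      rw [ofReal_ne_zero]; exact div_ne_zero hA two_ne_zero
    simp [I_ne_zero, hA] at h1

/-- The image of the constant `1` is even with mean zero. As `0` is not the even eigenvalue, it is
also the image of an even mean zero `v`; then `1 - v` is in the kernel. -/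
theorem exists_ker_mean_one {ε ω a : ℝ} {w : C(Circ, ℝ)} (hw : WienerBound 1 a (toComplex w))
    (heven : ∀ x, w (-x) = w x) {μ : ℂ} {x : L2per} (h : Sector (linOp ε ω w) 1 μ x)
    (hμ : μ ≠ 0) : ∃ w₀, coeff w₀ 0 = 1 ∧ linOp ε ω w w₀ = 0 := by
  have h1 : ∀ n : ℤ, coeff (linOp ε ω w oneL2) n =
      (waveNumber ε ω ^ 2 : ℝ) * ((n : ℂ) ^ 2 * realFourier n w) := by
    intro n
    have h2 : modeSymbol ε ω n * coeff oneL2 n = 0 := by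
      rw [coeff_oneL2]
      split_ifs with h
      · rw [h, modeSymbol_zero]; simp
      · simp
    rw [coeff_linOp hw, smooth_oneL2, h2, zero_add, oneL2, mulC_contToL2, coeff_contToL2,
      realFourier_apply]
    congr 4
    ext y
    simp
  have h2 : linOp ε ω w oneL2 ∈ parity 1 := by
    refine ⟨by rw [h1]; simp, fun n => ?_⟩
    rw [h1, h1, realFourier_even heven]
    push_cast
    ring
  obtain ⟨v, hv, hvL⟩ := h.surj 0 (by simp) (Ne.symm hμ) _ h2
  refine ⟨oneL2 - v, ?_, ?_⟩
  · rw [coeff_sub, coeff_oneL2, if_pos rfl, hv.1, sub_zero]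
  · rw [zero_smul, sub_zero] at hvL
    rw [map_sub, hvL, sub_self]

/-! ### The approximate eigenfunction along the branch of patterns -/

/-- The derivative of the profile `A • shape A g` in the direction of the amplitude, to leading
order. -/
def quasimode (A : ℝ) (g : C(Circ, ℝ)) : C(Circ, ℝ) := (2 : ℝ) • (shape A g + A • g)

/-- The residual of the quasimode, up to a factor. -/
def quasiDefect (s A : ℝ) (g : C(Circ, ℝ)) : C(Circ, ℝ) :=
  shape A g ^ 3 + (2 * s) • (shape A g * g) + (3 * A) • (shape A g ^ 2 * g)

/-- The higher order part of the bifurcation coefficient in the quasimode eigenvalue. -/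
def quasiCorr (s A : ℝ) (g : C(Circ, ℝ)) : ℝ :=
  s * cosCoeff 1 (g ^ 2) + 3 * cosCoeff 1 (shape A g ^ 2 * g)

/-- The approximate critical eigenvalue. -/
def quasiEigenvalue (s ε ω A : ℝ) (g : C(Circ, ℝ)) : ℝ :=
  -(waveNumber ε ω ^ 2 * (2 * A ^ 2 * bifCoeff s A g + A ^ 3 * quasiCorr s A g))

theorem quasimode_eq (A : ℝ) (g : C(Circ, ℝ)) :
    quasimode A g = (2 : ℝ) • cosC 1 + (4 * A) • g := by
  ext x
  simp only [quasimode, shape, ContinuousMap.add_apply, ContinuousMap.smul_apply, smul_eq_mul]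
  ring

/-- Exact separation of orders: the term `4 A` times the nonlinearity cancels the linear part acting
on `4 A g`, by the fixed point equation for `g`. Only `O(A²)` survives on the modes `|n| ≥ 2`. -/
theorem potential_mul_quasimode (s A : ℝ) (g : C(Circ, ℝ)) :
    potential s (A • shape A g) * quasimode A g =
      -((2 * A ^ 2) • quasiDefect s A g + (4 * A) • scaledNonlin s A g) := by
  ext x
  simp only [quasimode, potential, quasiDefect, scaledNonlin, ContinuousMap.add_apply,
    ContinuousMap.smul_apply, ContinuousMap.mul_apply, ContinuousMap.neg_apply,
    ContinuousMap.pow_apply, smul_eq_mul]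
  ring

theorem cosCoeff_one_quasiDefect (s A : ℝ) (g : C(Circ, ℝ)) :
    cosCoeff 1 (quasiDefect s A g) = bifCoeff s A g + A * quasiCorr s A g := by
  have h : shape A g * g = cosC 1 * g + A • g ^ 2 := by
    ext x
    simp only [shape, ContinuousMap.add_apply, ContinuousMap.smul_apply, ContinuousMap.mul_apply,
      ContinuousMap.pow_apply, smul_eq_mul]
    ring
  rw [quasiDefect, h, map_add, map_add, map_smul, map_smul, map_add, map_smul, bifCoeff, quasiCorr]
  simp only [smul_eq_mul]
  ring

/-- A bound for the residual of the quasimode. -/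
def defectBound (s : ℝ) : ℝ := 108 + 12 * |s| * corrBound s + 108 * corrBound s

/-- A bound for the higher order part of the quasimode eigenvalue. -/
def quasiCorrBound (s : ℝ) : ℝ := 2 * |s| * corrBound s ^ 2 + 24 * corrBound s

section Quasimode

variable {s ε ω A : ℝ} {g : C(Circ, ℝ)}

theorem abs_quasiCorr_le (hA : |A| ≤ ampBound s) (hg : ‖g‖ ≤ corrBound s) :
    |quasiCorr s A g| ≤ quasiCorrBound s := by
  have h1 := one_le_corrBound s
  have h2 := norm_shape_le hA hg
  have h3 : |cosCoeff 1 (g ^ 2)| ≤ 2 * corrBound s ^ 2 := by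
    refine (abs_cosCoeff_le 1 _).trans ?_
    have := norm_pow_le' g (n := 2) (by norm_num)
    have := pow_le_pow_left₀ (norm_nonneg g) hg 2
    linarith
  have h4 : |cosCoeff 1 (shape A g ^ 2 * g)| ≤ 8 * corrBound s := by
    refine (abs_cosCoeff_le 1 _).trans ?_
    have e1 := norm_mul_le (shape A g ^ 2) g
    have e2 := norm_pow_le' (shape A g) (n := 2) (by norm_num)
    have e3 := pow_le_pow_left₀ (norm_nonneg _) h2 2
    have e4 := mul_le_mul (e2.trans e3) hg (norm_nonneg _) (by norm_num)
    linarith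
  rw [quasiCorr, quasiCorrBound]
  refine (abs_add_le _ _).trans ?_
  rw [abs_mul, abs_mul, abs_of_pos (show (0 : ℝ) < 3 by norm_num)]
  have := mul_le_mul_of_nonneg_left h3 (abs_nonneg s)
  linarith

variable (hε : ε ∈ Set.Icc 0 (1 / 8 : ℝ)) (hω : ω ∈ Set.Icc (-1 / 2 : ℝ) (1 / 2))
  (hA : |A| ≤ ampBound s) (hg : ‖g‖ ≤ corrBound s) (h : ScaledProfile s ε ω A g)
include hε hω hA hg h

theorem ScaledProfile.wienerBound_quasiDefect :
    WienerBound 1 (defectBound s) (toComplex (quasiDefect s A g)) := by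
  have hy := wienerBound_shape hε hω hA hg h.eq
  have hg1 := wienerBound_corr hε hω hA hg h.eq
  refine ((hy.real_cube.real_add ((hy.real_mul hg1).real_smul (2 * s))).real_add
    ((hy.real_sq.real_mul hg1).real_smul (3 * A))).mono ?_
  have h1 := abs_le_one_of_le_ampBound hA
  have h2 := one_le_corrBound s
  rw [abs_mul, abs_mul, abs_two, abs_of_pos (show (0 : ℝ) < 3 by norm_num), defectBound]
  nlinarith [abs_nonneg A]

theorem ScaledProfile.wienerBound_potential :
    WienerBound 1 (|A| * (6 * |s| + 54)) (toComplex (potential s (A • shape A g))) := by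
  have hy := (wienerBound_shape hε hω hA hg h.eq).real_smul A
  refine ((hy.real_smul (2 * s)).real_add (hy.real_sq.real_smul 3)).real_neg.mono ?_
  have h1 := abs_le_one_of_le_ampBound hA
  rw [abs_mul, abs_two, abs_of_pos (show (0 : ℝ) < 3 by norm_num)]
  nlinarith [abs_nonneg A, abs_nonneg s]

omit hA hg in
theorem ScaledProfile.shape_even (x : Circ) : shape A g (-x) = shape A g x := by
  have h1 : g (-x) = g x := by
    rw [h.eq]; simp [greenOp_even hε hω]
  simp [shape, h1, cosC_even]

omit hA hg in
theorem ScaledProfile.corr_even (x : Circ) : g (-x) = g x := by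
  rw [h.eq]; simp [greenOp_even hε hω]

omit hA hg in
theorem ScaledProfile.quasimode_even (x : Circ) : quasimode A g (-x) = quasimode A g x := by
  simp [quasimode, h.shape_even hε hω, h.corr_even hε hω]

omit hA hg in
theorem ScaledProfile.realFourier_corr_zero : realFourier 0 g = 0 := by
  rw [h.eq, map_neg, greenOp, (cosSymbol_invSymbol hε hω).realFourier_cosMult]
  simp [invSymbol]

omit hA hg in
theorem ScaledProfile.realFourier_corr_one : realFourier 1 g = 0 := by
  rw [h.eq, map_neg, greenOp, (cosSymbol_invSymbol hε hω).realFourier_cosMult]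
  simp [invSymbol]

omit hA hg in
theorem ScaledProfile.linSymbol_mul_corr {n : ℤ} (hn : 2 ≤ |n|) :
    linSymbol ε ω n * realFourier n g = realFourier n (scaledNonlin s A g) := by
  have hev : ∀ x, scaledNonlin s A g (-x) = scaledNonlin s A g x := fun x => by
    simp [scaledNonlin, h.shape_even hε hω]
  have h1 := linSymbol_le hε hω hn
  have h2 := four_le_sq hn
  have h3 : linSymbol ε ω n ≠ 0 := by nlinarith
  conv_lhs => rw [h.eq]
  rw [map_neg, greenOp, (cosSymbol_invSymbol hε hω).realFourier_cosMult, invSymbol, if_pos hn,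
    realFourier_eq_cosCoeff hev, ← ofReal_neg, ← ofReal_mul]
  congr 1
  field_simp

omit hA hg in
theorem ScaledProfile.realFourier_quasimode_zero : realFourier 0 (quasimode A g) = 0 := by
  rw [quasimode_eq, map_add, map_smul, map_smul, h.realFourier_corr_zero hε hω, realFourier_cosC]
  simp

omit hA hg in
theorem ScaledProfile.realFourier_quasimode_one : realFourier 1 (quasimode A g) = 1 := by
  rw [quasimode_eq, map_add, map_smul, map_smul, h.realFourier_corr_one hε hω, realFourier_cosC]
  norm_num

omit hA hg in
theorem ScaledProfile.linSymbol_mul_quasimode {n : ℤ} (hn : 2 ≤ |n|) :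
    linSymbol ε ω n * realFourier n (quasimode A g) +
        realFourier n (potential s (A • shape A g) * quasimode A g) =
      (-(2 * A ^ 2) : ℝ) * realFourier n (quasiDefect s A g) := by
  have h1 := h.linSymbol_mul_corr hε hω hn
  rw [potential_mul_quasimode, quasimode_eq, map_neg, map_add, map_add, map_smul, map_smul,
    map_smul, map_smul, realFourier_cosC_one_of_two_le hn, ← h1]
  simp only [real_smul]
  push_cast
  ring

-- Bookkeeping for the factor `-2`: the bifurcation equation gives `A² Γ` from the linear symbol.
-- The potential gives `-3 A² Γ - A³ quasiCorr`, because a Fourier coefficient is half the cosine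
-- coefficient.
omit hA hg in
theorem ScaledProfile.linSymbol_mul_quasimode_one :
    ((waveNumber ε ω ^ 2 : ℝ) : ℂ) * (linSymbol ε ω 1 * realFourier 1 (quasimode A g) +
        realFourier 1 (potential s (A • shape A g) * quasimode A g)) =
      quasiEigenvalue s ε ω A g := by
  have hev : ∀ x, (potential s (A • shape A g) * quasimode A g) (-x) =
      (potential s (A • shape A g) * quasimode A g) x := fun x => by
    rw [ContinuousMap.mul_apply, ContinuousMap.mul_apply, h.quasimode_even hε hω,
      potential_even (h.reducedProfile.even hε hω)]
  rw [h.realFourier_quasimode_one hε hω, realFourier_eq_cosCoeff hev, potential_mul_quasimode,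
    map_neg, map_add, map_smul, map_smul, cosCoeff_one_scaledNonlin, cosCoeff_one_quasiDefect,
    linSymbol_one hε hω, h.bifurcation, quasiEigenvalue]
  simp only [smul_eq_mul]
  push_cast
  ring

/-- The choice of `quasiEigenvalue` removes the modes `±1` from the residual. On `|n| ≥ 2` the
residual is `-2 A² k² n²` times the defect; one weight pays for `n²`, and `9/4 = 2 · 9/8` since `k²
≤ 9/8`. The deviation of `smooth v` from the critical mode is exactly `4 A g`. -/
theorem ScaledProfile.exists_quasimode :
    ∃ v ∈ parity 1, ∃ ρ ∈ parity 1, linOp ε ω (potential s (A • shape A g)) v =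
        (quasiEigenvalue s ε ω A g : ℂ) • critVec 1 + ρ ∧ coeff v 1 = 1 ∧ coeff ρ 1 = 0 ∧
      ‖ρ‖ ≤ 9 / 4 * A ^ 2 * defectBound s ∧ ‖smooth v - critVec 1‖ ≤ 4 * |A| * corrBound s := by
  have hw := h.wienerBound_potential hε hω hA hg
  have hwe := potential_even (s := s) (h.reducedProfile.even hε hω)
  set w := potential s (A • shape A g) with hwdef
  set q := quasimode A g with hq
  have hqb : toL2 q ∈ sobolev 6 := by
    have hg3 := wienerBound_corr_three hε hω hA hg h.eq
    have := (((wienerBound_cosC 3 1).real_smul 2).real_add (hg3.real_smul (4 * A))).sobolev_bound.1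
    rwa [← quasimode_eq] at this
  obtain ⟨v, hv⟩ := exists_smooth_eq hqb
  have hvc : ∀ n : ℤ, weight n * coeff v n = realFourier n q := by
    intro n
    rw [← coeff_smooth, hv, toL2_eq, coeff_contToL2]; rfl
  have hwne : ∀ n : ℤ, (weight n : ℂ) ≠ 0 := fun n => by exact_mod_cast (weight_pos n).ne'
  have hvp : v ∈ parity 1 := by
    refine ⟨?_, fun n => ?_⟩
    · have := hvc 0
      rw [h.realFourier_quasimode_zero hε hω] at this
      exact (mul_eq_zero.1 this).resolve_left (hwne 0)
    · refine mul_left_cancel₀ (hwne n) ?_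
      rw [one_mul, hvc, ← realFourier_even (h.quasimode_even hε hω), ← hvc, weight_neg]
  have hL : ∀ n : ℤ, coeff (linOp ε ω w v) n = (waveNumber ε ω ^ 2 : ℝ) * (n : ℂ) ^ 2 *
      (linSymbol ε ω n * realFourier n q + realFourier n (w * q)) := by
    intro n
    rw [coeff_linOp hw, hv, toL2_eq, mulC_contToL2, coeff_contToL2, coeff_contToL2,
      ← toComplex_mul, ← realFourier_apply, ← realFourier_apply, modeSymbol]
    push_cast
    ring
  have hLp := linOp_mem_parity (τ := 1) (ε := ε) (ω := ω) hw hwe v hvp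
  set b : ℂ := ((quasiEigenvalue s ε ω A g : ℝ) : ℂ) with hb
  set ρ := linOp ε ω w v - b • critVec 1 with hρ
  have hρp : ρ ∈ parity 1 :=
    sub_mem hLp (Submodule.smul_mem _ _ (critVec_mem (by norm_num)))
  have hρ1 : coeff ρ 1 = 0 := by
    rw [hρ, coeff_sub, coeff_smul, coeff_critVec, hL, Int.cast_one, one_pow, mul_one,
      h.linSymbol_mul_quasimode_one hε hω]
    norm_num
    exact sub_self _
  have hd := h.wienerBound_quasiDefect hε hω hA hg
  have hk := waveNumber_sq_mem hε hω
  have hρn : ∀ n : ℤ, ‖coeff ρ n‖ ≤ 9 / 4 * A ^ 2 *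
      ((1 + (n : ℝ) ^ 2) ^ 1 * ‖fourierCoeff (toComplex (quasiDefect s A g)) n‖) := by
    intro n
    rcases int_cases n with rfl | rfl | rfl | hn
    · rw [hρp.1, norm_zero]; positivity
    · rw [hρ1, norm_zero]; positivity
    · rw [hρp.2, hρ1, mul_zero, norm_zero]; positivity
    · rw [hρ, coeff_sub, coeff_smul, coeff_critVec, if_neg (by rintro rfl; norm_num at hn),
        if_neg (by rintro rfl; norm_num at hn), mul_zero, add_zero, mul_zero, sub_zero, hL,
        h.linSymbol_mul_quasimode hε hω hn, ← realFourier_apply]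
      have e : ((waveNumber ε ω ^ 2 : ℝ) : ℂ) * (n : ℂ) ^ 2 =
          ((waveNumber ε ω ^ 2 * (n : ℝ) ^ 2 : ℝ) : ℂ) := by push_cast; ring
      rw [e, norm_mul, norm_mul, Complex.norm_real, Complex.norm_real, Real.norm_eq_abs,
        Real.norm_eq_abs, abs_neg, abs_of_nonneg (by positivity), abs_of_nonneg (by positivity),
        pow_one, ← mul_assoc, ← mul_assoc (9 / 4 * A ^ 2)]
      refine mul_le_mul_of_nonneg_right ?_ (norm_nonneg (realFourier n (quasiDefect s A g)))
      have e1 : waveNumber ε ω ^ 2 * (n : ℝ) ^ 2 ≤ 9 / 8 * (1 + (n : ℝ) ^ 2) := by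
        nlinarith [hk.2, sq_nonneg (n : ℝ)]
      nlinarith [sq_nonneg A]
  refine ⟨v, hvp, ρ, hρp, (add_sub_cancel _ _).symm, ?_, hρ1, ?_, ?_⟩
  · have := hvc 1
    rwa [h.realFourier_quasimode_one hε hω, weight_of_ne one_ne_zero, Int.cast_one, one_pow,
      div_one, ofReal_one, one_mul] at this
  · have hs := Summable.of_nonneg_of_le (fun n => norm_nonneg (coeff ρ n)) hρn (hd.summable.mul_left _)
    refine (norm_le_tsum_coeff hs).trans ((hs.tsum_le_tsum hρn (hd.summable.mul_left _)).trans ?_)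
    rw [tsum_mul_left]
    exact mul_le_mul_of_nonneg_left hd.tsum_le (by positivity)
  · have e : smooth v - critVec 1 = contToL2 (toComplex ((4 * A) • g)) := by
      rw [hv, toL2_eq, hq, quasimode_eq, toComplex_add, contToL2_add, add_comm, critVec,
        toComplex_smul 2, toComplex_cosC, smul_smul, one_smul]
      norm_num
    rw [e]
    have := ((wienerBound_corr hε hω hA hg h.eq).real_smul (4 * A)).norm_contToL2_le
    rwa [abs_mul, abs_of_pos (show (0 : ℝ) < 4 by norm_num)] at this

end Quasimode

/-! ### The critical eigenvalue and the spectrum -/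

/-- The perturbation of the linearisation is at most this constant times the amplitude. -/
def pertConst (s : ℝ) : ℝ := 9 / 8 * (8 * |s| + 16) + 9 / 8 * (2 * ‖mulC‖ * (6 * |s| + 54))

/-- The constant in the cubic error of the critical eigenvalue. -/
def eigenConst (s : ℝ) : ℝ :=
  32 * pertConst s * (9 / 4 * defectBound s + 16 * pertConst s * corrBound s) +
    9 / 8 * quasiCorrBound s

theorem pertConst_nonneg (s : ℝ) : 0 ≤ pertConst s := by rw [pertConst]; positivity

theorem defectBound_nonneg (s : ℝ) : 0 ≤ defectBound s := by
  have := one_le_corrBound s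
  rw [defectBound]; positivity

theorem eigenConst_nonneg (s : ℝ) : 0 ≤ eigenConst s := by
  have := one_le_corrBound s
  have := pertConst_nonneg s
  have := defectBound_nonneg s
  rw [eigenConst, quasiCorrBound]; positivity

section Branch

variable {s ε ω A : ℝ} {g : C(Circ, ℝ)}

/-- The amplitude equation expresses the critical symbol through `A` as well, so the whole
perturbation is `O(A)`, uniformly up to `|ω| = 1/2`. -/
theorem ScaledProfile.pertBound_le (hε : ε ∈ Set.Icc 0 (1 / 8 : ℝ))
    (hω : ω ∈ Set.Icc (-1 / 2 : ℝ) (1 / 2)) (hA : |A| ≤ ampBound s) (hg : ‖g‖ ≤ corrBound s)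
    (h : ScaledProfile s ε ω A g) :
    pertBound ε ω (|A| * (6 * |s| + 54)) ≤ |A| * pertConst s := by
  have hk := waveNumber_sq_mem hε hω
  have h1 : A ^ 2 * bifCoeff s A g = A * cosCoeff 1 (scaledNonlin s A g) := by
    rw [cosCoeff_one_scaledNonlin]; ring
  have h2 : |A * cosCoeff 1 (scaledNonlin s A g)| ≤ |A| * (8 * |s| + 16) := by
    rw [abs_mul]
    refine mul_le_mul_of_nonneg_left ?_ (abs_nonneg A)
    linarith [abs_cosCoeff_le 1 (scaledNonlin s A g), norm_scaledNonlin_le hA hg]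
  rw [pertBound, modeSymbol, linSymbol_one hε hω, h.bifurcation, h1, Int.cast_one, one_pow,
    mul_one, abs_mul, abs_of_nonneg (by linarith [hk.1] : 0 ≤ waveNumber ε ω ^ 2), pertConst]
  have h3 := mul_le_mul hk.2 h2 (abs_nonneg _) (by norm_num)
  linarith

/-- Both error terms are cubic in `A`: the perturbation `O(A)` times the residual `O(A²)`, and its
square times the `O(A)` deviation of the quasimode. -/
theorem ScaledProfile.exists_even_sector (hε : ε ∈ Set.Icc 0 (1 / 8 : ℝ))
    (hω : ω ∈ Set.Icc (-1 / 2 : ℝ) (1 / 2)) (hA : |A| ≤ ampBound s) (hg : ‖g‖ ≤ corrBound s)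
    (h : ScaledProfile s ε ω A g) (hsmall : 256 * (|A| * pertConst s) ≤ 1) :
    ∃ (lam : ℝ) (x : L2per), -1 < lam ∧
      Sector (linOp ε ω (potential s (A • shape A g))) 1 (lam : ℂ) x ∧
      |lam + waveNumber ε ω ^ 2 * (2 * A ^ 2 * bifCoeff s A g)| ≤ |A| ^ 3 * eigenConst s := by
  have hw := h.wienerBound_potential hε hω hA hg
  have hwe := potential_even (s := s) (h.reducedProfile.even hε hω)
  have hpb := h.pertBound_le hε hω hA hg
  have hk := waveNumber_sq_mem hε hω
  obtain ⟨μ, x, hμ, hx, hest⟩ := exists_sector (τ := 1) (by norm_num) hε hω hw hwe (by linarith)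
  obtain ⟨v, hv, ρ, hρ, hL, hv1, hρ1, hρn, hvn⟩ := h.exists_quasimode hε hω hA hg
  have h1 := hest v hv ρ hρ _ hL hv1 hρ1
  obtain ⟨lam, rfl⟩ := Complex.conj_eq_iff_real.1 (hx.conj_eq hw hwe hμ)
  refine ⟨lam, x, by simpa using hμ, hx, ?_⟩
  rw [← ofReal_sub, Complex.norm_real, Real.norm_eq_abs] at h1
  have hpb0 : 0 ≤ pertBound ε ω (|A| * (6 * |s| + 54)) := by rw [pertBound]; positivity
  have h2 : |quasiEigenvalue s ε ω A g - lam| ≤ |A| ^ 3 *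
      (32 * pertConst s * (9 / 4 * defectBound s + 16 * pertConst s * corrBound s)) := by
    refine h1.trans ?_
    have := pertConst_nonneg s
    calc _ ≤ 32 * (|A| * pertConst s) * (9 / 4 * A ^ 2 * defectBound s +
          4 * (|A| * pertConst s) * (4 * |A| * corrBound s)) := by gcongr
      _ = _ := by rw [← sq_abs A]; ring
  have h3 := abs_quasiCorr_le hA hg
  have h4 : |waveNumber ε ω ^ 2 * (A ^ 3 * quasiCorr s A g)| ≤
      |A| ^ 3 * (9 / 8 * quasiCorrBound s) := by
    rw [abs_mul, abs_mul, abs_pow A, abs_of_nonneg (by linarith [hk.1] : 0 ≤ waveNumber ε ω ^ 2)]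
    calc _ ≤ 9 / 8 * (|A| ^ 3 * quasiCorrBound s) := by gcongr; exact hk.2
      _ = _ := by ring
  have e : lam + waveNumber ε ω ^ 2 * (2 * A ^ 2 * bifCoeff s A g) =
      -(quasiEigenvalue s ε ω A g - lam) - waveNumber ε ω ^ 2 * (A ^ 3 * quasiCorr s A g) := by
    rw [quasiEigenvalue]; ring
  rw [e, eigenConst, mul_add]
  refine (abs_sub _ _).trans ?_
  rw [abs_neg]
  exact add_le_add h2 h4

end Branch

/-- The range of `ε` in which the spectrum at the patterns is controlled. -/
def stabilityRange (s : ℝ) : ℝ :=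
  min (patternRange s / 2)
    (landau s / 2 / (256 * pertConst s + 4 * eigenConst s / landau s + 1))

/-- The constant in the expansion of the critical eigenvalue. -/
def expansionConst (s : ℝ) : ℝ := (2 / landau s) ^ 3 * eigenConst s + 2

theorem stabilityRange_mem {s : ℝ} (hs : 0 < landau s) :
    stabilityRange s ∈ Set.Ioo 0 (patternRange s) := by
  have h1 := patternRange_pos hs
  have h2 := pertConst_nonneg s
  have h3 := eigenConst_nonneg s
  exact ⟨lt_min (half_pos h1) (by positivity), (min_le_left _ _).trans_lt (half_lt_self h1)⟩

theorem expansionConst_nonneg {s : ℝ} (hs : 0 < landau s) : 0 ≤ expansionConst s := by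
  have h3 := eigenConst_nonneg s
  rw [expansionConst]; positivity

theorem amp_le {s ε A : ℝ} (hs : 0 < landau s) (hε : 0 ≤ ε)
    (h : A ^ 2 * (landau s / 2) ≤ ε ^ 2) : A ≤ 2 / landau s * ε := by
  have h1 := landau_le s
  -- Uses `landau s / 2 ≤ 1`: the square of the left side is at most `A² landau s / 2`.
  have h2 : A * (landau s / 2) ≤ ε := by
    refine le_of_sq_le_sq ?_ hε
    nlinarith [sq_nonneg ε]
  rw [div_mul_eq_mul_div, le_div_iff₀ hs]
  linarith

/-- The potential vanishes and the modes `0`, `±1` are neutral. The constant and the even and odd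
critical modes are explicit kernel vectors, so all three eigenvalues are zero. -/
theorem spectral_splitting_of_zero {s ε ω : ℝ} {u : RealH6} (hε : ε ∈ Set.Icc 0 (1 / 8 : ℝ))
    (hω : ω ∈ Set.Icc (-1 / 2 : ℝ) (1 / 2)) (htriv : ε = 0 ∨ |ω| = 1 / 2) (hu : u.1 = 0) :
    spectrumOf (blochOp s ε ω 0 u) =
        {z ∈ spectrumOf (blochOp s ε ω 0 u) | z.re < -1} ∪ {0, 0, 0} ∧
      ∀ z ∈ ({0, 0, 0} : Set ℂ),
        algMultiplicity (blochOp s ε ω 0 u) z = Multiset.count z {0, 0, 0} := by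
  have hpot : potential s u.1 = 0 := by rw [hu]; ext x; simp [potential]
  have hw : WienerBound 1 0 (toComplex 0) := by
    have := (wienerBound_cosC 1 1).real_smul 0
    rwa [zero_smul, abs_zero, zero_mul] at this
  have hwu : WienerBound 1 0 (toComplex (potential s u.1)) := by rwa [hpot]
  have hP := precond_blochOp s ε ω u hwu (fun x => by rw [hu]; rfl)
  rw [hpot] at hP
  have hm : modeSymbol ε ω 1 = 0 := by
    rw [modeSymbol, linSymbol_one hε hω]
    rcases htriv with h | h
    · rw [h]; simp
    · have h2 : ω ^ 2 = 1 / 4 := by rw [← sq_abs, h]; norm_num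
      rw [h2]; norm_num
  have hpb : 256 * pertBound ε ω 0 ≤ 1 := by rw [pertBound, hm]; norm_num
  have hev : ∀ x, (0 : C(Circ, ℝ)) (-x) = (0 : C(Circ, ℝ)) x := fun x => rfl
  have key : ∀ τ : ℂ, τ * τ = 1 → ∃ x, Sector (linOp ε ω 0) τ 0 x := by
    intro τ hτ
    obtain ⟨μ, x, -, hx, -⟩ := exists_sector hτ hε hω hw hev hpb
    rw [hx.eigenvalue_eq_zero (critVec_mem hτ) (linOp_critVec_of_trivial hm τ hw)
      (critVec_ne_zero τ)] at hx
    exact ⟨x, hx⟩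
  obtain ⟨xe, he⟩ := key 1 (by norm_num)
  obtain ⟨xo, ho⟩ := key (-1) (by norm_num)
  exact hP.spectrum he ho (by simp) (w₀ := oneL2) (by rw [coeff_oneL2, if_pos rfl])
    (linOp_oneL2_of_trivial hw)

/-- On the branch the even eigenvalue is nonzero, which supplies the kernel vector with mean one,
while translation fixes the odd eigenvalue at `0`. The expansion then follows from `A² Γ = (1 - 4ω²)
ε²`, `|k² - 1| ≤ ε` and `A = O(ε)`. -/
theorem exists_spectral_splitting_of_scaledProfile {s ε ω A : ℝ} {u : RealH6} {g : C(Circ, ℝ)}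
    (hs : 0 < landau s) (h0 : 0 < ε) (hε : ε ≤ stabilityRange s)
    (hω : ω ∈ Set.Icc (-1 / 2 : ℝ) (1 / 2)) (hA0 : 0 < A) (hA : A ≤ smallAmp s)
    (hu : u.1 = A • shape A g) (hg : ‖g‖ ≤ corrBound s) (h : ScaledProfile s ε ω A g) :
    ∃ lam : ℝ, -1 < lam ∧ |lam - -2 * (1 - 4 * ω ^ 2) * ε ^ 2| ≤ expansionConst s * ε ^ 3 ∧
      spectrumOf (blochOp s ε ω 0 u) =
        {z ∈ spectrumOf (blochOp s ε ω 0 u) | z.re < -1} ∪ {(lam : ℂ), 0, 0} ∧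
      ∀ z ∈ ({(lam : ℂ), 0, 0} : Set ℂ),
        algMultiplicity (blochOp s ε ω 0 u) z = Multiset.count z {(lam : ℂ), 0, 0} := by
  have hεp := hε.trans_lt (stabilityRange_mem hs).2
  have hε8 := mem_Icc_of_lt_patternRange h0.le hεp
  have hεl := le_landau_of_lt_patternRange hεp
  have hAb : |A| ≤ smallAmp s := by rwa [abs_of_pos hA0]
  have hAa := hAb.trans (smallAmp_le_ampBound s)
  have hAe := amp_le hs h0.le (sq_amp_mul_le hs hε8 hω hεl hAb hg h)
  have hΓ := bifCoeff_ge hs hε8 hω hεl hAb hg h.eq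
  have hp := pertConst_nonneg s
  have hC := eigenConst_nonneg s
  have hk := waveNumber_sq_mem hε8 hω
  -- One inequality serves two purposes: the smallness required by the Schur pencil, and the
  -- dominance of the quadratic term over the cubic error in the eigenvalue.
  have hAs : A * (256 * pertConst s + 4 * eigenConst s / landau s + 1) ≤ 1 := by
    have h1 := hε.trans (min_le_right _ _)
    have h2 : 0 < 256 * pertConst s + 4 * eigenConst s / landau s + 1 := by positivity
    rw [le_div_iff₀ h2] at h1
    calc _ ≤ 2 / landau s * ε * (256 * pertConst s + 4 * eigenConst s / landau s + 1) := by gcongr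
      _ = 2 / landau s * (ε * (256 * pertConst s + 4 * eigenConst s / landau s + 1)) := by ring
      _ ≤ 2 / landau s * (landau s / 2) := by gcongr
      _ = 1 := by field_simp
  have hq : 0 ≤ 4 * eigenConst s / landau s := by positivity
  have hs1 : 256 * (|A| * pertConst s) ≤ 1 := by rw [abs_of_pos hA0]; nlinarith
  have hs2 : A * eigenConst s ≤ landau s / 4 := by
    have h1 : A * (4 * eigenConst s / landau s) ≤ 1 := by nlinarith
    rw [← mul_div_assoc, div_le_one hs] at h1
    linarith
  obtain ⟨lam, xe, hlam, he, hest⟩ := h.exists_even_sector hε8 hω hAa hg hs1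
  rw [abs_of_pos hA0] at hest
  have hw := h.wienerBound_potential hε8 hω hAa hg
  have hue := h.reducedProfile.even hε8 hω
  have hwe := potential_even (s := s) hue
  have hpb := h.pertBound_le hε8 hω hAa hg
  -- The leading term has size at least `7/8 A² landau s`, the error at most `A² landau s / 4`.
  have hne : lam ≠ 0 := by
    have h1 := (abs_le.1 hest).2
    have h2 : 0 < A ^ 2 := by positivity
    have h3 : 7 / 8 * (A ^ 2 * (landau s / 2)) ≤
        waveNumber ε ω ^ 2 * (A ^ 2 * bifCoeff s A g) := by
      have := mul_le_mul_of_nonneg_left hΓ h2.le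
      exact mul_le_mul hk.1 this (by positivity) (by linarith [hk.1])
    have h4 : A ^ 3 * eigenConst s ≤ A ^ 2 * (landau s / 4) := by
      rw [pow_succ, mul_assoc]; exact mul_le_mul_of_nonneg_left hs2 h2.le
    have h5 : 0 < A ^ 2 * landau s := by positivity
    intro h6
    rw [h6] at h1
    linarith
  have hP := precond_blochOp s ε ω u (by rw [hu]; exact hw) (by rw [hu]; exact hue)
  rw [hu] at hP
  obtain ⟨μ, xo, -, ho, -⟩ := exists_sector (τ := -1) (by norm_num) hε8 hω hw hwe (by linarith)
  obtain ⟨v, hv, hLv, hv0⟩ := exists_translation_mode h.reducedProfile hε8 hω hA0.ne' hw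
  rw [ho.eigenvalue_eq_zero hv hLv hv0] at ho
  obtain ⟨w₀, hw0, hLw⟩ := exists_ker_mean_one hw hwe he (by exact_mod_cast hne)
  obtain ⟨hspec, hmult⟩ := hP.spectrum he ho (by simpa using hlam) hw0 hLw
  refine ⟨lam, hlam, ?_, hspec, hmult⟩
  have hβ : A ^ 2 * bifCoeff s A g = (1 - 4 * ω ^ 2) * ε ^ 2 := by rw [← h.bifurcation]; ring
  have hβ0 : 0 ≤ 1 - 4 * ω ^ 2 := by nlinarith [hω.1, hω.2]
  have hβ1 : 1 - 4 * ω ^ 2 ≤ 1 := by nlinarith [sq_nonneg ω]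
  have h1 : |(waveNumber ε ω ^ 2 - 1) * (2 * ((1 - 4 * ω ^ 2) * ε ^ 2))| ≤ 2 * ε ^ 3 := by
    rw [abs_mul, abs_of_nonneg (by positivity : 0 ≤ 2 * ((1 - 4 * ω ^ 2) * ε ^ 2))]
    calc _ ≤ ε * (2 * (1 * ε ^ 2)) := by
          gcongr
          exact abs_waveNumber_sq_sub_le hε8 hω
      _ = _ := by ring
  have h2 : A ^ 3 * eigenConst s ≤ (2 / landau s) ^ 3 * eigenConst s * ε ^ 3 := by
    calc _ ≤ (2 / landau s * ε) ^ 3 * eigenConst s := by gcongr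
      _ = _ := by ring
  have e : lam - -2 * (1 - 4 * ω ^ 2) * ε ^ 2 =
      (lam + waveNumber ε ω ^ 2 * (2 * A ^ 2 * bifCoeff s A g)) -
        (waveNumber ε ω ^ 2 - 1) * (2 * ((1 - 4 * ω ^ 2) * ε ^ 2)) := by
    rw [mul_assoc 2 (A ^ 2), hβ]; ring
  rw [e, expansionConst]
  refine (abs_sub _ _).trans ?_
  linarith

end MatthewsCox

end

/-! ### Co-periodic stability: existence, uniqueness and spectrum combined -/

theorem proposition3p2 (s : ℝ)
    (hs : s ∈ Set.Ioo (-Real.sqrt (27 / 2)) (Real.sqrt (27 / 2))) :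
    ∃ ε₀ > (0 : ℝ), ∃ r > (0 : ℝ),
      (∀ ε ∈ Set.Ico 0 ε₀, ∀ ω ∈ Set.Icc (-1 / 2 : ℝ) (1 / 2),
        ∃! u : MatthewsCox.RealH6, MatthewsCox.IsPattern s ε ω u ∧
          MatthewsCox.sobolevNorm 6 (MatthewsCox.toL2 u.1) < r) ∧
      ∃ ε₁ ∈ Set.Ioo 0 ε₀, ∃ δ > (0 : ℝ), ∃ C : ℝ,
        ∀ ε ∈ Set.Icc 0 ε₁, ∀ ω ∈ Set.Icc (-1 / 2 : ℝ) (1 / 2),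
        ∀ u : MatthewsCox.RealH6, MatthewsCox.IsPattern s ε ω u →
          MatthewsCox.sobolevNorm 6 (MatthewsCox.toL2 u.1) < r →
          ∃ (S : Set ℂ) (lam₁ lam₂ lam₃ : ℝ),
            MatthewsCox.spectrumOf (MatthewsCox.blochOp s ε ω 0 u) =
              S ∪ {(lam₁ : ℂ), (lam₂ : ℂ), (lam₃ : ℂ)} ∧
            (∀ z ∈ S, z.re < -δ) ∧
            -δ < lam₁ ∧
            |lam₁ - -2 * (1 - 4 * ω ^ 2) * ε ^ 2| ≤ C * ε ^ 3 ∧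
            lam₂ = 0 ∧ lam₃ = 0 ∧
            ∀ z ∈ ({(lam₁ : ℂ), (lam₂ : ℂ), (lam₃ : ℂ)} : Set ℂ),
              MatthewsCox.algMultiplicity (MatthewsCox.blochOp s ε ω 0 u) z =
                Multiset.count z {(lam₁ : ℂ), (lam₂ : ℂ), (lam₃ : ℂ)} := by
  have hl := MatthewsCox.landau_pos hs
  refine ⟨MatthewsCox.patternRange s, MatthewsCox.patternRange_pos hl,
    MatthewsCox.patternRadius s, MatthewsCox.patternRadius_pos hl,
    fun ε hε ω hω => MatthewsCox.existsUnique_pattern hl hε.1 hε.2 hω,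
    -- The gap `δ = 1` matches the half plane `Re z ≥ -1` of the Schur complement analysis; it does
    -- not depend on `s`.
    MatthewsCox.stabilityRange s, MatthewsCox.stabilityRange_mem hl, 1, one_pos,
    MatthewsCox.expansionConst s, ?_⟩
  intro ε hε ω hω u hu hr
  have hε8 := MatthewsCox.mem_Icc_of_lt_patternRange hε.1
    (hε.2.trans_lt (MatthewsCox.stabilityRange_mem hl).2)
  rcases hu.cases hε8 hω hr with ⟨htriv, hu0⟩ | ⟨h0, -, A, hA0, hA, g, hug, hg, hprof⟩
  · obtain ⟨h1, h2⟩ :=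
      MatthewsCox.spectral_splitting_of_zero (s := s) hε8 hω htriv hu0
    refine ⟨{z ∈ MatthewsCox.spectrumOf (MatthewsCox.blochOp s ε ω 0 u) | z.re < -1}, 0, 0, 0,
      by simpa only [Complex.ofReal_zero] using h1, fun z hz => hz.2, by norm_num,
      ?_, rfl, rfl, by simpa only [Complex.ofReal_zero] using h2⟩
    -- At the trivial state the leading term of the expansion vanishes, in agreement with the
    -- eigenvalue `0`.
    have h3 : -2 * (1 - 4 * ω ^ 2) * ε ^ 2 = 0 := by
      rcases htriv with h | h
      · rw [h]; ring
      · rw [← sq_abs ω, h]; ring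
    rw [h3, sub_zero, abs_zero]
    exact mul_nonneg (MatthewsCox.expansionConst_nonneg hl) (pow_nonneg hε.1 3)
  · obtain ⟨lam, hlam, hexp, h1, h2⟩ :=
      MatthewsCox.exists_spectral_splitting_of_scaledProfile hl h0 hε.2 hω hA0 hA hug hg hprof
    exact ⟨{z ∈ MatthewsCox.spectrumOf (MatthewsCox.blochOp s ε ω 0 u) | z.re < -1}, lam, 0, 0,
      by simpa only [Complex.ofReal_zero] using h1, fun z hz => hz.2, hlam, hexp,
      rfl, rfl, by simpa only [Complex.ofReal_zero] using h2⟩
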